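/- Let $(M^n,g)$ be a complete connected smooth Riemannian manifold that is a steady gradient Ricci soliton, i.e. there is a smooth function $f:M\to\mathbb{R}$ (the Ricci potential) with $\mathrm{Ric}=\nabla\nabla f$. Suppose that $g$ has positive sectional curvature, that the scalar curvature $R$ attains its maximum at a point $\mathcal{O}\in M$ with $R(\mathcal{O})=1$, and that $R(p)\to 0$ as $d(\mathcal{O},p)\to\infty$. Normalize $f$ so that $f(\mathcal{O})=0$. Then: (1) For every $\delta>0$ there is $\bar s=\bar s(\delta)>0$ such that for all $p\in M$ with $s:=d(\mathcal{O},p)\ge\bar s$, $$(1-\delta)\,s\le f(p)<s.$$ (2) The angle between the outward normal $N=\nabla f/|\nabla f|$ to the level sets of $f$ and the radial direction tends to zero uniformly at infinity: for every $\varepsilon>0$ there is $\bar s=\bar s(\varepsilon)>0$ such that for every unit-speed minimizing geodesic $\gamma:[0,s]\to M$ with $\gamma(0)=\mathcal{O}$ and $s\ge\bar s$, the angle between $N(\gamma(s))$ and $\gamma'(s)$ is less than $\varepsilon$. -/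

import Mathlib

open Set Filter Topology Bundle
open scoped Manifold ContDiff

noncomputable section

namespace GradientSoliton

variable {n : ℕ} {M : Type*} [TopologicalSpace M]
  [ChartedSpace (EuclideanSpace ℝ (Fin n)) M]

section Metric

variable (n)
variable [RiemannianBundle (fun x : M => TangentSpace (𝓡 n) x)]

/-- The metric tensor in the chart `φ` around `c`: at a point `y` of the model space it is
`g (dφ⁻¹ v, dφ⁻¹ w)`, the inner product being the one of the tangent space at `φ⁻¹ y`.
(It is the true coordinate expression of the metric on the open target of the chart.) -/
def chartMetric (c : M) (y : EuclideanSpace ℝ (Fin n)) :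
    EuclideanSpace ℝ (Fin n) →L[ℝ] EuclideanSpace ℝ (Fin n) →L[ℝ] ℝ :=
  (innerSL ℝ : TangentSpace (𝓡 n) ((extChartAt (𝓡 n) c).symm y) →L[ℝ]
      TangentSpace (𝓡 n) ((extChartAt (𝓡 n) c).symm y) →L[ℝ] ℝ).bilinearComp
    (mfderiv 𝓘(ℝ, EuclideanSpace ℝ (Fin n)) (𝓡 n) (extChartAt (𝓡 n) c).symm y)
    (mfderiv 𝓘(ℝ, EuclideanSpace ℝ (Fin n)) (𝓡 n) (extChartAt (𝓡 n) c).symm y)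

/-- The Christoffel symbol of the Levi-Civita connection in the chart around `c`, as the vector
`Γ(v, w) = Γᵏᵢⱼ vⁱ wʲ eₖ`. It is obtained from
`g (Γ(v, w), z) = ½ (∂ᵥ g (w, z) + ∂_w g (v, z) - ∂_z g (v, w))` by raising the index. -/
def christoffel (c : M) (y v w : EuclideanSpace ℝ (Fin n)) : EuclideanSpace ℝ (Fin n) :=
  (chartMetric n c y).inverse
    ((1 / 2 : ℝ) •
      (fderiv ℝ (chartMetric n c) y v w + fderiv ℝ (chartMetric n c) y w v
        - ((fderiv ℝ (chartMetric n c) y).flip v).flip w))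

/-- The curvature `R(u, v) w = ∇ᵤ ∇ᵥ w - ∇ᵥ ∇ᵤ w` in the chart around `c`, for the coordinate
vector fields with constant components `u`, `v`, `w` (which commute). -/
def chartCurvature (c : M) (y u v w : EuclideanSpace ℝ (Fin n)) : EuclideanSpace ℝ (Fin n) :=
  fderiv ℝ (fun x => christoffel n c x v w) y u
    - fderiv ℝ (fun x => christoffel n c x u w) y v
    + christoffel n c y u (christoffel n c y v w)
    - christoffel n c y v (christoffel n c y u w)

/-- The components of a tangent vector at `p` in the preferred chart around `p`. -/
def coords (p : M) (X : TangentSpace (𝓡 n) p) : EuclideanSpace ℝ (Fin n) :=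
  mfderiv (𝓡 n) 𝓘(ℝ, EuclideanSpace ℝ (Fin n)) (extChartAt (𝓡 n) p) p X

/-- The Riemann curvature tensor `g (R(X, Y) Z, W)` at `p`. -/
def riemann (p : M) (X Y Z W : TangentSpace (𝓡 n) p) : ℝ :=
  chartMetric n p (extChartAt (𝓡 n) p p)
    (chartCurvature n p (extChartAt (𝓡 n) p p) (coords n p X) (coords n p Y) (coords n p Z))
    (coords n p W)

/-- The sectional curvature of the plane spanned by `X` and `Y` (linearly independent). -/
def sectional (p : M) (X Y : TangentSpace (𝓡 n) p) : ℝ :=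
  riemann n p X Y Y X / (‖X‖ ^ 2 * ‖Y‖ ^ 2 - (inner ℝ X Y) ^ 2)

variable (M) in
/-- All sectional curvatures are positive. -/
def HasPositiveSectionalCurvature : Prop :=
  ∀ (p : M) (X Y : TangentSpace (𝓡 n) p), LinearIndependent ℝ ![X, Y] → 0 < sectional n p X Y

instance finiteDimensional_tangentSpace (p : M) :
    FiniteDimensional ℝ (TangentSpace (𝓡 n) p) :=
  inferInstanceAs (FiniteDimensional ℝ (EuclideanSpace ℝ (Fin n)))

/-- The Ricci tensor `Ric (X, Y) = ∑ᵢ g (R(eᵢ, X) Y, eᵢ)`, for an orthonormal basis `eᵢ` of the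
tangent space at `p`. -/
def ricci (p : M) (X Y : TangentSpace (𝓡 n) p) : ℝ :=
  ∑ i, riemann n p (stdOrthonormalBasis ℝ (TangentSpace (𝓡 n) p) i) X Y
    (stdOrthonormalBasis ℝ (TangentSpace (𝓡 n) p) i)

/-- The scalar curvature, the trace of the Ricci tensor. -/
def scalar (p : M) : ℝ :=
  ∑ i, ricci n p (stdOrthonormalBasis ℝ (TangentSpace (𝓡 n) p) i)
    (stdOrthonormalBasis ℝ (TangentSpace (𝓡 n) p) i)

/-- The gradient of `f` at `p`: the vector with `g (∇f, X) = df (X)` for all `X`. -/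
def grad (f : M → ℝ) (p : M) : TangentSpace (𝓡 n) p :=
  (InnerProductSpace.toDual ℝ (TangentSpace (𝓡 n) p)).symm (mfderiv (𝓡 n) 𝓘(ℝ, ℝ) f p)

/-- The outward normal `N = ∇f / |∇f|` to the level sets of `f`. -/
def outwardNormal (f : M → ℝ) (p : M) : TangentSpace (𝓡 n) p :=
  ‖grad n f p‖⁻¹ • grad n f p

/-- The Hessian `∇∇f (X, Y) = Xⁱ Yʲ (∂ᵢ∂ⱼ f - Γᵏᵢⱼ ∂ₖ f)` at `p`, computed in the chart
around `p`. -/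
def hessian (f : M → ℝ) (p : M) (X Y : TangentSpace (𝓡 n) p) : ℝ :=
  fderiv ℝ (fderiv ℝ (f ∘ (extChartAt (𝓡 n) p).symm)) (extChartAt (𝓡 n) p p)
      (coords n p X) (coords n p Y)
    - fderiv ℝ (f ∘ (extChartAt (𝓡 n) p).symm) (extChartAt (𝓡 n) p p)
      (christoffel n p (extChartAt (𝓡 n) p p) (coords n p X) (coords n p Y))

/-- The manifold is a (steady) gradient Ricci soliton with Ricci potential `f`:
`f` is smooth and `Ric = ∇∇f`. -/
structure IsGradientRicciSoliton (f : M → ℝ) : Prop where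
  smooth : ContMDiff (𝓡 n) 𝓘(ℝ, ℝ) ∞ f
  ricci_eq : ∀ (p : M) (X Y : TangentSpace (𝓡 n) p), ricci n p X Y = hessian n f p X Y

/-- The velocity vector of a curve. -/
def velocity (γ : ℝ → M) (t : ℝ) : TangentSpace (𝓡 n) (γ t) :=
  mfderiv 𝓘(ℝ, ℝ) (𝓡 n) γ t 1

/-- The covariant acceleration `∇_{γ'} γ'` of a curve at time `t`, expressed by its components
`(γᵏ)'' + Γᵏᵢⱼ (γⁱ)' (γʲ)'` in the chart around the point `γ t`. -/
def acceleration (γ : ℝ → M) (t : ℝ) : EuclideanSpace ℝ (Fin n) :=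
  deriv (deriv (extChartAt (𝓡 n) (γ t) ∘ γ)) t
    + christoffel n (γ t) (extChartAt (𝓡 n) (γ t) (γ t))
      (deriv (extChartAt (𝓡 n) (γ t) ∘ γ) t) (deriv (extChartAt (𝓡 n) (γ t) ∘ γ) t)

end Metric

/-- `γ` restricted to `[0, s]` is a minimizing geodesic parametrized by arc length: it is smooth,
solves the geodesic equation `∇_{γ'} γ' = 0`, has unit speed, and its length `s` is the distance of
its end points. -/
structure IsMinimizingGeodesic (n : ℕ) {M : Type*} [MetricSpace M]
    [ChartedSpace (EuclideanSpace ℝ (Fin n)) M]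
    [RiemannianBundle (fun x : M => TangentSpace (𝓡 n) x)] (γ : ℝ → M) (s : ℝ) : Prop where
  smooth : ∀ t ∈ Icc 0 s, ContMDiffAt 𝓘(ℝ, ℝ) (𝓡 n) ∞ γ t
  geodesic : ∀ t ∈ Icc 0 s, acceleration n γ t = 0
  unit_speed : ∀ t ∈ Icc 0 s, ‖velocity n γ t‖ = 1
  minimizing : dist (γ 0) (γ s) = s

end GradientSoliton

end

/-! The soliton equation and the contracted second Bianchi identity give `dR = -2 Ric(∇f, ·)`, while
`d|∇f|² = 2 Hess f(∇f, ·) = 2 Ric(∇f, ·)`. Hence `R + |∇f|²` is constant (`hamiltonQuantity_eq`). At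
`O` the differential of `R` vanishes, so `Ric(∇f, ∇f) = 0` there and positivity of Ricci forces
`∇f(O) = 0`. The constant is therefore `1`: `|∇f|² = 1 - R`, so `|∇f| < 1` everywhere and `|∇f| → 1`
at infinity.

Upper bound: `f` is `1`-Lipschitz, and its slope is at most `1/2` near `O`, so a definite amount is
lost on the way out (`exists_potential_lt_dist`).

Lower bound: fix `κ < 1`. The points with `|∇f| ≤ κ` lie in some ball of radius `s₀` about `O`. If
`q` minimizes `f + κ d(p, ·)`, then `|∇f(q)| ≤ κ`, so `q` is in that ball and `f(p) ≥ f(q) + κ d(p,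
q) ≥ κ (d(O, p) - s₀)` (`exists_mul_sub_le_potential`). This needs `f ≥ 0`, which comes from a
mountain pass argument (`nonneg_of_strictLocalMin`): every critical point of `f` is a strict local
minimum because `Hess f = Ric > 0`, so the component of `{f < c}` containing `O` can be continued
through every level without meeting another one. Existence of minimizing geodesics is never used;
almost minimizing curves and compactness of closed balls suffice.

Angle: along a geodesic from `O`, `f` is convex, so its final slope `⟨∇f, γ'⟩` is at least the
average slope `f(γ(s)) / s ≥ 1 - δ`. As `|∇f| < 1`, the cosine of the angle is at least this slope.

The tensor identities are proved for metrics on open subsets of a vector space, at a point where the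
metric has vanishing first derivatives, and carried to `M` by naturality under changes of
coordinates. -/

noncomputable section

set_option maxSynthPendingDepth 3
set_option synthInstance.maxHeartbeats 200000
set_option linter.unusedSectionVars false

namespace GradientSoliton


/-! ### Tensor calculus of a metric on an open set of a vector space, and its naturality under
pullback. -/

section Local

variable {E : Type*} [NormedAddCommGroup E] [NormedSpace ℝ E]

/-- The Christoffel symbol of a field `g` of bilinear forms on a vector space. -/
def christoffelOf (g : E → E →L[ℝ] E →L[ℝ] ℝ) (y v w : E) : E :=
  (g y).inverse ((1 / 2 : ℝ) •
    (fderiv ℝ g y v w + fderiv ℝ g y w v - ((fderiv ℝ g y).flip v).flip w))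

/-- The curvature of a field `g` of bilinear forms on a vector space. -/
def curvatureOf (g : E → E →L[ℝ] E →L[ℝ] ℝ) (y u v w : E) : E :=
  fderiv ℝ (fun x => christoffelOf g x v w) y u - fderiv ℝ (fun x => christoffelOf g x u w) y v
    + christoffelOf g y u (christoffelOf g y v w) - christoffelOf g y v (christoffelOf g y u w)

/-- The Hessian of `F` with respect to a field `g` of bilinear forms on a vector space. -/
def hessianOf (g : E → E →L[ℝ] E →L[ℝ] ℝ) (F : E → ℝ) (y u v : E) : ℝ :=
  fderiv ℝ (fderiv ℝ F) y u v - fderiv ℝ F y (christoffelOf g y u v)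

/-- `g` is a smooth Riemannian metric on the open set `U`. -/
structure IsMetricOn (g : E → E →L[ℝ] E →L[ℝ] ℝ) (U : Set E) : Prop where
  isOpen : IsOpen U
  smooth : ContDiffOn ℝ ∞ g U
  symm : ∀ x ∈ U, ∀ v w, g x v w = g x w v
  pos : ∀ x ∈ U, ∀ v, v ≠ 0 → 0 < g x v v

/-- The Christoffel symbol with lowered index, as a bundled bilinear map into the dual. -/
def christoffelLower (g : E → E →L[ℝ] E →L[ℝ] ℝ) (y : E) : E →L[ℝ] E →L[ℝ] E →L[ℝ] ℝ :=
  (1 / 2 : ℝ) • (fderiv ℝ g y + (fderiv ℝ g y).flip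
    - (ContinuousLinearMap.flipₗᵢ ℝ E E ℝ).toContinuousLinearEquiv.toContinuousLinearMap.comp
        (fderiv ℝ g y).flip)

/-- The Christoffel symbol as a bundled bilinear map. -/
def christoffelMap (g : E → E →L[ℝ] E →L[ℝ] ℝ) (y : E) : E →L[ℝ] E →L[ℝ] E :=
  (ContinuousLinearMap.compL ℝ E (E →L[ℝ] ℝ) E (g y).inverse).comp (christoffelLower g y)

lemma christoffelLower_apply (g : E → E →L[ℝ] E →L[ℝ] ℝ) (y v w : E) :
    christoffelLower g y v w = (1 / 2 : ℝ) •
      (fderiv ℝ g y v w + fderiv ℝ g y w v - ((fderiv ℝ g y).flip v).flip w) := by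
  ext z
  simp [christoffelLower]

lemma christoffelMap_apply (g : E → E →L[ℝ] E →L[ℝ] ℝ) (y v w : E) :
    christoffelMap g y v w = christoffelOf g y v w := by
  simp only [christoffelMap, ContinuousLinearMap.comp_apply, ContinuousLinearMap.compL_apply,
    christoffelLower_apply, christoffelOf]

lemma minSmoothness_two_le : minSmoothness ℝ 2 ≤ ∞ := by
  simpa using (by decide : (2 : ℕ∞ω) ≤ ∞)

lemma fderiv_bilinear_apply {F G : Type*} [NormedAddCommGroup F] [NormedSpace ℝ F]
    [NormedAddCommGroup G] [NormedSpace ℝ G] {A : E → F →L[ℝ] F →L[ℝ] G} {a b : E → F} {x : E}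
    (hA : DifferentiableAt ℝ A x) (ha : DifferentiableAt ℝ a x) (hb : DifferentiableAt ℝ b x)
    (u : E) :
    fderiv ℝ (fun x => A x (a x) (b x)) x u
      = fderiv ℝ A x u (a x) (b x) + A x (fderiv ℝ a x u) (b x) + A x (a x) (fderiv ℝ b x u) := by
  have h := ((hA.hasFDerivAt.clm_apply ha.hasFDerivAt).clm_apply hb.hasFDerivAt).fderiv
  rw [h]
  simp
  abel

lemma fderiv_clm_apply' {F G : Type*} [NormedAddCommGroup F] [NormedSpace ℝ F]
    [NormedAddCommGroup G] [NormedSpace ℝ G] {A : E → F →L[ℝ] G} {a : E → F} {x : E}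
    (hA : DifferentiableAt ℝ A x) (ha : DifferentiableAt ℝ a x) (u : E) :
    fderiv ℝ (fun x => A x (a x)) x u = fderiv ℝ A x u (a x) + A x (fderiv ℝ a x u) := by
  rw [(hA.hasFDerivAt.clm_apply ha.hasFDerivAt).fderiv]
  simp
  abel

namespace IsMetricOn

variable {g h : E → E →L[ℝ] E →L[ℝ] ℝ} {U V : Set E}

lemma contDiffAt (hg : IsMetricOn g U) {x : E} (hx : x ∈ U) : ContDiffAt ℝ ∞ g x :=
  hg.smooth.contDiffAt (hg.isOpen.mem_nhds hx)

lemma mono (hg : IsMetricOn g U) (hV : IsOpen V) (hVU : V ⊆ U) : IsMetricOn g V :=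
  ⟨hV, hg.smooth.mono hVU, fun x hx => hg.symm x (hVU hx), fun x hx => hg.pos x (hVU hx)⟩

lemma eq_of_forall (hg : IsMetricOn g U) {x : E} (hx : x ∈ U) {v w : E}
    (H : ∀ z, g x v z = g x w z) : v = w := by
  by_contra hne
  have h1 := hg.pos x hx (v - w) (sub_ne_zero.mpr hne)
  have h2 : g x (v - w) (v - w) = 0 := by
    rw [map_sub]
    simp [H]
  exact h1.ne' h2

lemma contDiffAt_fderiv (hg : IsMetricOn g U) {x : E} (hx : x ∈ U) :
    ContDiffAt ℝ ∞ (fderiv ℝ g) x :=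
  (hg.contDiffAt hx).fderiv_right (by simp)

variable [FiniteDimensional ℝ E]

lemma isInvertible (hg : IsMetricOn g U) {x : E} (hx : x ∈ U) : (g x).IsInvertible := by
  have hinj : Function.Injective (g x : E →ₗ[ℝ] E →L[ℝ] ℝ) := by
    intro v w hvw
    exact hg.eq_of_forall hx fun z => by
      have : g x v = g x w := hvw
      rw [this]
  have hfin : Module.finrank ℝ E = Module.finrank ℝ (E →L[ℝ] ℝ) := by
    rw [← (LinearMap.toContinuousLinearMap (𝕜 := ℝ) (E := E) (F' := ℝ)).finrank_eq]
    exact (Subspace.dual_finrank_eq (K := ℝ) (V := E)).symm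
  let e := LinearEquiv.ofInjectiveOfFinrankEq (g x : E →ₗ[ℝ] E →L[ℝ] ℝ) hinj hfin
  exact ⟨e.toContinuousLinearEquiv, by ext; rfl⟩

lemma apply_inverse (hg : IsMetricOn g U) {x : E} (hx : x ∈ U) (l : E →L[ℝ] ℝ) :
    g x ((g x).inverse l) = l :=
  (hg.isInvertible hx).self_apply_inverse l

lemma apply_christoffelOf (hg : IsMetricOn g U) {x : E} (hx : x ∈ U) (v w z : E) :
    g x (christoffelOf g x v w) z
      = (1 / 2 : ℝ) * (fderiv ℝ g x v w z + fderiv ℝ g x w v z - fderiv ℝ g x z v w) := by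
  rw [christoffelOf, hg.apply_inverse hx]
  simp

lemma contDiffAt_inverse (hg : IsMetricOn g U) {x : E} (hx : x ∈ U) :
    ContDiffAt ℝ ∞ (fun y => (g y).inverse) x := by
  have : CompleteSpace E := FiniteDimensional.complete ℝ E
  exact ((hg.isInvertible hx).contDiffAt_map_inverse).comp x (hg.contDiffAt hx)

lemma contDiffAt_christoffelMap (hg : IsMetricOn g U) {x : E} (hx : x ∈ U) :
    ContDiffAt ℝ ∞ (christoffelMap g) x := by
  have h1 := hg.contDiffAt_inverse hx
  have h2 := hg.contDiffAt_fderiv hx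
  have h3 : ContDiffAt ℝ ∞ (fun y => (fderiv ℝ g y).flip) x :=
    (ContinuousLinearMap.flipₗᵢ ℝ E E (E →L[ℝ] ℝ)).toContinuousLinearEquiv.contDiff.contDiffAt.comp
      x h2
  have h4 : ContDiffAt ℝ ∞ (christoffelLower g) x := by
    unfold christoffelLower
    exact ((h2.add h3).sub (contDiffAt_const.clm_comp h3)).const_smul _
  unfold christoffelMap
  exact ((ContinuousLinearMap.contDiff _).contDiffAt.comp x h1).clm_comp h4

lemma christoffelOf_symm (hg : IsMetricOn g U) {x : E} (hx : x ∈ U) (v w : E) :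
    christoffelOf g x v w = christoffelOf g x w v := by
  refine hg.eq_of_forall hx fun z => ?_
  rw [hg.apply_christoffelOf hx, hg.apply_christoffelOf hx]
  have key : fderiv ℝ g x z v w = fderiv ℝ g x z w v := by
    have hd := (hg.contDiffAt hx).differentiableAt (by simp)
    have e : (fun y => g y v w) =ᶠ[𝓝 x] fun y => g y w v := by
      filter_upwards [hg.isOpen.mem_nhds hx] with y hy using hg.symm y hy v w
    have e1 := e.fderiv_eq (𝕜 := ℝ)
    have e2 := fun a b => fderiv_bilinear_apply (b := fun _ => b) hd
      (differentiableAt_const (c := a)) (differentiableAt_const (c := b)) z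
    have e3 := e2 v w
    rw [e1, e2 w v] at e3
    simpa using e3.symm
  rw [key]
  ring

/-- With the derivative of the bundled Christoffel map in place of derivatives of its values, the
curvature can be differentiated again and its linearity in each slot is visible. -/
lemma curvatureOf_eq (hg : IsMetricOn g U) {x : E} (hx : x ∈ U) (u v w : E) :
    curvatureOf g x u v w = fderiv ℝ (christoffelMap g) x u v w - fderiv ℝ (christoffelMap g) x v u w
      + christoffelMap g x u (christoffelMap g x v w)
      - christoffelMap g x v (christoffelMap g x u w) := by
  have hd := (hg.contDiffAt_christoffelMap hx).differentiableAt (by simp)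
  have key : ∀ a b c, fderiv ℝ (fun y => christoffelOf g y b c) x a
      = fderiv ℝ (christoffelMap g) x a b c := fun a b c => by
    have := fderiv_bilinear_apply hd (differentiableAt_const (c := b))
      (differentiableAt_const (c := c)) a
    simpa only [christoffelMap_apply, fderiv_fun_const, Pi.zero_apply, zero_apply, map_zero,
      add_zero] using this
  simp only [curvatureOf, key, christoffelMap_apply]

end IsMetricOn

/-- `h` is the pullback of `g` under the map `ψ`, smooth on `U`. -/
structure IsPullbackOn (g h : E → E →L[ℝ] E →L[ℝ] ℝ) (ψ : E → E) (U V : Set E) : Prop where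
  smooth : ContDiffOn ℝ ∞ ψ U
  mapsTo : MapsTo ψ U V
  eq : ∀ x ∈ U, ∀ v w, h x v w = g (ψ x) (fderiv ℝ ψ x v) (fderiv ℝ ψ x w)

namespace IsPullbackOn

variable {g h : E → E →L[ℝ] E →L[ℝ] ℝ} {ψ : E → E} {U V : Set E}

lemma fderiv_injective (hψ : IsPullbackOn g h ψ U V) (hh : IsMetricOn h U) {x : E} (hx : x ∈ U) :
    Function.Injective (fderiv ℝ ψ x) := by
  intro v w hvw
  exact hh.eq_of_forall hx fun z => by rw [hψ.eq x hx, hψ.eq x hx, hvw]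

lemma contDiffAt (hψ : IsPullbackOn g h ψ U V) (hh : IsMetricOn h U) {x : E} (hx : x ∈ U) :
    ContDiffAt ℝ ∞ ψ x :=
  hψ.smooth.contDiffAt (hh.isOpen.mem_nhds hx)

lemma fderiv_metric (hψ : IsPullbackOn g h ψ U V) (hg : IsMetricOn g V) (hh : IsMetricOn h U)
    {x : E} (hx : x ∈ U) (a b c : E) :
    fderiv ℝ h x a b c
      = fderiv ℝ g (ψ x) (fderiv ℝ ψ x a) (fderiv ℝ ψ x b) (fderiv ℝ ψ x c)
        + g (ψ x) (fderiv ℝ (fderiv ℝ ψ) x a b) (fderiv ℝ ψ x c)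
        + g (ψ x) (fderiv ℝ ψ x b) (fderiv ℝ (fderiv ℝ ψ) x a c) := by
  have hψx := hψ.contDiffAt hh hx
  have hdψ : DifferentiableAt ℝ ψ x := hψx.differentiableAt (by simp)
  have hd2 : DifferentiableAt ℝ (fderiv ℝ ψ) x :=
    (hψx.fderiv_right (m := ∞) (by simp)).differentiableAt (by simp)
  have hdg : DifferentiableAt ℝ g (ψ x) :=
    (hg.contDiffAt (hψ.mapsTo hx)).differentiableAt (by simp)
  have e : (fun y => h y b c) =ᶠ[𝓝 x]
      fun y => (g ∘ ψ) y (fderiv ℝ ψ y b) (fderiv ℝ ψ y c) := by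
    filter_upwards [hh.isOpen.mem_nhds hx] with y hy using hψ.eq y hy b c
  have e1 := e.fderiv_eq (𝕜 := ℝ)
  have e2 := fderiv_bilinear_apply ((hh.contDiffAt hx).differentiableAt (by simp))
    (differentiableAt_const (c := b)) (differentiableAt_const (c := c)) a
  have e3 := fun v : E => fderiv_clm_apply' hd2 (differentiableAt_const (c := v)) a
  have e4 := fderiv_bilinear_apply (hdg.comp x hdψ) (hd2.clm_apply (differentiableAt_const (c := b)))
    (hd2.clm_apply (differentiableAt_const (c := c))) a
  rw [e1, e4, fderiv_comp x hdg hdψ, e3, e3] at e2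
  simp only [fderiv_fun_const, Pi.zero_apply, zero_apply, map_zero,
    add_zero, Function.comp_apply, ContinuousLinearMap.comp_apply] at e2
  exact e2.symm

lemma fderiv_fderiv_symm (hψ : IsPullbackOn g h ψ U V) (hh : IsMetricOn h U)
    {x : E} (hx : x ∈ U) (a b : E) :
    fderiv ℝ (fderiv ℝ ψ) x a b = fderiv ℝ (fderiv ℝ ψ) x b a :=
  ((hψ.contDiffAt hh hx).isSymmSndFDerivAt minSmoothness_two_le).eq a b

variable [FiniteDimensional ℝ E]

lemma fderiv_surjective (hψ : IsPullbackOn g h ψ U V) (hh : IsMetricOn h U) {x : E} (hx : x ∈ U) :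
    Function.Surjective (fderiv ℝ ψ x) :=
  LinearMap.surjective_of_injective (f := (fderiv ℝ ψ x : E →ₗ[ℝ] E)) (hψ.fderiv_injective hh hx)

/-- Both sides are tested against `dψ z`. The Koszul formula for `h` and the product rule for `h =
ψ*g` leave the Koszul formula for `g`, plus second-derivative terms of which symmetry of `D²ψ`
cancels all but one. -/
lemma map_christoffel (hψ : IsPullbackOn g h ψ U V) (hg : IsMetricOn g V) (hh : IsMetricOn h U)
    {x : E} (hx : x ∈ U) (v w : E) :
    fderiv ℝ ψ x (christoffelOf h x v w) = fderiv ℝ (fderiv ℝ ψ) x v w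
      + christoffelOf g (ψ x) (fderiv ℝ ψ x v) (fderiv ℝ ψ x w) := by
  refine hg.eq_of_forall (hψ.mapsTo hx) fun z => ?_
  obtain ⟨z, rfl⟩ := hψ.fderiv_surjective hh hx z
  rw [← hψ.eq x hx, hh.apply_christoffelOf hx, map_add, add_apply,
    hg.apply_christoffelOf (hψ.mapsTo hx), hψ.fderiv_metric hg hh hx, hψ.fderiv_metric hg hh hx,
    hψ.fderiv_metric hg hh hx, hψ.fderiv_fderiv_symm hh hx w v, hψ.fderiv_fderiv_symm hh hx z v,
    hψ.fderiv_fderiv_symm hh hx z w,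
    hg.symm _ (hψ.mapsTo hx) (fderiv ℝ ψ x w) (fderiv ℝ (fderiv ℝ ψ) x v z)]
  ring

/-- The transformation law of the Christoffel symbol is differentiated once more. The third
derivative of `ψ` is symmetric in `u, v` and drops out on antisymmetrization; the second-derivative
terms cancel against those coming from the quadratic part of the curvature. -/
lemma map_curvature (hψ : IsPullbackOn g h ψ U V) (hg : IsMetricOn g V) (hh : IsMetricOn h U)
    {x : E} (hx : x ∈ U) (u v w : E) :
    fderiv ℝ ψ x (curvatureOf h x u v w)
      = curvatureOf g (ψ x) (fderiv ℝ ψ x u) (fderiv ℝ ψ x v) (fderiv ℝ ψ x w) := by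
  have hψx := hψ.contDiffAt hh hx
  have hdψ : DifferentiableAt ℝ ψ x := hψx.differentiableAt (by simp)
  have hc2 : ContDiffAt ℝ ∞ (fderiv ℝ ψ) x := hψx.fderiv_right (m := ∞) (by simp)
  have hd2 : DifferentiableAt ℝ (fderiv ℝ ψ) x := hc2.differentiableAt (by simp)
  have hd3 : DifferentiableAt ℝ (fderiv ℝ (fderiv ℝ ψ)) x :=
    (hc2.fderiv_right (m := ∞) (by simp)).differentiableAt (by simp)
  have hdG : DifferentiableAt ℝ (christoffelMap g) (ψ x) :=
    (hg.contDiffAt_christoffelMap (hψ.mapsTo hx)).differentiableAt (by simp)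
  have hdH : DifferentiableAt ℝ (christoffelMap h) x :=
    (hh.contDiffAt_christoffelMap hx).differentiableAt (by simp)
  have I1 : ∀ a b, fderiv ℝ ψ x (christoffelMap h x a b) = fderiv ℝ (fderiv ℝ ψ) x a b
      + christoffelMap g (ψ x) (fderiv ℝ ψ x a) (fderiv ℝ ψ x b) := fun a b => by
    simpa only [christoffelMap_apply] using hψ.map_christoffel hg hh hx a b
  have e3 := fun a b : E => fderiv_clm_apply' hd2 (differentiableAt_const (c := b)) a
  have I2 : ∀ a b c : E, fderiv ℝ (fderiv ℝ ψ) x a (christoffelMap h x b c)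
      + fderiv ℝ ψ x (fderiv ℝ (christoffelMap h) x a b c)
      = fderiv ℝ (fderiv ℝ (fderiv ℝ ψ)) x a b c
        + (fderiv ℝ (christoffelMap g) (ψ x) (fderiv ℝ ψ x a) (fderiv ℝ ψ x b) (fderiv ℝ ψ x c)
        + christoffelMap g (ψ x) (fderiv ℝ (fderiv ℝ ψ) x a b) (fderiv ℝ ψ x c)
        + christoffelMap g (ψ x) (fderiv ℝ ψ x b) (fderiv ℝ (fderiv ℝ ψ) x a c)) := by
    intro a b c
    have e : (fun y => fderiv ℝ ψ y (christoffelMap h y b c)) =ᶠ[𝓝 x]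
        fun y => fderiv ℝ (fderiv ℝ ψ) y b c
          + (christoffelMap g ∘ ψ) y (fderiv ℝ ψ y b) (fderiv ℝ ψ y c) := by
      filter_upwards [hh.isOpen.mem_nhds hx] with y hy
      simpa only [christoffelMap_apply, Function.comp_apply] using hψ.map_christoffel hg hh hy b c
    have hH : DifferentiableAt ℝ (fun y => christoffelMap h y b c) x :=
      (hdH.clm_apply (differentiableAt_const (c := b))).clm_apply (differentiableAt_const (c := c))
    have h3 : DifferentiableAt ℝ (fun y => fderiv ℝ (fderiv ℝ ψ) y b c) x :=
      (hd3.clm_apply (differentiableAt_const (c := b))).clm_apply (differentiableAt_const (c := c))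
    have hb := hd2.clm_apply (differentiableAt_const (c := b))
    have hc := hd2.clm_apply (differentiableAt_const (c := c))
    have hG := hdG.comp x hdψ
    have e1 : fderiv ℝ (fun y => fderiv ℝ ψ y (christoffelMap h y b c)) x a
        = fderiv ℝ (fun y => fderiv ℝ (fderiv ℝ ψ) y b c) x a
          + fderiv ℝ (fun y => (christoffelMap g ∘ ψ) y (fderiv ℝ ψ y b) (fderiv ℝ ψ y c)) x a := by
      rw [e.fderiv_eq, fderiv_fun_add h3 ((hG.clm_apply hb).clm_apply hc)]
      rfl
    rw [fderiv_clm_apply' hd2 hH,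
      fderiv_bilinear_apply hdH (differentiableAt_const (c := b)) (differentiableAt_const (c := c)),
      fderiv_bilinear_apply hd3 (differentiableAt_const (c := b)) (differentiableAt_const (c := c)),
      fderiv_bilinear_apply hG hb hc, fderiv_comp x hdG hdψ, e3, e3] at e1
    simpa only [fderiv_fun_const, Pi.zero_apply, zero_apply, map_zero,
      add_zero, Function.comp_apply, ContinuousLinearMap.comp_apply] using e1
  have S3 : fderiv ℝ (fderiv ℝ (fderiv ℝ ψ)) x u v = fderiv ℝ (fderiv ℝ (fderiv ℝ ψ)) x v u :=
    (hc2.isSymmSndFDerivAt minSmoothness_two_le).eq u v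
  have J1 := eq_sub_of_add_eq' (I2 u v w)
  have J2 := eq_sub_of_add_eq' (I2 v u w)
  rw [hh.curvatureOf_eq hx, hg.curvatureOf_eq (hψ.mapsTo hx), map_sub, map_add, map_sub, J1, J2,
    I1 u (christoffelMap h x v w), I1 v (christoffelMap h x u w), I1 v w, I1 u w, S3,
    hψ.fderiv_fderiv_symm hh hx v u]
  simp only [map_add]
  abel

/-- The chain rule adds `dF (D²ψ(u, v))` to the second derivative, and the inhomogeneous term in
`map_christoffel` removes exactly this. -/
lemma hessianOf_comp (hψ : IsPullbackOn g h ψ U V) (hg : IsMetricOn g V) (hh : IsMetricOn h U)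
    {F : E → ℝ} (hF : ContDiffOn ℝ ∞ F V) {x : E} (hx : x ∈ U) (u v : E) :
    hessianOf h (F ∘ ψ) x u v = hessianOf g F (ψ x) (fderiv ℝ ψ x u) (fderiv ℝ ψ x v) := by
  have hψd : ∀ y ∈ U, DifferentiableAt ℝ ψ y := fun y hy =>
    (hψ.contDiffAt hh hy).differentiableAt (by simp)
  have hFc : ∀ y ∈ V, ContDiffAt ℝ ∞ F y := fun y hy => hF.contDiffAt (hg.isOpen.mem_nhds hy)
  have hFd : ∀ y ∈ V, DifferentiableAt ℝ F y := fun y hy => (hFc y hy).differentiableAt (by simp)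
  have hd2 : DifferentiableAt ℝ (fderiv ℝ ψ) x :=
    ((hψ.contDiffAt hh hx).fderiv_right (m := ∞) (by simp)).differentiableAt (by simp)
  have hF2 : DifferentiableAt ℝ (fderiv ℝ F) (ψ x) :=
    ((hFc _ (hψ.mapsTo hx)).fderiv_right (m := ∞) (by simp)).differentiableAt (by simp)
  have e : fderiv ℝ (F ∘ ψ) =ᶠ[𝓝 x] fun y => ((fderiv ℝ F ∘ ψ) y).comp (fderiv ℝ ψ y) := by
    filter_upwards [hh.isOpen.mem_nhds hx] with y hy
    rw [fderiv_comp y (hFd _ (hψ.mapsTo hy)) (hψd y hy)]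
    rfl
  have e2 : fderiv ℝ (fderiv ℝ (F ∘ ψ)) x u v
      = fderiv ℝ (fderiv ℝ F) (ψ x) (fderiv ℝ ψ x u) (fderiv ℝ ψ x v)
        + fderiv ℝ F (ψ x) (fderiv ℝ (fderiv ℝ ψ) x u v) := by
    rw [e.fderiv_eq, ((hF2.comp x (hψd x hx)).hasFDerivAt.clm_comp hd2.hasFDerivAt).fderiv,
      fderiv_comp x hF2 (hψd x hx)]
    simp [add_comm]
  rw [hessianOf, hessianOf, e2, e.self_of_nhds, ContinuousLinearMap.comp_apply,
    hψ.map_christoffel hg hh hx, map_add]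
  simp only [Function.comp_apply]
  ring

end IsPullbackOn

end Local


/-! ### The contracted second Bianchi identity at a normal point. -/

section NormalPoint

lemma fderiv_apply_const {E F G : Type*} [NormedAddCommGroup E] [NormedSpace ℝ E]
    [NormedAddCommGroup F] [NormedSpace ℝ F] [NormedAddCommGroup G] [NormedSpace ℝ G]
    {A : E → F →L[ℝ] G} {x : E} (hA : DifferentiableAt ℝ A x) (v : F) (u : E) :
    fderiv ℝ (fun y => A y v) x u = fderiv ℝ A x u v := by
  have := fderiv_clm_apply' hA (differentiableAt_const (c := v)) u
  simpa using this

lemma fderiv_half_mul_add_sub {E : Type*} [NormedAddCommGroup E] [NormedSpace ℝ E]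
    {p q r : E → ℝ} {x : E} (hp : DifferentiableAt ℝ p x) (hq : DifferentiableAt ℝ q x)
    (hr : DifferentiableAt ℝ r x) (a : E) :
    fderiv ℝ (fun y => (1 / 2 : ℝ) * (p y + q y - r y)) x a
      = (1 / 2 : ℝ) * (fderiv ℝ p x a + fderiv ℝ q x a - fderiv ℝ r x a) := by
  rw [(((hp.hasFDerivAt.fun_add hq.hasFDerivAt).fun_sub hr.hasFDerivAt).const_mul (1 / 2 : ℝ)).fderiv]
  simp

variable {E : Type*} [NormedAddCommGroup E] [InnerProductSpace ℝ E] [FiniteDimensional ℝ E]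
  {ι : Type*} [Fintype ι]

/-- The Ricci tensor of a field of bilinear forms, as the trace of the curvature. -/
def ricciOf (e : OrthonormalBasis ι ℝ E) (g : E → E →L[ℝ] E →L[ℝ] ℝ) (y u v : E) : ℝ :=
  ∑ a, inner ℝ (e a) (curvatureOf g y (e a) u v)

/-- `x` is the centre of normal coordinates, up to first order. -/
structure IsNormalAt (h : E → E →L[ℝ] E →L[ℝ] ℝ) (x : E) : Prop where
  eq_inner : ∀ v w, h x v w = inner ℝ v w
  fderiv_eq : fderiv ℝ h x = 0

namespace IsNormalAt

variable {h : E → E →L[ℝ] E →L[ℝ] ℝ} {U : Set E} {x : E} {F : E → ℝ}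


lemma christoffelMap_eq (hx : IsNormalAt h x) : christoffelMap h x = 0 := by
  ext v w
  simp [christoffelMap_apply, christoffelOf, hx.fderiv_eq]

lemma contDiffAt_fderiv_christoffelMap (hh : IsMetricOn h U) (hU : x ∈ U) :
    ContDiffAt ℝ ∞ (fderiv ℝ (christoffelMap h)) x :=
  (hh.contDiffAt_christoffelMap hU).fderiv_right (by simp)

/-- The Koszul formula, differentiated once. Normality is not assumed, so the identity holds
throughout `U` and can be differentiated a second time. -/
lemma fderiv_apply_christoffelMap (hh : IsMetricOn h U) (hU : x ∈ U) (a u v z : E) :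
    fderiv ℝ h x a (christoffelMap h x u v) z + h x (fderiv ℝ (christoffelMap h) x a u v) z
      = (1 / 2 : ℝ) * (fderiv ℝ (fderiv ℝ h) x a u v z + fderiv ℝ (fderiv ℝ h) x a v u z
        - fderiv ℝ (fderiv ℝ h) x a z u v) := by
  have hd := (hh.contDiffAt hU).differentiableAt (by simp)
  have hd1 := (hh.contDiffAt_fderiv hU).differentiableAt (by simp)
  have hdG := (hh.contDiffAt_christoffelMap hU).differentiableAt (by simp)
  have e : (fun y => h y (christoffelMap h y u v) z) =ᶠ[𝓝 x] fun y => (1 / 2 : ℝ) *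
      (fderiv ℝ h y u v z + fderiv ℝ h y v u z - fderiv ℝ h y z u v) := by
    filter_upwards [hh.isOpen.mem_nhds hU] with y hy
    rw [christoffelMap_apply, hh.apply_christoffelOf hy]
  have k2 : ∀ p q r : E, DifferentiableAt ℝ (fun y => fderiv ℝ h y p q r) x := fun p q r =>
    ((hd1.clm_apply (differentiableAt_const p)).clm_apply (differentiableAt_const q)).clm_apply
      (differentiableAt_const r)
  have k3 : ∀ p q r : E, fderiv ℝ (fun y => fderiv ℝ h y p q r) x a
      = fderiv ℝ (fderiv ℝ h) x a p q r := fun p q r => by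
    rw [fderiv_apply_const ((hd1.clm_apply (differentiableAt_const p)).clm_apply
      (differentiableAt_const q)), fderiv_apply_const (hd1.clm_apply (differentiableAt_const p)),
      fderiv_apply_const hd1]
  have hGuv : DifferentiableAt ℝ (fun y => christoffelMap h y u v) x :=
    (hdG.clm_apply (differentiableAt_const u)).clm_apply (differentiableAt_const v)
  have e1 : fderiv ℝ (fun y => h y (christoffelMap h y u v) z) x a
      = (1 / 2 : ℝ) * (fderiv ℝ (fderiv ℝ h) x a u v z + fderiv ℝ (fderiv ℝ h) x a v u z
        - fderiv ℝ (fderiv ℝ h) x a z u v) := by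
    rw [e.fderiv_eq, fderiv_half_mul_add_sub (k2 u v z) (k2 v u z) (k2 z u v), k3, k3, k3]
  rw [fderiv_apply_const (hd.clm_apply hGuv), fderiv_clm_apply' hd hGuv,
    fderiv_apply_const (hdG.clm_apply (differentiableAt_const u)), fderiv_apply_const hdG] at e1
  simpa using e1

lemma inner_fderiv_christoffelMap (hx : IsNormalAt h x) (hh : IsMetricOn h U) (hU : x ∈ U)
    (a u v z : E) : inner ℝ z (fderiv ℝ (christoffelMap h) x a u v)
      = (1 / 2 : ℝ) * (fderiv ℝ (fderiv ℝ h) x a u v z + fderiv ℝ (fderiv ℝ h) x a v u z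
        - fderiv ℝ (fderiv ℝ h) x a z u v) := by
  rw [← fderiv_apply_christoffelMap hh hU, hx.eq_inner, real_inner_comm, hx.fderiv_eq]
  simp

set_option maxHeartbeats 800000 in
-- All products with a factor `Γ` or `Dh` vanish at a normal point, so the second derivative of the
-- Koszul formula reduces to third derivatives of the metric.
lemma inner_fderiv_fderiv_christoffelMap (hx : IsNormalAt h x) (hh : IsMetricOn h U) (hU : x ∈ U)
    (c a u v z : E) : inner ℝ z (fderiv ℝ (fderiv ℝ (christoffelMap h)) x c a u v)
      = (1 / 2 : ℝ) * (fderiv ℝ (fderiv ℝ (fderiv ℝ h)) x c a u v z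
        + fderiv ℝ (fderiv ℝ (fderiv ℝ h)) x c a v u z
        - fderiv ℝ (fderiv ℝ (fderiv ℝ h)) x c a z u v) := by
  have hd := (hh.contDiffAt hU).differentiableAt (by simp)
  have hc1 := hh.contDiffAt_fderiv hU
  have hd1 := hc1.differentiableAt (by simp)
  have hd2 : DifferentiableAt ℝ (fderiv ℝ (fderiv ℝ h)) x :=
    (hc1.fderiv_right (m := ∞) (by simp)).differentiableAt (by simp)
  have hdG := (hh.contDiffAt_christoffelMap hU).differentiableAt (by simp)
  have hdG1 := (contDiffAt_fderiv_christoffelMap hh hU).differentiableAt (by simp)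
  have cst : ∀ v : E, DifferentiableAt ℝ (fun _ : E => v) x := differentiableAt_const
  have e : (fun y => fderiv ℝ h y a (christoffelMap h y u v) z
      + h y (fderiv ℝ (christoffelMap h) y a u v) z) =ᶠ[𝓝 x] fun y => (1 / 2 : ℝ) *
      (fderiv ℝ (fderiv ℝ h) y a u v z + fderiv ℝ (fderiv ℝ h) y a v u z
        - fderiv ℝ (fderiv ℝ h) y a z u v) := by
    filter_upwards [hh.isOpen.mem_nhds hU] with y hy
    exact fderiv_apply_christoffelMap hh hy a u v z
  have k1 : ∀ p q : E, DifferentiableAt ℝ (fun y => fderiv ℝ (fderiv ℝ h) y a p q) x := fun p q =>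
    ((hd2.clm_apply (cst a)).clm_apply (cst p)).clm_apply (cst q)
  have k2 : ∀ p q r : E, DifferentiableAt ℝ (fun y => fderiv ℝ (fderiv ℝ h) y a p q r) x :=
    fun p q r => (k1 p q).clm_apply (cst r)
  have k3 : ∀ p q r : E, fderiv ℝ (fun y => fderiv ℝ (fderiv ℝ h) y a p q r) x c
      = fderiv ℝ (fderiv ℝ (fderiv ℝ h)) x c a p q r := fun p q r => by
    rw [fderiv_apply_const (k1 p q), fderiv_apply_const ((hd2.clm_apply (cst a)).clm_apply (cst p)),
      fderiv_apply_const (hd2.clm_apply (cst a)), fderiv_apply_const hd2]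
  have hG1 : DifferentiableAt ℝ (fun y => christoffelMap h y u) x := hdG.clm_apply (cst u)
  have hG2 : DifferentiableAt ℝ (fun y => christoffelMap h y u v) x := hG1.clm_apply (cst v)
  have hG3 : DifferentiableAt ℝ (fun y => fderiv ℝ (christoffelMap h) y a) x :=
    hdG1.clm_apply (cst a)
  have hG4 : DifferentiableAt ℝ (fun y => fderiv ℝ (christoffelMap h) y a u) x :=
    hG3.clm_apply (cst u)
  have hG5 : DifferentiableAt ℝ (fun y => fderiv ℝ (christoffelMap h) y a u v) x :=
    hG4.clm_apply (cst v)
  have hDa : DifferentiableAt ℝ (fun y => fderiv ℝ h y a) x := hd1.clm_apply (cst a)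
  have p1 : DifferentiableAt ℝ (fun y => fderiv ℝ h y a (christoffelMap h y u v)) x :=
    hDa.clm_apply hG2
  have p2 : DifferentiableAt ℝ (fun y => h y (fderiv ℝ (christoffelMap h) y a u v)) x :=
    hd.clm_apply hG5
  have e1 : fderiv ℝ (fun y => fderiv ℝ h y a (christoffelMap h y u v) z) x c
      + fderiv ℝ (fun y => h y (fderiv ℝ (christoffelMap h) y a u v) z) x c
      = (1 / 2 : ℝ) * (fderiv ℝ (fderiv ℝ (fderiv ℝ h)) x c a u v z
        + fderiv ℝ (fderiv ℝ (fderiv ℝ h)) x c a v u z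
        - fderiv ℝ (fderiv ℝ (fderiv ℝ h)) x c a z u v) := by
    rw [← add_apply, ← fderiv_fun_add (p1.clm_apply (cst z)) (p2.clm_apply (cst z)),
      e.fderiv_eq, fderiv_half_mul_add_sub (k2 u v z) (k2 v u z) (k2 z u v), k3, k3, k3]
  rw [fderiv_apply_const p1, fderiv_apply_const p2, fderiv_clm_apply' hDa hG2,
    fderiv_clm_apply' hd hG5, fderiv_apply_const hG4, fderiv_apply_const hG3,
    fderiv_apply_const hdG1, hx.fderiv_eq, hx.christoffelMap_eq] at e1
  rw [← e1, real_inner_comm, ← hx.eq_inner]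
  simp

lemma fderiv_fderiv_symm (hh : IsMetricOn h U) (hU : x ∈ U) (a b : E) :
    fderiv ℝ (fderiv ℝ h) x a b = fderiv ℝ (fderiv ℝ h) x b a :=
  ((hh.contDiffAt hU).isSymmSndFDerivAt minSmoothness_two_le).eq a b

lemma fderiv_fderiv_metric_symm (hh : IsMetricOn h U) (hU : x ∈ U) (a b v w : E) :
    fderiv ℝ (fderiv ℝ h) x a b v w = fderiv ℝ (fderiv ℝ h) x a b w v := by
  have cst : ∀ (y v : E), DifferentiableAt ℝ (fun _ : E => v) y := fun y => differentiableAt_const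
  have key : ∀ y ∈ U, ∀ b v w, fderiv ℝ h y b v w = fderiv ℝ h y b w v := by
    intro y hy b v w
    have hd := (hh.contDiffAt hy).differentiableAt (by simp)
    have e : (fun y => h y v w) =ᶠ[𝓝 y] fun y => h y w v := by
      filter_upwards [hh.isOpen.mem_nhds hy] with y hy using hh.symm y hy v w
    rw [← fderiv_apply_const hd, ← fderiv_apply_const (hd.clm_apply (cst y v)), e.fderiv_eq,
      fderiv_apply_const (hd.clm_apply (cst y w)), fderiv_apply_const hd]
  have hd1 := (hh.contDiffAt_fderiv hU).differentiableAt (by simp)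
  have e : (fun y => fderiv ℝ h y b v w) =ᶠ[𝓝 x] fun y => fderiv ℝ h y b w v := by
    filter_upwards [hh.isOpen.mem_nhds hU] with y hy using key y hy b v w
  rw [← fderiv_apply_const hd1, ← fderiv_apply_const (hd1.clm_apply (cst x b)),
    ← fderiv_apply_const ((hd1.clm_apply (cst x b)).clm_apply (cst x v)), e.fderiv_eq,
    fderiv_apply_const ((hd1.clm_apply (cst x b)).clm_apply (cst x w)),
    fderiv_apply_const (hd1.clm_apply (cst x b)), fderiv_apply_const hd1]

lemma fderiv₃_symm_left (hh : IsMetricOn h U) (hU : x ∈ U) (a b : E) :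
    fderiv ℝ (fderiv ℝ (fderiv ℝ h)) x a b = fderiv ℝ (fderiv ℝ (fderiv ℝ h)) x b a :=
  ((hh.contDiffAt_fderiv hU).isSymmSndFDerivAt minSmoothness_two_le).eq a b

lemma fderiv₃_symm_mid (hh : IsMetricOn h U) (hU : x ∈ U) (c a b : E) :
    fderiv ℝ (fderiv ℝ (fderiv ℝ h)) x c a b = fderiv ℝ (fderiv ℝ (fderiv ℝ h)) x c b a := by
  have hd2 : DifferentiableAt ℝ (fderiv ℝ (fderiv ℝ h)) x :=
    ((hh.contDiffAt_fderiv hU).fderiv_right (m := ∞) (by simp)).differentiableAt (by simp)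
  have cst : ∀ v : E, DifferentiableAt ℝ (fun _ : E => v) x := differentiableAt_const
  have e : (fun y => fderiv ℝ (fderiv ℝ h) y a b) =ᶠ[𝓝 x] fun y => fderiv ℝ (fderiv ℝ h) y b a := by
    filter_upwards [hh.isOpen.mem_nhds hU] with y hy using fderiv_fderiv_symm hh hy a b
  rw [← fderiv_apply_const hd2, ← fderiv_apply_const (hd2.clm_apply (cst a)), e.fderiv_eq,
    fderiv_apply_const (hd2.clm_apply (cst b)), fderiv_apply_const hd2]

lemma fderiv₃_symm_right (hh : IsMetricOn h U) (hU : x ∈ U) (c a b v w : E) :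
    fderiv ℝ (fderiv ℝ (fderiv ℝ h)) x c a b v w
      = fderiv ℝ (fderiv ℝ (fderiv ℝ h)) x c a b w v := by
  have hd2 : DifferentiableAt ℝ (fderiv ℝ (fderiv ℝ h)) x :=
    ((hh.contDiffAt_fderiv hU).fderiv_right (m := ∞) (by simp)).differentiableAt (by simp)
  have cst : ∀ v : E, DifferentiableAt ℝ (fun _ : E => v) x := differentiableAt_const
  have e : (fun y => fderiv ℝ (fderiv ℝ h) y a b v w) =ᶠ[𝓝 x]
      fun y => fderiv ℝ (fderiv ℝ h) y a b w v := by
    filter_upwards [hh.isOpen.mem_nhds hU] with y hy using fderiv_fderiv_metric_symm hh hy a b v w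
  have h1 := hd2.clm_apply (cst a)
  have h2 := h1.clm_apply (cst b)
  rw [← fderiv_apply_const hd2, ← fderiv_apply_const h1, ← fderiv_apply_const h2,
    ← fderiv_apply_const (h2.clm_apply (cst v)), e.fderiv_eq,
    fderiv_apply_const (h2.clm_apply (cst w)), fderiv_apply_const h2, fderiv_apply_const h1,
    fderiv_apply_const hd2]

/-- The contracted second Bianchi identity at the centre of normal coordinates. -/
lemma contracted_bianchi (hx : IsNormalAt h x) (hh : IsMetricOn h U) (hU : x ∈ U)
    (e : OrthonormalBasis ι ℝ E) (c : E) :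
    ∑ b, ∑ a, inner ℝ (e a) (fderiv ℝ (fderiv ℝ (christoffelMap h)) x c (e a) (e b) (e b)
        - fderiv ℝ (fderiv ℝ (christoffelMap h)) x c (e b) (e a) (e b))
      = 2 * ∑ b, ∑ a, inner ℝ (e a)
        (fderiv ℝ (fderiv ℝ (christoffelMap h)) x (e b) (e a) (e b) c
          - fderiv ℝ (fderiv ℝ (christoffelMap h)) x (e b) (e b) (e a) c) := by
  set t : E → E → E → E → E → ℝ := fun c a u v z =>
    fderiv ℝ (fderiv ℝ (fderiv ℝ h)) x c a u v z with ht
  have t1 : ∀ c a u v z, t c a u v z = t a c u v z := fun c a u v z => by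
    simp only [ht, fderiv₃_symm_left hh hU c a]
  have t2 : ∀ c a u v z, t c a u v z = t c u a v z := fun c a u v z => by
    simp only [ht, fderiv₃_symm_mid hh hU c a u]
  have t3 : ∀ c a u v z, t c a u v z = t c a u z v := fun c a u v z => by
    simp only [ht, fderiv₃_symm_right hh hU c a u v z]
  have key : ∀ c a u v z : E, inner ℝ z (fderiv ℝ (fderiv ℝ (christoffelMap h)) x c a u v)
      = (1 / 2 : ℝ) * (t c a u v z + t c a v u z - t c a z u v) := fun c a u v z =>
    hx.inner_fderiv_fderiv_christoffelMap hh hU c a u v z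
  -- Written in third derivatives of the metric, the general terms of the two double sums differ
  -- only by `q a b - q b a`, which sums to zero.
  set q : ι → ι → ℝ := fun a b =>
    t (e b) (e a) (e a) (e b) c + 1 / 2 * t c (e b) (e b) (e a) (e a) with hq
  have pt : ∀ a b, inner ℝ (e a) (fderiv ℝ (fderiv ℝ (christoffelMap h)) x c (e a) (e b) (e b)
        - fderiv ℝ (fderiv ℝ (christoffelMap h)) x c (e b) (e a) (e b))
      = 2 * inner ℝ (e a) (fderiv ℝ (fderiv ℝ (christoffelMap h)) x (e b) (e a) (e b) c
          - fderiv ℝ (fderiv ℝ (christoffelMap h)) x (e b) (e b) (e a) c) + (q a b - q b a) := by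
    intro a b
    simp only [inner_sub_right, key, hq]
    have r1 := t2 c (e b) (e a) (e b) (e a)
    have r2 := t3 c (e a) (e b) (e b) (e a)
    have r3 : t (e b) (e a) (e b) c (e a) = t (e a) (e b) (e b) (e a) c := by
      rw [t1, t3]
    have r4 : t (e b) (e a) c (e b) (e a) = t c (e a) (e b) (e a) (e b) := by
      rw [t2, t1, t2, t3]
    have r5 : t (e b) (e b) c (e a) (e a) = t c (e b) (e b) (e a) (e a) := by rw [t2, t1]
    have r6 := t3 (e b) (e b) (e a) c (e a)
    have r7 := t3 c (e b) (e a) (e a) (e b)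
    linarith
  simp only [pt, Finset.sum_add_distrib, Finset.sum_sub_distrib, Finset.mul_sum]
  rw [Finset.sum_comm (f := fun b a => q a b), sub_self, add_zero]

/-- The contraction of the curvature over the first and third slots is minus the Ricci tensor. -/
lemma sum_inner_fderiv_christoffelMap (hx : IsNormalAt h x) (hh : IsMetricOn h U) (hU : x ∈ U)
    (e : OrthonormalBasis ι ℝ E) (c d : E) :
    ∑ b, inner ℝ d (fderiv ℝ (christoffelMap h) x (e b) (e b) c
        - fderiv ℝ (christoffelMap h) x c (e b) (e b)) = - ricciOf e h x c d := by
  rw [ricciOf, ← Finset.sum_neg_distrib]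
  refine Finset.sum_congr rfl fun b _ => ?_
  rw [hh.curvatureOf_eq hU, hx.christoffelMap_eq]
  simp only [zero_apply, add_zero, sub_zero, inner_sub_right,
    hx.inner_fderiv_christoffelMap hh hU]
  have s1 := fun a u => fderiv_fderiv_symm hh hU a u
  have s2 := fun a u v w => fderiv_fderiv_metric_symm hh hU a u v w
  rw [s1 c (e b), s2 (e b) c d (e b), s2 (e b) d c (e b)]
  ring

end IsNormalAt

end NormalPoint


/-! ### Hessian, Laplacian and gradient at a normal point, and `dR = -2 Ric(∇f, ·)`. -/

section NormalPoint

variable {E : Type*} [NormedAddCommGroup E] [InnerProductSpace ℝ E] [FiniteDimensional ℝ E]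
  {ι : Type*} [Fintype ι]

/-- The trace of the Hessian of `F`, with respect to a field of bilinear forms. -/
def laplacianOf (e : OrthonormalBasis ι ℝ E) (g : E → E →L[ℝ] E →L[ℝ] ℝ) (F : E → ℝ) (y : E) : ℝ :=
  ∑ b, hessianOf g F y ((g y).inverse (innerSL ℝ (e b))) (e b)

/-- The squared norm of the gradient of `F`, with respect to a field of bilinear forms. -/
def gradSqOf (g : E → E →L[ℝ] E →L[ℝ] ℝ) (F : E → ℝ) (y : E) : ℝ :=
  fderiv ℝ F y ((g y).inverse (fderiv ℝ F y))

/-- The Hessian of `F` as a bundled bilinear form. -/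
def hessianMap (g : E → E →L[ℝ] E →L[ℝ] ℝ) (F : E → ℝ) (y : E) : E →L[ℝ] E →L[ℝ] ℝ :=
  fderiv ℝ (fderiv ℝ F) y
    - (ContinuousLinearMap.compL ℝ E E ℝ (fderiv ℝ F y)).comp (christoffelMap g y)

lemma hessianMap_apply (g : E → E →L[ℝ] E →L[ℝ] ℝ) (F : E → ℝ) (y u v : E) :
    hessianMap g F y u v = hessianOf g F y u v := by
  simp [hessianMap, hessianOf, christoffelMap_apply]

namespace IsNormalAt

variable {h : E → E →L[ℝ] E →L[ℝ] ℝ} {U : Set E} {x : E} {F : E → ℝ}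

lemma inverse_eq (hx : IsNormalAt h x) (hh : IsMetricOn h U) (hU : x ∈ U) (l : E →L[ℝ] ℝ)
    (v : E) : inner ℝ ((h x).inverse l) v = l v := by
  rw [← hx.eq_inner, hh.apply_inverse hU]

lemma inverse_innerSL (hx : IsNormalAt h x) (hh : IsMetricOn h U) (hU : x ∈ U) (v : E) :
    (h x).inverse (innerSL ℝ v) = v :=
  ext_inner_right ℝ fun w => by rw [hx.inverse_eq hh hU]; simp

/-- The relation `h ∘ h⁻¹ = id` is differentiated at a point where `Dh = 0`. Hence raising an index
commutes with differentiation there. -/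
lemma fderiv_inverse (hx : IsNormalAt h x) (hh : IsMetricOn h U) (hU : x ∈ U) :
    fderiv ℝ (fun y => (h y).inverse) x = 0 := by
  have hd := (hh.contDiffAt hU).differentiableAt (by simp)
  have hi := (hh.contDiffAt_inverse hU).differentiableAt (by simp)
  have e : (fun y => (h y).comp (h y).inverse) =ᶠ[𝓝 x]
      fun _ => ContinuousLinearMap.id ℝ (E →L[ℝ] ℝ) := by
    filter_upwards [hh.isOpen.mem_nhds hU] with y hy
    exact (hh.isInvertible hy).self_comp_inverse
  have e1 := e.fderiv_eq (𝕜 := ℝ)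
  rw [(hd.hasFDerivAt.clm_comp hi.hasFDerivAt).fderiv, hx.fderiv_eq] at e1
  ext c l : 2
  have e2 := congrArg (fun L => L c l) e1
  have e3 : h x (fderiv ℝ (fun y => (h y).inverse) x c l) = 0 := by
    simpa using e2
  refine hh.eq_of_forall hU fun z => ?_
  rw [e3]
  simp

lemma hessianOf_eq (hx : IsNormalAt h x) (u v : E) : hessianOf h F x u v = fderiv ℝ (fderiv ℝ F) x u v := by
  rw [hessianOf, ← christoffelMap_apply, hx.christoffelMap_eq]
  simp

lemma fderiv_hessianOf (hx : IsNormalAt h x) (hh : IsMetricOn h U) (hU : x ∈ U)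
    (hF : ContDiffAt ℝ ∞ F x) (c u v : E) :
    fderiv ℝ (fun y => hessianOf h F y u v) x c
      = fderiv ℝ (fderiv ℝ (fderiv ℝ F)) x c u v
        - fderiv ℝ F x (fderiv ℝ (christoffelMap h) x c u v) := by
  have hc1 : ContDiffAt ℝ ∞ (fderiv ℝ F) x := hF.fderiv_right (by simp)
  have hd1 := hc1.differentiableAt (by simp)
  have hd2 : DifferentiableAt ℝ (fderiv ℝ (fderiv ℝ F)) x :=
    (hc1.fderiv_right (m := ∞) (by simp)).differentiableAt (by simp)
  have hdG := (hh.contDiffAt_christoffelMap hU).differentiableAt (by simp)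
  have cst : ∀ v : E, DifferentiableAt ℝ (fun _ : E => v) x := differentiableAt_const
  have hG1 := hdG.clm_apply (cst u)
  have hG2 := hG1.clm_apply (cst v)
  have h1 := hd2.clm_apply (cst u)
  simp only [hessianOf, ← christoffelMap_apply]
  rw [fderiv_fun_sub (h1.clm_apply (cst v)) (hd1.clm_apply hG2), sub_apply,
    fderiv_apply_const h1, fderiv_apply_const hd2, fderiv_clm_apply' hd1 hG2,
    fderiv_apply_const hG1, fderiv_apply_const hdG, hx.christoffelMap_eq]
  simp

/-- Only the derivative part of the curvature contributes: the part quadratic in `Γ` vanishes to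
second order at a normal point. -/
lemma fderiv_ricciOf (hx : IsNormalAt h x) (hh : IsMetricOn h U) (hU : x ∈ U)
    (e : OrthonormalBasis ι ℝ E) (c u v : E) :
    fderiv ℝ (fun y => ricciOf e h y u v) x c
      = ∑ a, inner ℝ (e a) (fderiv ℝ (fderiv ℝ (christoffelMap h)) x c (e a) u v
        - fderiv ℝ (fderiv ℝ (christoffelMap h)) x c u (e a) v) := by
  have hdG := (hh.contDiffAt_christoffelMap hU).differentiableAt (by simp)
  have hd1 := (contDiffAt_fderiv_christoffelMap hh hU).differentiableAt (by simp)
  have cst : ∀ v : E, DifferentiableAt ℝ (fun _ : E => v) x := differentiableAt_const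
  have ev : (fun y => ricciOf e h y u v) =ᶠ[𝓝 x] fun y => ∑ a, innerSL ℝ (e a)
      (fderiv ℝ (christoffelMap h) y (e a) u v - fderiv ℝ (christoffelMap h) y u (e a) v
      + christoffelMap h y (e a) (christoffelMap h y u v)
      - christoffelMap h y u (christoffelMap h y (e a) v)) := by
    filter_upwards [hh.isOpen.mem_nhds hU] with y hy
    simp only [ricciOf, hh.curvatureOf_eq hy, innerSL_apply_apply]
  have k1 : ∀ a b, DifferentiableAt ℝ (fun y => fderiv ℝ (christoffelMap h) y a b v) x :=
    fun a b => ((hd1.clm_apply (cst a)).clm_apply (cst b)).clm_apply (cst v)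
  have k2 : ∀ a b, DifferentiableAt ℝ (fun y => christoffelMap h y a b) x :=
    fun a b => (hdG.clm_apply (cst a)).clm_apply (cst b)
  have k3 : ∀ a b, DifferentiableAt ℝ (fun y => christoffelMap h y a (christoffelMap h y b v)) x :=
    fun a b => (hdG.clm_apply (cst a)).clm_apply (k2 b v)
  have d1 : ∀ a b, fderiv ℝ (fun y => fderiv ℝ (christoffelMap h) y a b v) x c
      = fderiv ℝ (fderiv ℝ (christoffelMap h)) x c a b v := fun a b => by
    rw [fderiv_apply_const ((hd1.clm_apply (cst a)).clm_apply (cst b)),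
      fderiv_apply_const (hd1.clm_apply (cst a)), fderiv_apply_const hd1]
  have d3 : ∀ a b, fderiv ℝ (fun y => christoffelMap h y a (christoffelMap h y b v)) x c = 0 :=
    fun a b => by
    rw [fderiv_clm_apply' (hdG.clm_apply (cst a)) (k2 b v), fderiv_apply_const hdG,
      hx.christoffelMap_eq]
    simp
  have tot : ∀ a b : E, HasFDerivAt (fun y => fderiv ℝ (christoffelMap h) y a b v
      - fderiv ℝ (christoffelMap h) y b a v + christoffelMap h y a (christoffelMap h y b v)
      - christoffelMap h y b (christoffelMap h y a v)) _ x := fun a b =>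
    (((k1 a b).hasFDerivAt.fun_sub (k1 b a).hasFDerivAt).fun_add (k3 a b).hasFDerivAt).fun_sub
      (k3 b a).hasFDerivAt
  rw [ev.fderiv_eq, fderiv_fun_sum fun a _ =>
    (differentiableAt_const (innerSL ℝ (e a))).clm_apply (tot (e a) u).differentiableAt, sum_apply]
  refine Finset.sum_congr rfl fun a _ => ?_
  rw [fderiv_clm_apply' (differentiableAt_const (c := innerSL ℝ (e a)))
    (tot (e a) u).differentiableAt, (tot (e a) u).fderiv]
  simp [d1, d3]

lemma fderiv_laplacianOf (hx : IsNormalAt h x) (hh : IsMetricOn h U) (hU : x ∈ U)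
    (hF : ContDiffAt ℝ ∞ F x) (e : OrthonormalBasis ι ℝ E) (c : E) :
    fderiv ℝ (laplacianOf e h F) x c = ∑ b, fderiv ℝ (fun y => hessianOf h F y (e b) (e b)) x c := by
  have hc1 : ContDiffAt ℝ ∞ (fderiv ℝ F) x := hF.fderiv_right (by simp)
  have hcG := hh.contDiffAt_christoffelMap hU
  have hH : DifferentiableAt ℝ (hessianMap h F) x := by
    refine ContDiffAt.differentiableAt (n := ∞) ?_ (by simp)
    exact (hc1.fderiv_right (m := ∞) (by simp)).sub
      (((ContinuousLinearMap.contDiff _).contDiffAt.comp x hc1).clm_comp hcG)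
  have hi := (hh.contDiffAt_inverse hU).differentiableAt (by simp)
  have cst : ∀ v : E, DifferentiableAt ℝ (fun _ : E => v) x := differentiableAt_const
  have hi1 : ∀ l : E →L[ℝ] ℝ, DifferentiableAt ℝ (fun y => (h y).inverse l) x :=
    fun l => hi.clm_apply (differentiableAt_const l)
  have d1 : ∀ b, DifferentiableAt ℝ
      (fun y => hessianMap h F y ((h y).inverse (innerSL ℝ (e b))) (e b)) x :=
    fun b => (hH.clm_apply (hi1 _)).clm_apply (cst _)
  have e1 : laplacianOf e h F
      = fun y => ∑ b, hessianMap h F y ((h y).inverse (innerSL ℝ (e b))) (e b) := by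
    ext y
    simp only [laplacianOf, hessianMap_apply]
  rw [e1, fderiv_fun_sum fun b _ => d1 b, sum_apply]
  refine Finset.sum_congr rfl fun b _ => ?_
  simp only [← hessianMap_apply]
  rw [fderiv_apply_const (hH.clm_apply (hi1 _)), fderiv_clm_apply' hH (hi1 _),
    fderiv_apply_const hi, hx.fderiv_inverse hh hU, hx.inverse_innerSL hh hU,
    fderiv_apply_const (hH.clm_apply (cst _)), fderiv_apply_const hH]
  simp

/-- The differential of the squared norm of the gradient is twice the Hessian applied to the
gradient. -/
lemma fderiv_gradSqOf (hx : IsNormalAt h x) (hh : IsMetricOn h U) (hU : x ∈ U)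
    (hF : ContDiffAt ℝ ∞ F x) (c : E) :
    fderiv ℝ (gradSqOf h F) x c
      = 2 * fderiv ℝ (fderiv ℝ F) x c ((h x).inverse (fderiv ℝ F x)) := by
  have hd1 : DifferentiableAt ℝ (fderiv ℝ F) x :=
    (hF.fderiv_right (m := ∞) (by simp)).differentiableAt (by simp)
  have hi := (hh.contDiffAt_inverse hU).differentiableAt (by simp)
  have e1 : gradSqOf h F = fun y => fderiv ℝ F y ((h y).inverse (fderiv ℝ F y)) := rfl
  rw [e1, fderiv_clm_apply' hd1 (hi.clm_apply hd1), fderiv_clm_apply' hi hd1,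
    hx.fderiv_inverse hh hU, two_mul]
  simp only [zero_apply, zero_add]
  congr 1
  rw [← hx.inverse_eq hh hU (fderiv ℝ F x), real_inner_comm, hx.inverse_eq hh hU]

/-- On a steady gradient Ricci soliton, `dR = -2 Ric(∇f, ·)`. -/
lemma fderiv_laplacianOf_of_soliton (hx : IsNormalAt h x) (hh : IsMetricOn h U) (hU : x ∈ U)
    (hF : ContDiffAt ℝ ∞ F x) (e : OrthonormalBasis ι ℝ E)
    (hsol : ∀ y ∈ U, ∀ u v, ricciOf e h y u v = hessianOf h F y u v) (c : E) :
    fderiv ℝ (laplacianOf e h F) x c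
      = - 2 * fderiv ℝ (fderiv ℝ F) x c ((h x).inverse (fderiv ℝ F x)) := by
  have hc1 : ContDiffAt ℝ ∞ (fderiv ℝ F) x := hF.fderiv_right (by simp)
  have E1 : ∀ c u v, ∑ a, inner ℝ (e a) (fderiv ℝ (fderiv ℝ (christoffelMap h)) x c (e a) u v
        - fderiv ℝ (fderiv ℝ (christoffelMap h)) x c u (e a) v)
      = fderiv ℝ (fderiv ℝ (fderiv ℝ F)) x c u v
        - fderiv ℝ F x (fderiv ℝ (christoffelMap h) x c u v) := fun c u v => by
    rw [← hx.fderiv_ricciOf hh hU, ← hx.fderiv_hessianOf hh hU hF]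
    have : (fun y => ricciOf e h y u v) =ᶠ[𝓝 x] fun y => hessianOf h F y u v := by
      filter_upwards [hh.isOpen.mem_nhds hU] with y hy using hsol y hy u v
    rw [this.fderiv_eq]
  -- By the soliton equation, the Bianchi identity now reads `dΔF = 2 div Hess F`.
  have hB := hx.contracted_bianchi hh hU e c
  simp only [E1] at hB
  have s3 : ∀ b, fderiv ℝ (fderiv ℝ (fderiv ℝ F)) x b b c
      = fderiv ℝ (fderiv ℝ (fderiv ℝ F)) x c b b := fun b => by
    have hd2 : DifferentiableAt ℝ (fderiv ℝ (fderiv ℝ F)) x :=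
      (hc1.fderiv_right (m := ∞) (by simp)).differentiableAt (by simp)
    have cst : ∀ v : E, DifferentiableAt ℝ (fun _ : E => v) x := differentiableAt_const
    have r1 : fderiv ℝ (fderiv ℝ (fderiv ℝ F)) x b c = fderiv ℝ (fderiv ℝ (fderiv ℝ F)) x c b :=
      (hc1.isSymmSndFDerivAt minSmoothness_two_le).eq b c
    have ev : (fun y => fderiv ℝ (fderiv ℝ F) y b c) =ᶠ[𝓝 x]
        fun y => fderiv ℝ (fderiv ℝ F) y c b := by
      filter_upwards [(hF.of_le (by decide : (2 : ℕ∞ω) ≤ ∞)).eventually (by simp)] with y hy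
      exact (hy.isSymmSndFDerivAt (by simp)).eq b c
    rw [← r1, ← fderiv_apply_const hd2, ← fderiv_apply_const (hd2.clm_apply (cst b)), ev.fderiv_eq,
      fderiv_apply_const (hd2.clm_apply (cst c)), fderiv_apply_const hd2]
  -- Bochner's commutation: `div Hess F - dΔF = Ric(∇F, ·)`, where the soliton equation turns Ricci
  -- back into the Hessian. Combined with `hB`, this gives `dΔF = -2 Hess F(∇F, ·)`.
  have hR : ∑ b, fderiv ℝ F x (fderiv ℝ (christoffelMap h) x (e b) (e b) c
        - fderiv ℝ (christoffelMap h) x c (e b) (e b))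
      = - fderiv ℝ (fderiv ℝ F) x c ((h x).inverse (fderiv ℝ F x)) := by
    simp only [← hx.inverse_eq hh hU (fderiv ℝ F x)]
    rw [hx.sum_inner_fderiv_christoffelMap hh hU e, hsol x hU, hx.hessianOf_eq]
  simp only [map_sub, Finset.sum_sub_distrib, s3] at hR hB
  rw [hx.fderiv_laplacianOf hh hU hF]
  simp only [hx.fderiv_hessianOf hh hU hF, Finset.sum_sub_distrib]
  linarith

end IsNormalAt

end NormalPoint


/-! ### Smoothness and positivity of the metric in a chart. -/

section Chart

variable {n : ℕ} {M : Type*} [TopologicalSpace M]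
  [ChartedSpace (EuclideanSpace ℝ (Fin n)) M] [IsManifold (𝓡 n) ∞ M]

lemma isManifold_one : IsManifold (𝓡 n) 1 M :=
  IsManifold.of_le (n := ∞) (by decide)

lemma contMDiffAt_extChartAt_symm {c : M} {y : EuclideanSpace ℝ (Fin n)}
    (hy : y ∈ (extChartAt (𝓡 n) c).target) :
    ContMDiffAt 𝓘(ℝ, EuclideanSpace ℝ (Fin n)) (𝓡 n) ∞ (extChartAt (𝓡 n) c).symm y :=
  (contMDiffOn_extChartAt_symm c).contMDiffAt ((isOpen_extChartAt_target c).mem_nhds hy)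

lemma mdifferentiableAt_extChartAt_symm {c : M} {y : EuclideanSpace ℝ (Fin n)}
    (hy : y ∈ (extChartAt (𝓡 n) c).target) :
    MDifferentiableAt 𝓘(ℝ, EuclideanSpace ℝ (Fin n)) (𝓡 n) (extChartAt (𝓡 n) c).symm y :=
  (contMDiffAt_extChartAt_symm hy).mdifferentiableAt (by simp)

lemma isInvertible_mfderiv_extChartAt_symm {c : M} {y : EuclideanSpace ℝ (Fin n)}
    (hy : y ∈ (extChartAt (𝓡 n) c).target) :
    (mfderiv 𝓘(ℝ, EuclideanSpace ℝ (Fin n)) (𝓡 n) (extChartAt (𝓡 n) c).symm y).IsInvertible := by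
  have := isManifold_one (n := n) (M := M)
  have h := isInvertible_mfderivWithin_extChartAt_symm (I := 𝓡 n) hy
  rwa [ModelWithCorners.range_eq_univ, mfderivWithin_univ] at h

/-- In the trivialization of the tangent bundle around `c`, this coordinate vector field is the
constant `v`. -/
lemma contMDiffOn_mfderiv_extChartAt_symm (c : M) (v : EuclideanSpace ℝ (Fin n)) :
    ContMDiffOn 𝓘(ℝ, EuclideanSpace ℝ (Fin n)) ((𝓡 n).prod 𝓘(ℝ, EuclideanSpace ℝ (Fin n))) ∞
      (fun y => (TotalSpace.mk ((extChartAt (𝓡 n) c).symm y)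
        (mfderiv 𝓘(ℝ, EuclideanSpace ℝ (Fin n)) (𝓡 n) (extChartAt (𝓡 n) c).symm y v) :
        TotalSpace (EuclideanSpace ℝ (Fin n)) (TangentSpace (𝓡 n) : M → Type _)))
      (extChartAt (𝓡 n) c).target := by
  have := isManifold_one (n := n) (M := M)
  have hsrc : ∀ y ∈ (extChartAt (𝓡 n) c).target,
      (extChartAt (𝓡 n) c).symm y ∈ (chartAt (EuclideanSpace ℝ (Fin n)) c).source := fun y hy => by
    have := (extChartAt (𝓡 n) c).map_target hy
    rwa [extChartAt_source] at this
  rw [Trivialization.contMDiffOn_iff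
    (e := trivializationAt (EuclideanSpace ℝ (Fin n)) (TangentSpace (𝓡 n)) c)]
  · refine ⟨contMDiffOn_extChartAt_symm c, ?_⟩
    refine (contMDiffOn_const (c := v)).congr fun y hy => ?_
    have h1 := hsrc y hy
    have h2 := TangentBundle.symmL_trivializationAt (I := 𝓡 n) h1
    rw [ModelWithCorners.range_eq_univ, mfderivWithin_univ,
      (extChartAt (𝓡 n) c).right_inv hy] at h2
    have hb : (extChartAt (𝓡 n) c).symm y
        ∈ (trivializationAt (EuclideanSpace ℝ (Fin n)) (TangentSpace (𝓡 n)) c).baseSet := by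
      simpa using h1
    have h3 := Trivialization.continuousLinearMapAt_symmL (R := ℝ)
      (trivializationAt (EuclideanSpace ℝ (Fin n)) (TangentSpace (𝓡 n)) c) hb v
    rw [h2, Trivialization.continuousLinearMapAt_apply,
      Trivialization.coe_linearMapAt_of_mem _ hb] at h3
    exact h3
  · intro y hy
    have h1 := hsrc y hy
    rw [Trivialization.mem_source]
    simpa using h1

variable [RiemannianBundle (fun x : M => TangentSpace (𝓡 n) x)]

lemma chartMetric_apply (c : M) (y v w : EuclideanSpace ℝ (Fin n)) :
    chartMetric n c y v w
      = inner ℝ (mfderiv 𝓘(ℝ, EuclideanSpace ℝ (Fin n)) (𝓡 n) (extChartAt (𝓡 n) c).symm y v)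
        (mfderiv 𝓘(ℝ, EuclideanSpace ℝ (Fin n)) (𝓡 n) (extChartAt (𝓡 n) c).symm y w) :=
  rfl

lemma chartMetric_isMetricOn [IsContMDiffRiemannianBundle (𝓡 n) ∞ (EuclideanSpace ℝ (Fin n))
      (fun x : M => TangentSpace (𝓡 n) x)] (c : M) :
    IsMetricOn (chartMetric n c) (extChartAt (𝓡 n) c).target where
  isOpen := isOpen_extChartAt_target c
  smooth := by
    refine contDiffOn_clm_apply.mpr fun v => contDiffOn_clm_apply.mpr fun w => ?_
    exact contMDiffOn_iff_contDiffOn.mp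
      (ContMDiffOn.inner_bundle (contMDiffOn_mfderiv_extChartAt_symm c v)
        (contMDiffOn_mfderiv_extChartAt_symm c w))
  symm y hy v w := by
    rw [chartMetric_apply, chartMetric_apply, real_inner_comm]
  pos y hy v hv := by
    rw [chartMetric_apply, real_inner_self_pos]
    intro h0
    exact hv ((isInvertible_mfderiv_extChartAt_symm hy).injective (h0.trans (map_zero _).symm))

end Chart


/-! ### The metric, curvature and Hessian in an arbitrary parametrization. -/

section Param

variable {n : ℕ} {M : Type*} [TopologicalSpace M]
  [ChartedSpace (EuclideanSpace ℝ (Fin n)) M]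

/-- `σ` is a smooth immersion of the open set `U` of the model space. -/
structure IsParamOn (σ : EuclideanSpace ℝ (Fin n) → M) (U : Set (EuclideanSpace ℝ (Fin n))) :
    Prop where
  isOpen : IsOpen U
  smooth : ContMDiffOn 𝓘(ℝ, EuclideanSpace ℝ (Fin n)) (𝓡 n) ∞ σ U
  injective : ∀ y ∈ U, Function.Injective (mfderiv 𝓘(ℝ, EuclideanSpace ℝ (Fin n)) (𝓡 n) σ y)

/-- The inner product of the tangent space at `p`, on the model space. -/
def tangentInner [RiemannianBundle (fun x : M => TangentSpace (𝓡 n) x)] (p : M)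
    (v w : EuclideanSpace ℝ (Fin n)) : ℝ :=
  letI V : TangentSpace (𝓡 n) p := v
  letI W : TangentSpace (𝓡 n) p := w
  inner ℝ V W

/-- The metric in the coordinates given by the parametrization `σ`. -/
def pullMetric [RiemannianBundle (fun x : M => TangentSpace (𝓡 n) x)]
    (σ : EuclideanSpace ℝ (Fin n) → M) (y : EuclideanSpace ℝ (Fin n)) :
    EuclideanSpace ℝ (Fin n) →L[ℝ] EuclideanSpace ℝ (Fin n) →L[ℝ] ℝ :=
  (innerSL ℝ : TangentSpace (𝓡 n) (σ y) →L[ℝ] TangentSpace (𝓡 n) (σ y) →L[ℝ] ℝ).bilinearComp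
    (mfderiv 𝓘(ℝ, EuclideanSpace ℝ (Fin n)) (𝓡 n) σ y)
    (mfderiv 𝓘(ℝ, EuclideanSpace ℝ (Fin n)) (𝓡 n) σ y)

/-- The coordinate expression of the parametrization `σ` in the chart around `c`. -/
def transition (c : M) (σ : EuclideanSpace ℝ (Fin n) → M) :
    EuclideanSpace ℝ (Fin n) → EuclideanSpace ℝ (Fin n) :=
  extChartAt (𝓡 n) c ∘ σ

namespace IsParamOn

variable {σ : EuclideanSpace ℝ (Fin n) → M} {U : Set (EuclideanSpace ℝ (Fin n))}
  [IsManifold (𝓡 n) ∞ M]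

lemma contMDiffAt (hσ : IsParamOn σ U) {x : EuclideanSpace ℝ (Fin n)} (hx : x ∈ U) :
    ContMDiffAt 𝓘(ℝ, EuclideanSpace ℝ (Fin n)) (𝓡 n) ∞ σ x :=
  hσ.smooth.contMDiffAt (hσ.isOpen.mem_nhds hx)

lemma mdifferentiableAt (hσ : IsParamOn σ U) {x : EuclideanSpace ℝ (Fin n)} (hx : x ∈ U) :
    MDifferentiableAt 𝓘(ℝ, EuclideanSpace ℝ (Fin n)) (𝓡 n) σ x :=
  (hσ.contMDiffAt hx).mdifferentiableAt (by simp)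

lemma surjective (hσ : IsParamOn σ U) {x : EuclideanSpace ℝ (Fin n)} (hx : x ∈ U) :
    Function.Surjective (mfderiv 𝓘(ℝ, EuclideanSpace ℝ (Fin n)) (𝓡 n) σ x) := by
  let L : EuclideanSpace ℝ (Fin n) →L[ℝ] EuclideanSpace ℝ (Fin n) :=
    mfderiv 𝓘(ℝ, EuclideanSpace ℝ (Fin n)) (𝓡 n) σ x
  have hL : Function.Injective L := hσ.injective x hx
  exact LinearMap.surjective_of_injective (f := L.toLinearMap) hL

/-- The part of `U` that is mapped into the domain of the chart around `c`. -/
lemma isOpen_inter (hσ : IsParamOn σ U) (c : M) :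
    IsOpen (U ∩ σ ⁻¹' (extChartAt (𝓡 n) c).source) :=
  hσ.smooth.continuousOn.isOpen_inter_preimage hσ.isOpen (isOpen_extChartAt_source c)

lemma mapsTo_transition (c : M) : MapsTo (transition c σ)
    (U ∩ σ ⁻¹' (extChartAt (𝓡 n) c).source) (extChartAt (𝓡 n) c).target :=
  fun _ hx => (extChartAt (𝓡 n) c).map_source hx.2

lemma contDiffOn_transition (hσ : IsParamOn σ U) (c : M) :
    ContDiffOn ℝ ∞ (transition c σ) (U ∩ σ ⁻¹' (extChartAt (𝓡 n) c).source) := by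
  rw [← contMDiffOn_iff_contDiffOn]
  exact (contMDiffOn_extChartAt (I := 𝓡 n) (n := ∞) (x := c)).comp
    (hσ.smooth.mono inter_subset_left) fun x hx => by
      have := hx.2
      rwa [mem_preimage, extChartAt_source] at this

lemma eventuallyEq (hσ : IsParamOn σ U) (c : M) {x : EuclideanSpace ℝ (Fin n)}
    (hx : x ∈ U ∩ σ ⁻¹' (extChartAt (𝓡 n) c).source) :
    σ =ᶠ[𝓝 x] (extChartAt (𝓡 n) c).symm ∘ transition c σ := by
  filter_upwards [(hσ.isOpen_inter c).mem_nhds hx] with y hy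
  exact ((extChartAt (𝓡 n) c).left_inv hy.2).symm

/-- The components of `dσ u` in the preferred chart. -/
lemma coords_mfderiv (hσ : IsParamOn σ U) {x : EuclideanSpace ℝ (Fin n)} (hx : x ∈ U)
    (u : EuclideanSpace ℝ (Fin n)) :
    coords n (σ x) (mfderiv 𝓘(ℝ, EuclideanSpace ℝ (Fin n)) (𝓡 n) σ x u)
      = fderiv ℝ (transition (σ x) σ) x u := by
  have := isManifold_one (n := n) (M := M)
  have h := mfderiv_comp (I'' := 𝓘(ℝ, EuclideanSpace ℝ (Fin n))) x
    (mdifferentiableAt_extChartAt (I := 𝓡 n) (mem_chart_source _ (σ x))) (hσ.mdifferentiableAt hx)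
  rw [← mfderiv_eq_fderiv]
  exact (congrArg (fun L => L u) h).symm

lemma mem_inter (hx : x ∈ U) : x ∈ U ∩ σ ⁻¹' (extChartAt (𝓡 n) (σ x)).source :=
  ⟨hx, mem_extChartAt_source (σ x)⟩

variable [RiemannianBundle (fun x : M => TangentSpace (𝓡 n) x)]

lemma pullMetric_eq (hσ : IsParamOn σ U) (c : M) {x : EuclideanSpace ℝ (Fin n)}
    (hx : x ∈ U ∩ σ ⁻¹' (extChartAt (𝓡 n) c).source) (v w : EuclideanSpace ℝ (Fin n)) :
    pullMetric σ x v w = chartMetric n c (transition c σ x)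
      (fderiv ℝ (transition c σ) x v) (fderiv ℝ (transition c σ) x w) := by
  have e := hσ.eventuallyEq c hx
  have hd : MDifferentiableAt 𝓘(ℝ, EuclideanSpace ℝ (Fin n)) 𝓘(ℝ, EuclideanSpace ℝ (Fin n))
      (transition c σ) x :=
    (((hσ.contDiffOn_transition c).contDiffAt ((hσ.isOpen_inter c).mem_nhds hx)).differentiableAt
      (by simp)).mdifferentiableAt
  have h := mfderiv_comp (I'' := 𝓡 n) x
    (mdifferentiableAt_extChartAt_symm (mapsTo_transition (σ := σ) (U := U) c hx)) hd
  have h1 : ∀ u, mfderiv 𝓘(ℝ, EuclideanSpace ℝ (Fin n)) (𝓡 n) σ x u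
      = mfderiv 𝓘(ℝ, EuclideanSpace ℝ (Fin n)) (𝓡 n) (extChartAt (𝓡 n) c).symm
        (transition c σ x) (fderiv ℝ (transition c σ) x u) := fun u => by
    rw [e.mfderiv_eq, ← mfderiv_eq_fderiv]
    exact congrArg (fun L => L u) h
  -- The two base points are equal but not by definition. With both arguments read in the model
  -- space, the inner product can be moved from one tangent space to the other.
  have h2 : ∀ a b, tangentInner (n := n) (σ x) a b
      = tangentInner (n := n) ((extChartAt (𝓡 n) c).symm (transition c σ x)) a b := fun a b => by
    have := e.self_of_nhds
    rw [this]
    rfl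
  have h3 : pullMetric σ x v w = tangentInner (n := n) (σ x)
      (mfderiv 𝓘(ℝ, EuclideanSpace ℝ (Fin n)) (𝓡 n) σ x v)
      (mfderiv 𝓘(ℝ, EuclideanSpace ℝ (Fin n)) (𝓡 n) σ x w) := rfl
  exact h3.trans ((h2 _ _).trans ((congrArg₂
    (tangentInner (n := n) ((extChartAt (𝓡 n) c).symm (transition c σ x))) (h1 v) (h1 w)).trans
    (chartMetric_apply c _ _ _).symm))

variable [IsContMDiffRiemannianBundle (𝓡 n) ∞ (EuclideanSpace ℝ (Fin n))
      (fun x : M => TangentSpace (𝓡 n) x)]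

lemma isMetricOn (hσ : IsParamOn σ U) : IsMetricOn (pullMetric (n := n) σ) U where
  isOpen := hσ.isOpen
  smooth := by
    refine contDiffOn_clm_apply.mpr fun v => contDiffOn_clm_apply.mpr fun w => fun x hx => ?_
    refine ContDiffAt.contDiffWithinAt ?_
    have hx' := mem_inter (σ := σ) hx
    have hψ : ContDiffAt ℝ ∞ (transition (σ x) σ) x :=
      (hσ.contDiffOn_transition (σ x)).contDiffAt ((hσ.isOpen_inter (σ x)).mem_nhds hx')
    have hψ1 : ContDiffAt ℝ ∞ (fderiv ℝ (transition (σ x) σ)) x := hψ.fderiv_right (by simp)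
    have hg : ContDiffAt ℝ ∞ (chartMetric n (σ x) ∘ transition (σ x) σ) x :=
      ((chartMetric_isMetricOn (σ x)).contDiffAt (mapsTo_transition (σ := σ) (σ x) hx')).comp x hψ
    refine ((hg.clm_apply (hψ1.clm_apply (contDiffAt_const (c := v)))).clm_apply
      (hψ1.clm_apply (contDiffAt_const (c := w)))).congr_of_eventuallyEq (f₁ := fun y => pullMetric σ y v w) ?_
    filter_upwards [(hσ.isOpen_inter (σ x)).mem_nhds hx'] with y hy
    exact hσ.pullMetric_eq (σ x) hy v w
  symm y hy v w := by
    exact real_inner_comm (F := TangentSpace (𝓡 n) (σ y)) _ _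
  pos y hy v hv := by
    refine real_inner_self_pos (F := TangentSpace (𝓡 n) (σ y)).mpr ?_
    intro h0
    exact hv (hσ.injective y hy (h0.trans (map_zero _).symm))

lemma isPullbackOn (hσ : IsParamOn σ U) (c : M) :
    IsPullbackOn (chartMetric n c) (pullMetric σ) (transition c σ)
      (U ∩ σ ⁻¹' (extChartAt (𝓡 n) c).source) (extChartAt (𝓡 n) c).target :=
  ⟨hσ.contDiffOn_transition c, mapsTo_transition c, fun _ hx => hσ.pullMetric_eq c hx⟩

lemma isMetricOn_inter (hσ : IsParamOn σ U) (c : M) :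
    IsMetricOn (pullMetric (n := n) σ) (U ∩ σ ⁻¹' (extChartAt (𝓡 n) c).source) :=
  hσ.isMetricOn.mono (hσ.isOpen_inter c) inter_subset_left

/-- The curvature is defined through the preferred chart at each point. Naturality allows it to be
computed in a fixed parametrization, in particular in one normal at a given point. -/
lemma riemann_eq (hσ : IsParamOn σ U) {x : EuclideanSpace ℝ (Fin n)} (hx : x ∈ U)
    (u v w z : EuclideanSpace ℝ (Fin n)) :
    riemann n (σ x) (mfderiv 𝓘(ℝ, EuclideanSpace ℝ (Fin n)) (𝓡 n) σ x u)
      (mfderiv 𝓘(ℝ, EuclideanSpace ℝ (Fin n)) (𝓡 n) σ x v)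
      (mfderiv 𝓘(ℝ, EuclideanSpace ℝ (Fin n)) (𝓡 n) σ x w)
      (mfderiv 𝓘(ℝ, EuclideanSpace ℝ (Fin n)) (𝓡 n) σ x z)
      = pullMetric σ x (curvatureOf (pullMetric σ) x u v w) z := by
  have hx' := mem_inter (σ := σ) hx
  rw [riemann, hσ.coords_mfderiv hx, hσ.coords_mfderiv hx, hσ.coords_mfderiv hx,
    hσ.coords_mfderiv hx, hσ.pullMetric_eq (σ x) hx',
    (hσ.isPullbackOn (σ x)).map_curvature (chartMetric_isMetricOn (σ x))
      (hσ.isMetricOn_inter (σ x)) hx']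
  rfl

lemma hessian_eq (hσ : IsParamOn σ U) {f : M → ℝ} (hf : ContMDiff (𝓡 n) 𝓘(ℝ, ℝ) ∞ f)
    {x : EuclideanSpace ℝ (Fin n)} (hx : x ∈ U) (u v : EuclideanSpace ℝ (Fin n)) :
    hessian n f (σ x) (mfderiv 𝓘(ℝ, EuclideanSpace ℝ (Fin n)) (𝓡 n) σ x u)
      (mfderiv 𝓘(ℝ, EuclideanSpace ℝ (Fin n)) (𝓡 n) σ x v)
      = hessianOf (pullMetric σ) (f ∘ σ) x u v := by
  have hx' := mem_inter (σ := σ) hx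
  have hF : ContDiffOn ℝ ∞ (f ∘ (extChartAt (𝓡 n) (σ x)).symm) (extChartAt (𝓡 n) (σ x)).target := by
    rw [← contMDiffOn_iff_contDiffOn]
    exact hf.comp_contMDiffOn (contMDiffOn_extChartAt_symm _)
  have h := (hσ.isPullbackOn (σ x)).hessianOf_comp (chartMetric_isMetricOn (σ x))
      (hσ.isMetricOn_inter (σ x)) hF hx' u v
  have e : f ∘ σ =ᶠ[𝓝 x] (f ∘ (extChartAt (𝓡 n) (σ x)).symm) ∘ transition (σ x) σ :=
    (hσ.eventuallyEq (σ x) hx').fun_comp f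
  have e' : hessianOf (pullMetric σ) (f ∘ σ) x u v = hessianOf (pullMetric σ)
      ((f ∘ (extChartAt (𝓡 n) (σ x)).symm) ∘ transition (σ x) σ) x u v := by
    rw [hessianOf, hessianOf, e.fderiv_eq, e.fderiv.fderiv_eq]
  rw [e', h, hessian, hσ.coords_mfderiv hx, hσ.coords_mfderiv hx]
  rfl

end IsParamOn

end Param


/-! ### Traces in frames that are orthonormal for a varying metric. -/

section Trace

variable {E : Type*} [NormedAddCommGroup E] [InnerProductSpace ℝ E]
  {ι κ : Type*} [Fintype ι] [Fintype κ]

/-- The curvature as a linear map in its first argument. -/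
def curvatureMap (g : E → E →L[ℝ] E →L[ℝ] ℝ) (y v w : E) : E →L[ℝ] E :=
  ((fderiv ℝ (christoffelMap g) y).flip v).flip w - (fderiv ℝ (christoffelMap g) y v).flip w
    + (christoffelMap g y).flip (christoffelMap g y v w)
    - (christoffelMap g y v).comp ((christoffelMap g y).flip w)

lemma IsMetricOn.curvatureMap_apply [FiniteDimensional ℝ E] {g : E → E →L[ℝ] E →L[ℝ] ℝ} {U : Set E}
    (hg : IsMetricOn g U) {x : E} (hx : x ∈ U) (u v w : E) :
    curvatureMap g x v w u = curvatureOf g x u v w := by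
  rw [hg.curvatureOf_eq hx]
  simp [curvatureMap]

lemma curvatureOf_self (g : E → E →L[ℝ] E →L[ℝ] ℝ) (x u w : E) : curvatureOf g x u u w = 0 := by
  simp [curvatureOf]

lemma curvatureOf_antisymm (g : E → E →L[ℝ] E →L[ℝ] ℝ) (x u v w : E) :
    curvatureOf g x u v w = - curvatureOf g x v u w := by
  simp only [curvatureOf]
  abel

/-- The trace of an endomorphism computed in a `B`-orthonormal frame `u`. -/
lemma sum_bilin_eq_trace (e : OrthonormalBasis ι ℝ E) (B : E →L[ℝ] E →L[ℝ] ℝ) {u : κ → E}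
    (hu : ∀ z, ∑ i, B (u i) z • u i = z) (T : E →L[ℝ] E) :
    ∑ i, B (u i) (T (u i)) = ∑ a, inner ℝ (e a) (T (e a)) := by
  have h1 : ∀ a, inner ℝ (e a) (T (e a)) = ∑ i, B (u i) (inner ℝ (e a) (u i) • T (e a)) := by
    intro a
    conv_lhs => rw [← hu (T (e a))]
    rw [inner_sum]
    refine Finset.sum_congr rfl fun i _ => ?_
    rw [real_inner_smul_right, map_smul, smul_eq_mul, mul_comm]
  simp only [h1]
  rw [Finset.sum_comm]
  refine Finset.sum_congr rfl fun i _ => ?_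
  rw [← map_sum]
  congr 1
  conv_lhs => rw [← e.sum_repr' (u i), map_sum]
  simp

/-- The trace of a bilinear form `S` computed in a `B`-orthonormal frame `u`. -/
lemma sum_bilin_eq_sum_inverse (e : OrthonormalBasis ι ℝ E) (B S : E →L[ℝ] E →L[ℝ] ℝ) {u : κ → E}
    (hu : ∀ z, ∑ i, B (u i) z • u i = z) {s : ι → E}
    (hs : ∀ b z, B z (s b) = inner ℝ (e b) z) :
    ∑ i, S (u i) (u i) = ∑ b, S (s b) (e b) := by
  have h1 : ∀ b, S (s b) (e b) = ∑ i, S (u i) (inner ℝ (e b) (u i) • e b) := by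
    intro b
    conv_lhs => rw [← hu (s b)]
    rw [map_sum, sum_apply]
    refine Finset.sum_congr rfl fun i _ => ?_
    rw [hs, map_smul, smul_apply, map_smul]
  simp only [h1]
  rw [Finset.sum_comm]
  refine Finset.sum_congr rfl fun i _ => ?_
  rw [← map_sum, e.sum_repr']

end Trace

/-! ### Ricci tensor, scalar curvature and gradient in a parametrization. -/

section Param

variable {n : ℕ} {M : Type*} [TopologicalSpace M]
  [ChartedSpace (EuclideanSpace ℝ (Fin n)) M]

variable {σ : EuclideanSpace ℝ (Fin n) → M} {U : Set (EuclideanSpace ℝ (Fin n))}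
  [IsManifold (𝓡 n) ∞ M]
variable [RiemannianBundle (fun x : M => TangentSpace (𝓡 n) x)]
  [IsContMDiffRiemannianBundle (𝓡 n) ∞ (EuclideanSpace ℝ (Fin n))
      (fun x : M => TangentSpace (𝓡 n) x)]

namespace IsParamOn

/-- The differential of `σ` at `x`, with the model space as its domain. -/
def diff (σ : EuclideanSpace ℝ (Fin n) → M) (x : EuclideanSpace ℝ (Fin n)) :
    EuclideanSpace ℝ (Fin n) →L[ℝ] TangentSpace (𝓡 n) (σ x) :=
  mfderiv 𝓘(ℝ, EuclideanSpace ℝ (Fin n)) (𝓡 n) σ x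

lemma pullMetric_apply (σ : EuclideanSpace ℝ (Fin n) → M) (x v w : EuclideanSpace ℝ (Fin n)) :
    pullMetric σ x v w = inner ℝ (diff σ x v) (diff σ x w) := rfl

/-- A frame of the model space corresponding to the standard orthonormal basis. -/
lemma exists_frame (hσ : IsParamOn σ U) {x : EuclideanSpace ℝ (Fin n)} (hx : x ∈ U) :
    ∃ u : Fin (Module.finrank ℝ (TangentSpace (𝓡 n) (σ x))) → EuclideanSpace ℝ (Fin n),
      (∀ i, diff σ x (u i) = stdOrthonormalBasis ℝ (TangentSpace (𝓡 n) (σ x)) i) ∧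
      ∀ z, ∑ i, pullMetric σ x (u i) z • u i = z := by
  have hsurj : Function.Surjective (diff σ x) := hσ.surjective hx
  have hinj : Function.Injective (diff σ x) := hσ.injective x hx
  choose u hu using fun i => hsurj (stdOrthonormalBasis ℝ (TangentSpace (𝓡 n) (σ x)) i)
  refine ⟨u, hu, fun z => ?_⟩
  apply hinj
  rw [map_sum]
  simp only [map_smul, pullMetric_apply, hu]
  exact OrthonormalBasis.sum_repr' _ _

lemma ricci_eq (hσ : IsParamOn σ U) {x : EuclideanSpace ℝ (Fin n)} (hx : x ∈ U)
    (e : OrthonormalBasis (Fin n) ℝ (EuclideanSpace ℝ (Fin n))) (v w : EuclideanSpace ℝ (Fin n)) :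
    ricci n (σ x) (diff σ x v) (diff σ x w) = ricciOf e (pullMetric σ) x v w := by
  obtain ⟨u, hu, hz⟩ := hσ.exists_frame hx
  have h1 : ricci n (σ x) (diff σ x v) (diff σ x w)
      = ∑ i, pullMetric σ x (u i) (curvatureMap (pullMetric σ) x v w (u i)) := by
    rw [ricci]
    refine Finset.sum_congr rfl fun i _ => ?_
    rw [← hu, hσ.isMetricOn.curvatureMap_apply hx, hσ.isMetricOn.symm x hx]
    exact hσ.riemann_eq hx (u i) v w (u i)
  rw [h1, sum_bilin_eq_trace e _ hz, ricciOf]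
  simp only [hσ.isMetricOn.curvatureMap_apply hx]

/-- The soliton equation is used at once: `R` is the trace of `Hess f`, so it becomes a Laplacian,
whose smoothness and differential are accessible. -/
lemma scalar_eq (hσ : IsParamOn σ U) {f : M → ℝ} (hf : IsGradientRicciSoliton n f)
    {x : EuclideanSpace ℝ (Fin n)} (hx : x ∈ U)
    (e : OrthonormalBasis (Fin n) ℝ (EuclideanSpace ℝ (Fin n))) :
    scalar n (σ x) = laplacianOf e (pullMetric σ) (f ∘ σ) x := by
  obtain ⟨u, hu, hz⟩ := hσ.exists_frame hx
  have h1 : scalar n (σ x) = ∑ i, hessianMap (pullMetric σ) (f ∘ σ) x (u i) (u i) := by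
    rw [scalar]
    refine Finset.sum_congr rfl fun i _ => ?_
    rw [hf.ricci_eq, ← hu, hessianMap_apply]
    exact hσ.hessian_eq hf.smooth hx (u i) (u i)
  rw [h1, laplacianOf, sum_bilin_eq_sum_inverse e (pullMetric σ x) _ hz
    (s := fun b => (pullMetric σ x).inverse (innerSL ℝ (e b)))]
  · simp only [hessianMap_apply]
  · intro b z
    rw [hσ.isMetricOn.symm x hx, hσ.isMetricOn.apply_inverse hx]
    rfl

lemma inner_grad (f : M → ℝ) (p : M) (X : TangentSpace (𝓡 n) p) :
    inner ℝ (grad n f p) X = mfderiv (𝓡 n) 𝓘(ℝ, ℝ) f p X := by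
  rw [grad]
  exact InnerProductSpace.toDual_symm_apply

lemma fderiv_comp_eq (hσ : IsParamOn σ U) {f : M → ℝ} (hf : MDifferentiable (𝓡 n) 𝓘(ℝ, ℝ) f)
    {x : EuclideanSpace ℝ (Fin n)} (hx : x ∈ U) (u : EuclideanSpace ℝ (Fin n)) :
    fderiv ℝ (f ∘ σ) x u = mfderiv (𝓡 n) 𝓘(ℝ, ℝ) f (σ x) (diff σ x u) := by
  have h := mfderiv_comp (I'' := 𝓘(ℝ, ℝ)) x (hf (σ x)) (hσ.mdifferentiableAt hx)
  rw [← mfderiv_eq_fderiv]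
  exact congrArg (fun L => L u) h

/-- The gradient of `f` in the coordinates given by `σ`. -/
lemma grad_eq (hσ : IsParamOn σ U) {f : M → ℝ} (hf : MDifferentiable (𝓡 n) 𝓘(ℝ, ℝ) f)
    {x : EuclideanSpace ℝ (Fin n)} (hx : x ∈ U) :
    grad n f (σ x) = diff σ x ((pullMetric σ x).inverse (fderiv ℝ (f ∘ σ) x)) := by
  obtain ⟨w, hw⟩ : ∃ w, diff σ x w = grad n f (σ x) := hσ.surjective hx _
  rw [← hw]
  congr 1
  refine hσ.isMetricOn.eq_of_forall hx fun z => ?_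
  rw [hσ.isMetricOn.apply_inverse hx, hσ.fderiv_comp_eq hf hx, pullMetric_apply, hw, inner_grad]

lemma norm_grad_sq (hσ : IsParamOn σ U) {f : M → ℝ} (hf : MDifferentiable (𝓡 n) 𝓘(ℝ, ℝ) f)
    {x : EuclideanSpace ℝ (Fin n)} (hx : x ∈ U) :
    ‖grad n f (σ x)‖ ^ 2 = gradSqOf (pullMetric σ) (f ∘ σ) x := by
  rw [← real_inner_self_eq_norm_sq, inner_grad, gradSqOf, hσ.fderiv_comp_eq hf hx,
    ← hσ.grad_eq hf hx]

/-- The preferred chart around `c` gives a parametrization. -/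
lemma _root_.GradientSoliton.isParamOn_extChartAt_symm (c : M) :
    IsParamOn (n := n) (extChartAt (𝓡 n) c).symm (extChartAt (𝓡 n) c).target where
  isOpen := isOpen_extChartAt_target c
  smooth := contMDiffOn_extChartAt_symm c
  injective _ hy := (isInvertible_mfderiv_extChartAt_symm hy).injective

end IsParamOn

end Param

/-! ### Consequences of positive sectional curvature. -/

section Positivity

variable {n : ℕ} {M : Type*} [TopologicalSpace M]
  [ChartedSpace (EuclideanSpace ℝ (Fin n)) M] [IsManifold (𝓡 n) ∞ M]
  [RiemannianBundle (fun x : M => TangentSpace (𝓡 n) x)]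
  [IsContMDiffRiemannianBundle (𝓡 n) ∞ (EuclideanSpace ℝ (Fin n))
      (fun x : M => TangentSpace (𝓡 n) x)]

lemma riemann_smul_smul (p : M) (X : TangentSpace (𝓡 n) p) (a : ℝ) :
    riemann n p X (a • X) (a • X) X = 0 := by
  have hg := chartMetric_isMetricOn (n := n) p
  have hy := mem_extChartAt_target (I := 𝓡 n) p
  have hc : coords n p (a • X) = a • coords n p X := map_smul (mfderiv (𝓡 n)
    𝓘(ℝ, EuclideanSpace ℝ (Fin n)) (extChartAt (𝓡 n) p) p) a X
  have h0 : chartCurvature n p (extChartAt (𝓡 n) p p) (coords n p X) (coords n p (a • X))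
      (coords n p (a • X)) = 0 := by
    change curvatureOf (chartMetric n p) _ _ _ _ = 0
    rw [curvatureOf_antisymm, ← hg.curvatureMap_apply hy, hc, map_smul, ← hc,
      hg.curvatureMap_apply hy, curvatureOf_self, smul_zero, neg_zero]
  rw [riemann, h0, map_zero, zero_apply]

/-- Cauchy–Schwarz makes the denominator of the sectional curvature nonnegative, so a positive
quotient forces a positive numerator. -/
lemma riemann_pos (hsec : HasPositiveSectionalCurvature n M) {p : M} {X Y : TangentSpace (𝓡 n) p}
    (h : LinearIndependent ℝ ![X, Y]) : 0 < riemann n p X Y Y X := by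
  have h1 := hsec p X Y h
  have h2 : 0 ≤ ‖X‖ ^ 2 * ‖Y‖ ^ 2 - (inner ℝ X Y) ^ 2 := by
    have := real_inner_mul_inner_self_le X Y
    rw [real_inner_self_eq_norm_sq, real_inner_self_eq_norm_sq] at this
    nlinarith
  by_contra hc
  exact absurd h1 (not_lt.mpr (div_nonpos_of_nonpos_of_nonneg (not_lt.mp hc) h2))

lemma riemann_nonneg (hsec : HasPositiveSectionalCurvature n M) {p : M}
    {X Y : TangentSpace (𝓡 n) p} (hX : X ≠ 0) : 0 ≤ riemann n p X Y Y X := by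
  by_cases h : LinearIndependent ℝ ![X, Y]
  · exact (riemann_pos hsec h).le
  · rw [LinearIndependent.pair_iff' hX] at h
    push Not at h
    obtain ⟨a, rfl⟩ := h
    exact (riemann_smul_smul p X a).ge

lemma finrank_tangentSpace (p : M) : Module.finrank ℝ (TangentSpace (𝓡 n) p) = n :=
  finrank_euclideanSpace_fin

/-- In dimension at most one every term of the double trace is `g(R(e, e)e, e) = 0`. The
normalization `R(O) = 1` thus supplies the dimension bound needed for positive Ricci curvature. -/
lemma two_le_of_scalar_ne_zero {p : M} (h : scalar n p ≠ 0) : 2 ≤ n := by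
  by_contra hn
  apply h
  have : Subsingleton (Fin (Module.finrank ℝ (TangentSpace (𝓡 n) p))) := by
    rw [finrank_tangentSpace]
    exact Fin.subsingleton_iff_le_one.mpr (by omega)
  refine Finset.sum_eq_zero fun i _ => Finset.sum_eq_zero fun j _ => ?_
  rw [Subsingleton.elim i j]
  simpa using riemann_smul_smul p (stdOrthonormalBasis ℝ (TangentSpace (𝓡 n) p) j) 1

/-- The trace has nonnegative terms. If none were positive, `X` would be a multiple of every basis
vector, in particular of two orthogonal ones, hence zero. -/
lemma ricci_pos (hsec : HasPositiveSectionalCurvature n M) (hn : 2 ≤ n) {p : M}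
    {X : TangentSpace (𝓡 n) p} (hX : X ≠ 0) : 0 < ricci n p X X := by
  set b := stdOrthonormalBasis ℝ (TangentSpace (𝓡 n) p) with hb
  have hb0 : ∀ i, b i ≠ 0 := fun i => b.orthonormal.ne_zero i
  refine Finset.sum_pos' (fun i _ => riemann_nonneg hsec (hb0 i)) ?_
  by_contra hcon
  push Not at hcon
  have hdep : ∀ i, ∃ a : ℝ, a • b i = X := fun i => by
    by_contra hi
    push Not at hi
    exact absurd (riemann_pos hsec ((LinearIndependent.pair_iff' (hb0 i)).mpr hi))
      (not_lt.mpr (hcon i (Finset.mem_univ i)))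
  have hfin := finrank_tangentSpace (n := n) p
  let i0 : Fin (Module.finrank ℝ (TangentSpace (𝓡 n) p)) := ⟨0, by omega⟩
  let i1 : Fin (Module.finrank ℝ (TangentSpace (𝓡 n) p)) := ⟨1, by omega⟩
  have hne : i0 ≠ i1 := by simp [i0, i1, Fin.ext_iff]
  obtain ⟨a0, h0⟩ := hdep i0
  obtain ⟨a1, h1⟩ := hdep i1
  have h01 : inner ℝ (b i0) (b i1) = (0 : ℝ) := b.orthonormal.inner_eq_zero hne
  have hXX : inner ℝ X X = (0 : ℝ) := by
    have : inner ℝ X X = inner ℝ (a0 • b i0) (a1 • b i1) := by rw [h0, h1]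
    rw [this, real_inner_smul_left, real_inner_smul_right, h01, mul_zero, mul_zero]
  exact hX (inner_self_eq_zero.mp hXX)

lemma ricci_nonneg (hsec : HasPositiveSectionalCurvature n M) (hn : 2 ≤ n) {p : M}
    (X : TangentSpace (𝓡 n) p) : 0 ≤ ricci n p X X := by
  rcases eq_or_ne X 0 with rfl | hX
  · refine Finset.sum_nonneg fun i _ => le_of_eq ?_
    have h := riemann_smul_smul (n := n) p (stdOrthonormalBasis ℝ (TangentSpace (𝓡 n) p) i) 0
    rw [zero_smul] at h
    exact h.symm
  · exact (ricci_pos hsec hn hX).le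

lemma scalar_pos (hsec : HasPositiveSectionalCurvature n M) (hn : 2 ≤ n) (p : M) :
    0 < scalar n p := by
  have hfin := finrank_tangentSpace (n := n) p
  have : Nonempty (Fin (Module.finrank ℝ (TangentSpace (𝓡 n) p))) := ⟨⟨0, by omega⟩⟩
  exact Finset.sum_pos (fun i _ => ricci_pos hsec hn
    ((stdOrthonormalBasis ℝ (TangentSpace (𝓡 n) p)).orthonormal.ne_zero i)) Finset.univ_nonempty

end Positivity


/-! ### Coordinates that are normal to first order at a point. -/

section Local

variable {E : Type*} [NormedAddCommGroup E]

lemma IsMetricOn.fderiv_symm [NormedSpace ℝ E] {h : E → E →L[ℝ] E →L[ℝ] ℝ} {U : Set E}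
    (hh : IsMetricOn h U) {x : E} (hU : x ∈ U) (b v w : E) :
    fderiv ℝ h x b v w = fderiv ℝ h x b w v := by
  have cst : ∀ v : E, DifferentiableAt ℝ (fun _ : E => v) x := differentiableAt_const
  have hd := (hh.contDiffAt hU).differentiableAt (by simp)
  have e : (fun y => h y v w) =ᶠ[𝓝 x] fun y => h y w v := by
    filter_upwards [hh.isOpen.mem_nhds hU] with y hy using hh.symm y hy v w
  rw [← fderiv_apply_const hd, ← fderiv_apply_const (hd.clm_apply (cst v)), e.fderiv_eq,
    fderiv_apply_const (hd.clm_apply (cst w)), fderiv_apply_const hd]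

/-- By `map_christoffel`, the condition on `D²ψ` makes the Christoffel symbol of `h` vanish at `x`.
Since `∂ᵥ h(w, z)` is the sum of two lowered Christoffel symbols, all first derivatives of `h`
vanish too. -/
lemma IsPullbackOn.isNormalAt [InnerProductSpace ℝ E] [FiniteDimensional ℝ E]
    {g h : E → E →L[ℝ] E →L[ℝ] ℝ} {ψ : E → E} {U V : Set E}
    (hψ : IsPullbackOn g h ψ U V) (hg : IsMetricOn g V) (hh : IsMetricOn h U) {x : E} (hx : x ∈ U)
    (h1 : ∀ v w, g (ψ x) (fderiv ℝ ψ x v) (fderiv ℝ ψ x w) = inner ℝ v w)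
    (h2 : ∀ v w, fderiv ℝ (fderiv ℝ ψ) x v w
      = - christoffelOf g (ψ x) (fderiv ℝ ψ x v) (fderiv ℝ ψ x w)) :
    IsNormalAt h x where
  eq_inner v w := by rw [hψ.eq x hx, h1]
  fderiv_eq := by
    have h0 : ∀ v w, christoffelOf h x v w = 0 := fun v w => by
      apply hψ.fderiv_injective hh hx
      rw [hψ.map_christoffel hg hh hx, h2, neg_add_cancel, map_zero]
    have h3 := fun v w z => hh.apply_christoffelOf hx v w z
    simp only [h0, map_zero, zero_apply] at h3
    ext v w z
    have e1 := h3 v w z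
    have e2 := h3 v z w
    rw [hh.fderiv_symm hx v z w, hh.fderiv_symm hx z v w] at e2
    rw [hh.fderiv_symm hx w v z] at e1
    rw [hh.fderiv_symm hx z v w] at e1
    rw [hh.fderiv_symm hx w v z] at e2
    simp only [zero_apply]
    linarith

variable [NormedSpace ℝ E]

/-- The quadratic map with value `y`, differential `A` and second differential `-N` at `0`. -/
def quadraticMap (y : E) (A : E →L[ℝ] E) (N : E →L[ℝ] E →L[ℝ] E) (x : E) : E :=
  y + A x - (1 / 2 : ℝ) • N x x

lemma fderiv_quadraticMap (y : E) (A : E →L[ℝ] E) {N : E →L[ℝ] E →L[ℝ] E}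
    (hN : ∀ v w, N v w = N w v) : fderiv ℝ (quadraticMap y A N) = fun x => A - N x := by
  ext x v
  have h := ((A.hasFDerivAt (x := x)).const_add y).fun_sub
    ((N.hasFDerivAt.clm_apply (hasFDerivAt_id x)).const_smul (1 / 2 : ℝ))
  have h' : HasFDerivAt (quadraticMap y A N) _ x := h
  rw [h'.fderiv]
  simp only [sub_apply, smul_apply, add_apply, ContinuousLinearMap.comp_apply,
    ContinuousLinearMap.id_apply, ContinuousLinearMap.flip_apply, id, hN v x]
  rw [← two_smul ℝ, smul_smul]
  norm_num

lemma fderiv_fderiv_quadraticMap (y : E) (A : E →L[ℝ] E) {N : E →L[ℝ] E →L[ℝ] E}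
    (hN : ∀ v w, N v w = N w v) (x : E) : fderiv ℝ (fderiv ℝ (quadraticMap y A N)) x = -N := by
  rw [fderiv_quadraticMap y A hN, fderiv_const_sub, N.fderiv]

lemma contDiff_quadraticMap (y : E) (A : E →L[ℝ] E) (N : E →L[ℝ] E →L[ℝ] E) :
    ContDiff ℝ ∞ (quadraticMap y A N) := by
  unfold quadraticMap
  exact (contDiff_const.add A.contDiff).sub
    ((N.contDiff.clm_apply contDiff_id).const_smul (1 / 2 : ℝ))

end Local

section Param

variable {n : ℕ} {M : Type*} [TopologicalSpace M]
  [ChartedSpace (EuclideanSpace ℝ (Fin n)) M]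
  [IsManifold (𝓡 n) ∞ M]
  [RiemannianBundle (fun x : M => TangentSpace (𝓡 n) x)]
  [IsContMDiffRiemannianBundle (𝓡 n) ∞ (EuclideanSpace ℝ (Fin n))
      (fun x : M => TangentSpace (𝓡 n) x)]

lemma diff_comp (c : M) {ψ : EuclideanSpace ℝ (Fin n) → EuclideanSpace ℝ (Fin n)}
    {x : EuclideanSpace ℝ (Fin n)} (hψ : DifferentiableAt ℝ ψ x)
    (hx : ψ x ∈ (extChartAt (𝓡 n) c).target) (u : EuclideanSpace ℝ (Fin n)) :
    mfderiv 𝓘(ℝ, EuclideanSpace ℝ (Fin n)) (𝓡 n) ((extChartAt (𝓡 n) c).symm ∘ ψ) x u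
      = mfderiv 𝓘(ℝ, EuclideanSpace ℝ (Fin n)) (𝓡 n) (extChartAt (𝓡 n) c).symm (ψ x)
        (fderiv ℝ ψ x u) := by
  have h := mfderiv_comp (I'' := 𝓡 n) x
    (mdifferentiableAt_extChartAt_symm hx) hψ.mdifferentiableAt
  rw [← mfderiv_eq_fderiv]
  exact congrArg (fun L => L u) h

lemma isParamOn_comp (c : M) {ψ : EuclideanSpace ℝ (Fin n) → EuclideanSpace ℝ (Fin n)}
    {U : Set (EuclideanSpace ℝ (Fin n))} (hU : IsOpen U) (hψ : ContDiffOn ℝ ∞ ψ U)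
    (hmaps : MapsTo ψ U (extChartAt (𝓡 n) c).target)
    (hinj : ∀ x ∈ U, Function.Injective (fderiv ℝ ψ x)) :
    IsParamOn ((extChartAt (𝓡 n) c).symm ∘ ψ) U where
  isOpen := hU
  smooth := (contMDiffOn_extChartAt_symm c).comp (contMDiffOn_iff_contDiffOn.mpr hψ) hmaps
  injective x hx v w hvw := by
    have hd := (hψ.contDiffAt (hU.mem_nhds hx)).differentiableAt (by simp)
    apply hinj x hx
    refine (isInvertible_mfderiv_extChartAt_symm (hmaps hx)).injective ?_
    exact (diff_comp c hd (hmaps hx) v).symm.trans (hvw.trans (diff_comp c hd (hmaps hx) w))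

/-- Around each point there are coordinates that are normal to first order at that point. -/
lemma exists_isNormalAt (p : M) : ∃ (σ : EuclideanSpace ℝ (Fin n) → M)
    (U : Set (EuclideanSpace ℝ (Fin n))), IsParamOn σ U ∧ 0 ∈ U ∧ σ 0 = p ∧
      IsNormalAt (pullMetric σ) 0 := by
  set φ := extChartAt (𝓡 n) p with hφ
  set y := φ p with hy
  have hyt : y ∈ φ.target := mem_extChartAt_target p
  have hg := chartMetric_isMetricOn (n := n) p
  have hDinv := isInvertible_mfderiv_extChartAt_symm hyt
  set b : OrthonormalBasis (Fin n) ℝ (TangentSpace (𝓡 n) (φ.symm y)) :=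
    (stdOrthonormalBasis ℝ (TangentSpace (𝓡 n) (φ.symm y))).reindex
      (finCongr (finrank_tangentSpace _)) with hb
  obtain ⟨D, hD⟩ := hDinv
  -- `A` sends the standard basis to a frame orthonormal at `y`; it will be the differential of the
  -- new coordinates.
  let A' : EuclideanSpace ℝ (Fin n) ≃L[ℝ] EuclideanSpace ℝ (Fin n) :=
    b.repr.symm.toContinuousLinearEquiv.trans D.symm
  let A : EuclideanSpace ℝ (Fin n) →L[ℝ] EuclideanSpace ℝ (Fin n) := A'
  have hA : ∀ v w, chartMetric n p y (A v) (A w) = inner ℝ v w := fun v w => by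
    rw [chartMetric_apply]
    have key : ∀ u, mfderiv 𝓘(ℝ, EuclideanSpace ℝ (Fin n)) (𝓡 n) φ.symm y (A u)
        = b.repr.symm u := fun u => by
      rw [← hD]
      exact D.apply_symm_apply (b.repr.symm u)
    rw [key, key]
    exact b.repr.symm.inner_map_map v w
  -- The second differential `-N` of the quadratic map is chosen to cancel the Christoffel symbol at
  -- `y`.
  let N := (christoffelMap (chartMetric n p) y).bilinearComp A A
  have hNa : ∀ v w, N v w = christoffelOf (chartMetric n p) y (A v) (A w) := fun v w => by
    rw [← christoffelMap_apply]
    rfl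
  have hN : ∀ v w, N v w = N w v := fun v w => by
    rw [hNa, hNa, hg.christoffelOf_symm hyt]
  set ψ := quadraticMap y A N with hψdef
  have hψ : ContDiff ℝ ∞ ψ := contDiff_quadraticMap y A N
  have hψ0 : ψ 0 = y := by simp [hψdef, quadraticMap]
  have hψ1 : fderiv ℝ ψ = fun x => A - N x := fderiv_quadraticMap y A hN
  have hψ10 : fderiv ℝ ψ 0 = A := by simp [hψ1]
  have hψ2 : fderiv ℝ (fderiv ℝ ψ) 0 = -N := fderiv_fderiv_quadraticMap y A hN 0
  set U := ψ ⁻¹' φ.target ∩ (fderiv ℝ ψ) ⁻¹'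
    (range ((↑) : (EuclideanSpace ℝ (Fin n) ≃L[ℝ] EuclideanSpace ℝ (Fin n)) →
      EuclideanSpace ℝ (Fin n) →L[ℝ] EuclideanSpace ℝ (Fin n))) with hUdef
  have hU : IsOpen U := (hψ.continuous.isOpen_preimage _ (isOpen_extChartAt_target p)).inter
    ((hψ.continuous_fderiv (by simp)).isOpen_preimage _ ContinuousLinearEquiv.isOpen)
  have h0U : (0 : EuclideanSpace ℝ (Fin n)) ∈ U := by
    refine ⟨?_, A', ?_⟩
    · rw [mem_preimage, hψ0]
      exact hyt
    · rw [hψ10]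
  have hmaps : MapsTo ψ U φ.target := fun x hx => hx.1
  have hinj : ∀ x ∈ U, Function.Injective (fderiv ℝ ψ x) := fun x hx => by
    obtain ⟨e, he⟩ := hx.2
    rw [← he]
    exact e.injective
  have hσ : IsParamOn (φ.symm ∘ ψ) U := isParamOn_comp p hU hψ.contDiffOn hmaps hinj
  refine ⟨φ.symm ∘ ψ, U, hσ, h0U, ?_, ?_⟩
  · rw [Function.comp_apply, hψ0]
    exact extChartAt_to_inv p
  · have hpull : IsPullbackOn (chartMetric n p) (pullMetric (φ.symm ∘ ψ)) ψ U φ.target := by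
      refine ⟨hψ.contDiffOn, hmaps, fun x hx v w => ?_⟩
      have hd : DifferentiableAt ℝ ψ x := hψ.differentiable (by simp) x
      exact congrArg₂ (tangentInner (n := n) (φ.symm (ψ x))) (diff_comp p hd (hmaps hx) v)
        (diff_comp p hd (hmaps hx) w)
    refine hpull.isNormalAt hg hσ.isMetricOn h0U (fun v w => ?_) fun v w => ?_
    · rw [hψ0, hψ10]
      exact hA v w
    · rw [hψ0, hψ2, hψ10, neg_apply, neg_apply, hNa]

end Param

/-! ### The conserved quantity `R + |∇f|²`. -/

section Conservation

variable {n : ℕ} {M : Type*} [TopologicalSpace M]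
  [ChartedSpace (EuclideanSpace ℝ (Fin n)) M]
  [IsManifold (𝓡 n) ∞ M]
  [RiemannianBundle (fun x : M => TangentSpace (𝓡 n) x)]
  [IsContMDiffRiemannianBundle (𝓡 n) ∞ (EuclideanSpace ℝ (Fin n))
      (fun x : M => TangentSpace (𝓡 n) x)]

lemma IsMetricOn.contDiffAt_laplacianOf_add_gradSqOf {E : Type*} [NormedAddCommGroup E]
    [InnerProductSpace ℝ E] [FiniteDimensional ℝ E] {ι : Type*} [Fintype ι]
    (e : OrthonormalBasis ι ℝ E) {h : E → E →L[ℝ] E →L[ℝ] ℝ} {U : Set E} (hh : IsMetricOn h U)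
    {x : E} (hU : x ∈ U) {F : E → ℝ} (hF : ContDiffAt ℝ ∞ F x) :
    ContDiffAt ℝ ∞ (laplacianOf e h F) x ∧ ContDiffAt ℝ ∞ (gradSqOf h F) x := by
  have hc1 : ContDiffAt ℝ ∞ (fderiv ℝ F) x := hF.fderiv_right (by simp)
  have hcG := hh.contDiffAt_christoffelMap hU
  have hi := hh.contDiffAt_inverse hU
  have hH : ContDiffAt ℝ ∞ (hessianMap h F) x :=
    (hc1.fderiv_right (m := ∞) (by simp)).sub
      (((ContinuousLinearMap.contDiff _).contDiffAt.comp x hc1).clm_comp hcG)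
  refine ⟨?_, hc1.clm_apply (hi.clm_apply hc1)⟩
  have e1 : laplacianOf e h F
      = fun y => ∑ b, hessianMap h F y ((h y).inverse (innerSL ℝ (e b))) (e b) := by
    ext y
    simp only [laplacianOf, hessianMap_apply]
  rw [e1]
  exact ContDiffAt.sum fun b _ =>
    (hH.clm_apply (hi.clm_apply contDiffAt_const)).clm_apply contDiffAt_const

variable {f : M → ℝ}

lemma IsGradientRicciSoliton.contDiffAt_comp (hf : IsGradientRicciSoliton n f)
    {σ : EuclideanSpace ℝ (Fin n) → M} {U : Set (EuclideanSpace ℝ (Fin n))} (hσ : IsParamOn σ U)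
    {x : EuclideanSpace ℝ (Fin n)} (hx : x ∈ U) : ContDiffAt ℝ ∞ (f ∘ σ) x := by
  rw [← contMDiffAt_iff_contDiffAt]
  exact (hf.smooth (σ x)).comp x (hσ.contMDiffAt hx)

lemma IsGradientRicciSoliton.mdifferentiable (hf : IsGradientRicciSoliton n f) :
    MDifferentiable (𝓡 n) 𝓘(ℝ, ℝ) f :=
  hf.smooth.mdifferentiable (by simp)

lemma IsGradientRicciSoliton.ricciOf_eq (hf : IsGradientRicciSoliton n f)
    {σ : EuclideanSpace ℝ (Fin n) → M} {U : Set (EuclideanSpace ℝ (Fin n))} (hσ : IsParamOn σ U)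
    (e : OrthonormalBasis (Fin n) ℝ (EuclideanSpace ℝ (Fin n)))
    {x : EuclideanSpace ℝ (Fin n)} (hx : x ∈ U) (u v : EuclideanSpace ℝ (Fin n)) :
    ricciOf e (pullMetric σ) x u v = hessianOf (pullMetric σ) (f ∘ σ) x u v := by
  rw [← hσ.ricci_eq hx, hf.ricci_eq]
  exact hσ.hessian_eq hf.smooth hx u v

/-- The quantity `R + |∇f|²`. -/
def hamiltonQuantity (n : ℕ) {M : Type*} [TopologicalSpace M]
    [ChartedSpace (EuclideanSpace ℝ (Fin n)) M]
    [RiemannianBundle (fun x : M => TangentSpace (𝓡 n) x)] (f : M → ℝ) (p : M) : ℝ :=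
  scalar n p + ‖grad n f p‖ ^ 2

lemma hamiltonQuantity_eventuallyEq (hf : IsGradientRicciSoliton n f)
    {σ : EuclideanSpace ℝ (Fin n) → M} {U : Set (EuclideanSpace ℝ (Fin n))} (hσ : IsParamOn σ U)
    (e : OrthonormalBasis (Fin n) ℝ (EuclideanSpace ℝ (Fin n)))
    {x : EuclideanSpace ℝ (Fin n)} (hx : x ∈ U) :
    hamiltonQuantity n f ∘ σ =ᶠ[𝓝 x]
      fun y => laplacianOf e (pullMetric σ) (f ∘ σ) y + gradSqOf (pullMetric σ) (f ∘ σ) y := by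
  filter_upwards [hσ.isOpen.mem_nhds hx] with y hy
  rw [Function.comp_apply, hamiltonQuantity, hσ.scalar_eq hf hy e,
    hσ.norm_grad_sq hf.mdifferentiable hy]

lemma mdifferentiable_hamiltonQuantity (hf : IsGradientRicciSoliton n f) :
    MDifferentiable (𝓡 n) 𝓘(ℝ, ℝ) (hamiltonQuantity n f) := by
  intro p
  have := isManifold_one (n := n) (M := M)
  have hσ := isParamOn_extChartAt_symm (n := n) p
  have hy := mem_extChartAt_target (I := 𝓡 n) p
  have e := EuclideanSpace.basisFun (Fin n) ℝ
  obtain ⟨h1, h2⟩ := hσ.isMetricOn.contDiffAt_laplacianOf_add_gradSqOf e hy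
    (hf.contDiffAt_comp hσ hy)
  have h3 : DifferentiableAt ℝ (hamiltonQuantity n f ∘ (extChartAt (𝓡 n) p).symm)
      (extChartAt (𝓡 n) p p) :=
    ((h1.add h2).differentiableAt (by simp)).congr_of_eventuallyEq
      (hamiltonQuantity_eventuallyEq hf hσ e hy)
  have h4 := h3.mdifferentiableAt.comp p
    (mdifferentiableAt_extChartAt (I := 𝓡 n) (mem_chart_source _ p))
  refine h4.congr_of_eventuallyEq ?_
  filter_upwards [extChartAt_source_mem_nhds (I := 𝓡 n) p] with q hq
  simp only [Function.comp_apply]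
  rw [(extChartAt (𝓡 n) p).left_inv hq]

/-- In normal coordinates at `p` the two differentials are `-2 Hess f(∇f, ·)` and `2 Hess f(∇f, ·)`.
-/
lemma mfderiv_hamiltonQuantity (hf : IsGradientRicciSoliton n f) (p : M) :
    mfderiv (𝓡 n) 𝓘(ℝ, ℝ) (hamiltonQuantity n f) p = 0 := by
  obtain ⟨σ, U, hσ, h0, rfl, hN⟩ := exists_isNormalAt (n := n) p
  have e := EuclideanSpace.basisFun (Fin n) ℝ
  have hF := hf.contDiffAt_comp hσ h0
  obtain ⟨h1, h2⟩ := hσ.isMetricOn.contDiffAt_laplacianOf_add_gradSqOf e h0 hF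
  ext X
  obtain ⟨u, rfl⟩ : ∃ u, IsParamOn.diff σ 0 u = X := hσ.surjective h0 X
  rw [← hσ.fderiv_comp_eq (mdifferentiable_hamiltonQuantity hf) h0,
    (hamiltonQuantity_eventuallyEq hf hσ e h0).fderiv_eq,
    fderiv_fun_add (h1.differentiableAt (by simp)) (h2.differentiableAt (by simp)), add_apply,
    hN.fderiv_gradSqOf hσ.isMetricOn h0 hF, hN.fderiv_laplacianOf_of_soliton hσ.isMetricOn h0 hF e
      fun y hy u v => hf.ricciOf_eq hσ e hy u v, neg_mul]
  exact neg_add_cancel _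

/-- At a maximum of the scalar curvature, the gradient of the potential vanishes if the Ricci
tensor is positive. -/
lemma grad_eq_zero_of_isLocalMax_scalar (hf : IsGradientRicciSoliton n f)
    (hsec : HasPositiveSectionalCurvature n M) (hn : 2 ≤ n) {p : M}
    (hmax : ∀ q : M, scalar n q ≤ scalar n p) : grad n f p = 0 := by
  obtain ⟨σ, U, hσ, h0, rfl, hN⟩ := exists_isNormalAt (n := n) p
  have e := EuclideanSpace.basisFun (Fin n) ℝ
  have hF := hf.contDiffAt_comp hσ h0
  set X := (pullMetric σ 0).inverse (fderiv ℝ (f ∘ σ) 0) with hX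
  have hgrad : grad n f (σ 0) = IsParamOn.diff σ 0 X := hσ.grad_eq hf.mdifferentiable h0
  have hloc : IsLocalMax (laplacianOf e (pullMetric σ) (f ∘ σ)) 0 := by
    filter_upwards [hσ.isOpen.mem_nhds h0] with y hy
    rw [← hσ.scalar_eq hf hy e, ← hσ.scalar_eq hf h0 e]
    exact hmax _
  -- At the maximum `dR = 0`; evaluated on `X = ∇f` this says `Ric(∇f, ∇f) = 0`.
  have h1 := hN.fderiv_laplacianOf_of_soliton hσ.isMetricOn h0 hF e
    (fun y hy u v => hf.ricciOf_eq hσ e hy u v) X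
  rw [hloc.fderiv_eq_zero, zero_apply, ← hX, ← hN.hessianOf_eq, ← hf.ricciOf_eq hσ e h0,
    ← hσ.ricci_eq h0, ← hgrad] at h1
  by_contra hne
  have := ricci_pos hsec hn hne
  linarith

end Conservation


/-! ### Lengths of curves, Riemannian distance and gradient bounds. -/

section Length

open MeasureTheory
open scoped ENNReal

variable {n : ℕ} {M : Type*} [MetricSpace M]
  [ChartedSpace (EuclideanSpace ℝ (Fin n)) M] [IsManifold (𝓡 n) ∞ M]
  [RiemannianBundle (fun x : M => TangentSpace (𝓡 n) x)]
  [IsContMDiffRiemannianBundle (𝓡 n) ∞ (EuclideanSpace ℝ (Fin n))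
    (fun x : M => TangentSpace (𝓡 n) x)]

lemma hasDerivAt_comp_curve {f : M → ℝ} {γ : ℝ → M} {t : ℝ}
    (hf : MDifferentiableAt (𝓡 n) 𝓘(ℝ, ℝ) f (γ t)) (hγ : MDifferentiableAt 𝓘(ℝ, ℝ) (𝓡 n) γ t) :
    HasDerivAt (f ∘ γ) (inner ℝ (grad n f (γ t)) (velocity n γ t)) t := by
  have h := mfderiv_comp (I'' := 𝓘(ℝ, ℝ)) t hf hγ
  have hd : DifferentiableAt ℝ (f ∘ γ) t := (hf.comp t hγ).differentiableAt
  have e : deriv (f ∘ γ) t = inner ℝ (grad n f (γ t)) (velocity n γ t) := by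
    rw [IsParamOn.inner_grad, ← fderiv_apply_one_eq_deriv, ← mfderiv_eq_fderiv]
    exact congrArg (fun L => L 1) h
  rw [← e]
  exact hd.hasDerivAt

/-- The variation of a function along a curve is at most its Lipschitz constant times the
length of the curve. -/
lemma enorm_sub_le_pathELength {f : M → ℝ} (hf : ContMDiff (𝓡 n) 𝓘(ℝ, ℝ) 1 f) {γ : ℝ → M}
    (hγ : ContMDiff 𝓘(ℝ, ℝ) (𝓡 n) 1 γ) {C : ℝ}
    {a b : ℝ} (hab : a ≤ b) (hC : ∀ t ∈ Icc a b, ‖grad n f (γ t)‖ ≤ C) :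
    ‖f (γ b) - f (γ a)‖ₑ ≤ ENNReal.ofReal C * Manifold.pathELength (𝓡 n) γ a b := by
  have hc : ContDiff ℝ 1 (f ∘ γ) := contMDiff_iff_contDiff.mp (hf.comp hγ)
  refine (enorm_sub_le_lintegral_derivWithin_Icc_of_contDiffOn_Icc hc.contDiffOn hab).trans ?_
  rw [Manifold.pathELength_eq_lintegral_mfderiv_Ioo,
    ← lintegral_const_mul' _ _ ENNReal.ofReal_ne_top, ← restrict_Ioo_eq_restrict_Icc]
  refine setLIntegral_mono' measurableSet_Ioo fun t ht => ?_
  have h1 := hasDerivAt_comp_curve (n := n) (hf.mdifferentiable (by simp) (γ t))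
    (hγ.mdifferentiable (by simp) t)
  rw [derivWithin_of_mem_nhds (Icc_mem_nhds ht.1 ht.2), h1.deriv]
  have h2 : ‖inner ℝ (grad n f (γ t)) (velocity n γ t)‖ ≤ C * ‖velocity n γ t‖ :=
    (norm_inner_le_norm _ _).trans
      (mul_le_mul_of_nonneg_right (hC t (Ioo_subset_Icc_self ht)) (norm_nonneg _))
  have hC0 : 0 ≤ C := (norm_nonneg _).trans (hC t (Ioo_subset_Icc_self ht))
  have h3 := ENNReal.ofReal_le_ofReal h2
  rw [ENNReal.ofReal_mul hC0, ofReal_norm, ofReal_norm] at h3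
  exact h3

variable [IsRiemannianManifold (𝓡 n) M]

/-- The distance is an infimum of lengths. These almost minimizing curves take the place of
minimizing geodesics in all later path arguments. -/
lemma exists_curve {x y : M} {r : ℝ} (h : dist x y < r) : ∃ γ : ℝ → M, γ 0 = x ∧ γ 1 = y ∧
    ContMDiff 𝓘(ℝ, ℝ) (𝓡 n) 1 γ ∧ Manifold.pathELength (𝓡 n) γ 0 1 < ENNReal.ofReal r := by
  have h1 : Manifold.riemannianEDist (𝓡 n) x y < ENNReal.ofReal r := by
    rw [← IsRiemannianManifold.out, edist_dist]
    exact (ENNReal.ofReal_lt_ofReal_iff_of_nonneg dist_nonneg).mpr h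
  obtain ⟨γ, h0, h1, hs, hl, -, -⟩ :=
    Manifold.exists_lt_locally_constant_of_riemannianEDist_lt h1 zero_lt_one
  exact ⟨γ, h0, h1, hs, hl⟩

lemma edist_le_pathELength {γ : ℝ → M} {a b : ℝ} (hab : a ≤ b)
    (hγ : ContMDiffOn 𝓘(ℝ, ℝ) (𝓡 n) 1 γ (Icc a b)) :
    edist (γ a) (γ b) ≤ Manifold.pathELength (𝓡 n) γ a b := by
  rw [IsRiemannianManifold.out (I := 𝓡 n)]
  exact Manifold.riemannianEDist_le_pathELength hγ rfl rfl hab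

lemma dist_le_of_norm_velocity_le {γ : ℝ → M} {a b C : ℝ} (hab : a ≤ b)
    (hγ : ContMDiffOn 𝓘(ℝ, ℝ) (𝓡 n) 1 γ (Icc a b)) (hC0 : 0 ≤ C)
    (hC : ∀ t ∈ Ioo a b, ‖velocity n γ t‖ ≤ C) : dist (γ a) (γ b) ≤ C * (b - a) := by
  have h1 := edist_le_pathELength hab hγ
  rw [Manifold.pathELength_eq_lintegral_mfderiv_Ioo] at h1
  have h2 : ∫⁻ t in Ioo a b, ‖mfderiv 𝓘(ℝ, ℝ) (𝓡 n) γ t 1‖ₑ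
      ≤ ∫⁻ _ in Ioo a b, ENNReal.ofReal C := by
    refine setLIntegral_mono' measurableSet_Ioo fun t ht => ?_
    have h3 := ENNReal.ofReal_le_ofReal (hC t ht)
    rw [ofReal_norm] at h3
    exact h3
  rw [setLIntegral_const, Real.volume_Ioo, ← ENNReal.ofReal_mul hC0] at h2
  have h3 := h1.trans h2
  rw [edist_dist, ENNReal.ofReal_le_ofReal_iff (mul_nonneg hC0 (sub_nonneg.mpr hab))] at h3
  exact h3

/-- Along a curve of length less than `r`, the distances to the end points add up to less
than `r`. -/
lemma dist_add_dist_lt {γ : ℝ → M} (hγ : ContMDiff 𝓘(ℝ, ℝ) (𝓡 n) 1 γ) {r : ℝ}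
    (hr : Manifold.pathELength (𝓡 n) γ 0 1 < ENNReal.ofReal r) {t : ℝ} (ht : t ∈ Icc (0 : ℝ) 1) :
    dist (γ 0) (γ t) + dist (γ t) (γ 1) < r := by
  have h1 := edist_le_pathELength ht.1 (hγ.contMDiffOn (s := Icc 0 t))
  have h2 := edist_le_pathELength ht.2 (hγ.contMDiffOn (s := Icc t 1))
  have h3 := add_le_add h1 h2
  rw [Manifold.pathELength_add ht.1 ht.2] at h3
  have h4 := h3.trans_lt hr
  rw [edist_dist, edist_dist, ← ENNReal.ofReal_add dist_nonneg dist_nonneg,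
    ENNReal.ofReal_lt_ofReal_iff_of_nonneg (by positivity)] at h4
  exact h4

/-- A Riemannian manifold is a length space. -/
lemma exists_dist_le_dist_lt (n : ℕ) {M : Type*} [MetricSpace M]
    [ChartedSpace (EuclideanSpace ℝ (Fin n)) M]
    [RiemannianBundle (fun x : M => TangentSpace (𝓡 n) x)] [IsManifold (𝓡 n) ∞ M]
    [IsContMDiffRiemannianBundle (𝓡 n) ∞ (EuclideanSpace ℝ (Fin n))
      (fun x : M => TangentSpace (𝓡 n) x)]
    [IsRiemannianManifold (𝓡 n) M] {x y : M} {r₁ r₂ : ℝ} (h₁ : 0 ≤ r₁) (h₂ : 0 < r₂)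
    (h : dist x y < r₁ + r₂) : ∃ z, dist x z ≤ r₁ ∧ dist z y < r₂ := by
  by_cases hxy : dist x y ≤ r₁
  · exact ⟨y, hxy, by simpa using h₂⟩
  push Not at hxy
  obtain ⟨γ, rfl, rfl, hs, hl⟩ := exists_curve (n := n) h
  have hc : ContinuousOn (fun t => dist (γ 0) (γ t)) (Icc 0 1) :=
    (continuous_const.dist hs.continuous).continuousOn
  obtain ⟨t, ht, he⟩ := intermediate_value_Icc zero_le_one hc
    (show r₁ ∈ Icc _ _ from ⟨by simpa using h₁, hxy.le⟩)
  have he : dist (γ 0) (γ t) = r₁ := he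
  have := dist_add_dist_lt hs hl ht
  exact ⟨γ t, he.le, by linarith⟩

lemma joined_of_isRiemannianManifold (n : ℕ) {M : Type*} [MetricSpace M]
    [ChartedSpace (EuclideanSpace ℝ (Fin n)) M]
    [RiemannianBundle (fun x : M => TangentSpace (𝓡 n) x)] [IsManifold (𝓡 n) ∞ M]
    [IsContMDiffRiemannianBundle (𝓡 n) ∞ (EuclideanSpace ℝ (Fin n))
      (fun x : M => TangentSpace (𝓡 n) x)]
    [IsRiemannianManifold (𝓡 n) M] (x y : M) : Joined x y := by
  obtain ⟨γ, h0, h1, hs, -⟩ := exists_curve (n := n) (lt_add_one (dist x y))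
  exact ⟨⟨⟨fun t => γ t, hs.continuous.comp continuous_subtype_val⟩, by simp [h0], by simp [h1]⟩⟩

/-- If the gradient of `f` has norm at most `C` on the ball, then `f` varies at most like `C` times
the distance to the centre. -/
lemma abs_sub_le_of_norm_grad_le {f : M → ℝ} (hf : ContMDiff (𝓡 n) 𝓘(ℝ, ℝ) 1 f) {x y : M}
    {C r : ℝ} (hC : ∀ z, dist x z < r → ‖grad n f z‖ ≤ C) (hC0 : 0 ≤ C) (hy : dist x y < r) :
    |f y - f x| ≤ C * dist x y := by
  -- A curve of length less than `ρ` from `x` stays inside the ball where the gradient bound holds;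
  -- afterwards `ρ` decreases to `dist x y`.
  have key : ∀ ρ, dist x y < ρ → ρ < r → |f y - f x| ≤ C * ρ := fun ρ h1 h2 => by
    obtain ⟨γ, rfl, rfl, hs, hl⟩ := exists_curve (n := n) h1
    have h3 := enorm_sub_le_pathELength hf hs zero_le_one (C := C) fun t ht => by
      refine hC _ (lt_of_le_of_lt ?_ h2)
      have := dist_add_dist_lt hs hl ht
      have := dist_nonneg (x := γ t) (y := γ 1)
      linarith
    have h4 := h3.trans (mul_le_mul_right hl.le _)
    rw [← ENNReal.ofReal_mul hC0, ← ofReal_norm, Real.norm_eq_abs] at h4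
    have hρ : 0 ≤ ρ := dist_nonneg.trans h1.le
    exact (ENNReal.ofReal_le_ofReal_iff (by positivity)).mp h4
  refine ge_of_tendsto (f := fun ρ => C * ρ) (x := 𝓝[>] dist x y)
    (((continuous_const.mul continuous_id).tendsto _).mono_left nhdsWithin_le_nhds) ?_
  filter_upwards [Ioo_mem_nhdsGT hy] with ρ hρ using key ρ hρ.1 hρ.2

end Length

/-! ### Compactness of closed balls. -/

section HopfRinow

/-- The Hopf–Rinow–Cohn-Vossen theorem: a complete locally compact length space is proper. -/
theorem properSpace_of_exists_dist_le_dist_lt {X : Type*} [MetricSpace X] [CompleteSpace X]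
    [WeaklyLocallyCompactSpace X]
    (hX : ∀ (x y : X) (r₁ r₂ : ℝ), 0 ≤ r₁ → 0 < r₂ → dist x y < r₁ + r₂ →
      ∃ z, dist x z ≤ r₁ ∧ dist z y < r₂) : ProperSpace X := by
  refine ⟨fun x => ?_⟩
  by_contra! hcon
  obtain ⟨r₀, hr₀⟩ := hcon
  -- If some ball fails to be compact, the compact radii are bounded above. Their supremum `R` is
  -- shown to be a compact radius and then to be exceeded.
  set S := {r : ℝ | IsCompact (Metric.closedBall x r)} with hS
  have hdown : ∀ r ∈ S, ∀ r' ≤ r, r' ∈ S := fun r hr r' hr' =>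
    IsCompact.of_isClosed_subset hr Metric.isClosed_closedBall (Metric.closedBall_subset_closedBall hr')
  have hbdd : BddAbove S := ⟨r₀, fun r hr => by
    by_contra! h
    exact hr₀ (hdown r hr r₀ h.le)⟩
  have h0 : (0 : ℝ) ∈ S := by
    simp [hS]
  set R := sSup S with hR
  have hR0 : 0 ≤ R := le_csSup hbdd h0
  have hlt : ∀ r < R, r ∈ S := fun r hr => by
    obtain ⟨r', hr', h⟩ := exists_lt_of_lt_csSup ⟨0, h0⟩ hr
    exact hdown r' hr' r h.le
  have hRS : IsCompact (Metric.closedBall x R) := by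
    refine isCompact_iff_totallyBounded_isComplete.mpr
      ⟨Metric.totallyBounded_iff.mpr fun ε hε => ?_, Metric.isClosed_closedBall.isComplete⟩
    -- Every point of the ball of radius `R` is within `ε / 2` of the compact ball of radius `R - ε
    -- / 4` (cut off at `0`), so an `ε / 2`-net of the latter is an `ε`-net of the former.
    obtain ⟨t, -, htf, ht⟩ := (show IsCompact (Metric.closedBall x (max (R - ε / 4) 0)) by
      rcases le_or_gt (R - ε / 4) 0 with h | h
      · rw [max_eq_right h]; exact h0
      · rw [max_eq_left h.le]; exact hlt _ (by linarith)).finite_cover_balls (half_pos hε)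
    refine ⟨t, htf, fun y hy => ?_⟩
    rw [Metric.mem_closedBall'] at hy
    obtain ⟨z, hz1, hz2⟩ := hX x y (max (R - ε / 4) 0) (ε / 2) (le_max_right _ _) (half_pos hε) (by
      have := le_max_left (R - ε / 4) 0
      linarith)
    obtain ⟨w, hw, hzw⟩ := mem_iUnion₂.mp (ht (Metric.mem_closedBall'.mpr hz1))
    refine mem_iUnion₂.mpr ⟨w, hw, ?_⟩
    rw [Metric.mem_ball] at hzw ⊢
    have := dist_triangle y z w
    rw [dist_comm y z] at this
    linarith
  -- Local compactness gives a compact neighbourhood of the ball of radius `R`, and the length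
  -- property puts a slightly larger ball inside it.
  obtain ⟨K, hK, hRK⟩ := exists_compact_superset hRS
  obtain ⟨δ, hδ, hδK⟩ := hRS.exists_thickening_subset_open isOpen_interior hRK
  have hmem : R + δ / 2 ∈ S := by
    refine IsCompact.of_isClosed_subset hK Metric.isClosed_closedBall fun y hy => ?_
    rw [Metric.mem_closedBall'] at hy
    obtain ⟨z, hz1, hz2⟩ := hX x y R δ hR0 hδ (by linarith)
    refine interior_subset (hδK (Metric.mem_thickening_iff.mpr
      ⟨z, Metric.mem_closedBall'.mpr hz1, ?_⟩))
    rwa [dist_comm]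
  have := le_csSup hbdd hmem
  linarith

end HopfRinow


/-! ### A mountain pass principle on proper metric spaces. -/

section MountainPass

variable {X : Type*} [MetricSpace X] {f : X → ℝ} {O : X}

/-- If `y` is joined to `O` inside `{f < c}` then `f ≤ b` on the joining path for some `b < c`. -/
lemma exists_lt_joinedIn (hf : Continuous f) {c : ℝ} {y : X} (h : JoinedIn {x | f x < c} O y) :
    ∃ b < c, ∀ b', b < b' → JoinedIn {x | f x < b'} O y := by
  obtain ⟨γ, hγ⟩ := h
  obtain ⟨t, -, ht⟩ := isCompact_univ.exists_isMaxOn univ_nonempty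
    (hf.comp γ.continuous).continuousOn
  exact ⟨f (γ t), hγ t, fun b' hb' => ⟨γ, fun s => (ht (mem_univ s)).trans_lt hb'⟩⟩

lemma mem_cthickening_of_infDist_le {K : Set X} (hK : K.Nonempty) {δ : ℝ} {x : X}
    (h : Metric.infDist x K ≤ δ) : x ∈ Metric.cthickening δ K := by
  rw [Metric.mem_cthickening_iff, ← ENNReal.ofReal_toReal (Metric.infEDist_ne_top hK)]
  exact ENNReal.ofReal_le_ofReal h

/-- A path starting in a set `K` and avoiding the set of points at distance `δ` of `K` stays in
the `δ`-thickening of `K`. -/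
lemma JoinedIn.infDist_lt {K S : Set X} {δ : ℝ} (hδ : 0 < δ) (hO : O ∈ K) {y : X}
    (h : JoinedIn S O y) (hS : ∀ x ∈ S, Metric.infDist x K ≠ δ) : Metric.infDist y K < δ := by
  obtain ⟨γ, hγ⟩ := h
  by_contra! hcon
  have hc : Continuous fun t : unitInterval => Metric.infDist (γ t) K :=
    (Metric.continuous_infDist_pt K).comp γ.continuous
  obtain ⟨t, ht⟩ := mem_range_of_exists_le_of_exists_ge (c := δ) hc
    ⟨0, by simpa [Metric.infDist_zero_of_mem hO] using hδ.le⟩ ⟨1, by simpa using hcon⟩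
  exact hS _ (hγ t) ht

variable [ProperSpace X]

/-- If the points of `{f ≤ c}` near a compact set `K` lie in `K`, then the part of a slightly
larger sublevel set that can be reached from `K` stays near `K`. -/
lemma exists_joinedIn_bounded (hf : Continuous f) {K : Set X} (hK : IsCompact K) (hO : O ∈ K)
    {c : ℝ} (hc : 0 ≤ c) (hK0 : ∀ x ∈ K, 0 ≤ f x)
    (hloc : ∀ x ∈ K, ∀ᶠ y in 𝓝 x, f y ≤ c → y ∈ K) :
    ∃ ε > 0, Bornology.IsBounded {y | JoinedIn {x | f x < c + ε} O y} ∧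
      ∀ y, JoinedIn {x | f x < c + ε} O y → 0 ≤ f y := by
  have hev : ∀ᶠ y in 𝓝ˢ K, f y ≤ c → y ∈ K := eventually_nhdsSet_iff_forall.mpr hloc
  obtain ⟨U, hU, hKU, hUc⟩ := mem_nhdsSet_iff_exists.mp hev
  obtain ⟨δ, hδ, hδU⟩ := hK.exists_cthickening_subset_open hU hKU
  have hne : K.Nonempty := ⟨O, hO⟩
  -- The shell `D` is a compact barrier: `f > c` on it, hence `f ≥ c + ε` for some `ε > 0`, so a
  -- path in `{f < c + ε}` from `O` cannot cross it.
  set D := {x | Metric.infDist x K = δ} with hD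
  have hDsub : D ⊆ Metric.cthickening δ K := fun x hx =>
    mem_cthickening_of_infDist_le hne (le_of_eq hx)
  have hDc : IsCompact D := hK.cthickening.of_isClosed_subset
    (isClosed_eq (Metric.continuous_infDist_pt K) continuous_const) hDsub
  have hDf : ∀ x ∈ D, c < f x := fun x hx => by
    by_contra! h
    have := Metric.infDist_zero_of_mem (hUc (hδU (hDsub hx)) h)
    rw [hD, mem_ofPred_eq, this] at hx
    exact hδ.ne hx
  obtain ⟨ε, hε, hεD⟩ : ∃ ε > 0, ∀ x ∈ D, c + ε ≤ f x := by
    rcases D.eq_empty_or_nonempty with h | h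
    · exact ⟨1, one_pos, by simp [h]⟩
    · obtain ⟨x, hx, hm⟩ := hDc.exists_isMinOn h hf.continuousOn
      exact ⟨f x - c, sub_pos.mpr (hDf x hx), fun y hy => by
        have : f x ≤ f y := hm hy
        linarith⟩
  have hin : ∀ y, JoinedIn {x | f x < c + ε} O y → y ∈ Metric.cthickening δ K := fun y hy =>
    mem_cthickening_of_infDist_le hne (JoinedIn.infDist_lt hδ hO hy fun x hx he =>
      absurd hx (not_lt.mpr (hεD x he))).le
  refine ⟨ε, hε, hK.cthickening.isBounded.subset hin, fun y hy => ?_⟩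
  -- A point near `K` with `f < 0 ≤ c` lies in `K`, where `f` is nonnegative.
  by_contra! h
  exact absurd (hK0 y (hUc (hδU (hin y hy)) (h.le.trans hc))) (not_le.mpr h)

/-- A mountain pass principle: a function on a proper space with a strict local minimum with value
`0` at `O` is nonnegative, if all its almost critical points lie in a bounded set, and if the
sublevel sets are locally either connected or a single point near each point of their boundary. -/
theorem nonneg_of_strictLocalMin [LocallyPathConnectedSpace X] [PathConnectedSpace X]
    (hf : Continuous f) (hfO : f O = 0) (hmin : ∀ᶠ y in 𝓝 O, f y ≤ 0 → y = O)
    (hjoin : ∀ q, ∃ W ∈ 𝓝 q, ∀ y ∈ W, ∀ z ∈ W, f y < f q → f z < f q →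
      JoinedIn {x | f x < f q} y z)
    (hclos : ∀ q, ∀ᶠ y in 𝓝 q, f y ≤ f q → y ≠ q → y ∈ closure {x | f x < f q})
    {s₀ : ℝ} (hslope : ∀ q, (∀ᶠ y in 𝓝 q, f q - 1 / 2 * dist q y ≤ f y) → dist O q ≤ s₀)
    (p : X) : 0 ≤ f p := by
  set V : ℝ → Set X := fun c => {y | JoinedIn {x | f x < c} O y} with hV
  have hopen : ∀ c, IsOpen {x | f x < c} := fun c => isOpen_lt hf continuous_const
  have hVopen : ∀ c, IsOpen (V c) := fun c => (hopen c).pathComponentIn O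
  have hVlt : ∀ c, ∀ y ∈ V c, f y < c := fun c y hy => hy.target_mem
  -- The good levels: the component of `{f < c}` containing `O` is bounded and `f` is nonnegative on
  -- it. The goal is that every positive level is good.
  set G := {c | 0 < c ∧ Bornology.IsBounded (V c) ∧ ∀ y ∈ V c, 0 ≤ f y} with hG
  have hmono : ∀ {c c'}, c' ≤ c → V c' ⊆ V c := fun h y hy =>
    hy.mono fun x hx => lt_of_lt_of_le hx h
  have hOV : ∀ c, 0 < c → O ∈ V c := fun c hc => JoinedIn.refl (by simpa [hfO] using hc)
  -- relative closedness
  have hrel : ∀ c, ∀ q ∈ closure (V c), f q < c → q ∈ V c := fun c q hq hqc => by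
    have h1 : pathComponentIn {x | f x < c} q ∈ 𝓝 q :=
      ((hopen c).pathComponentIn q).mem_nhds (mem_pathComponentIn_self hqc)
    obtain ⟨z, hz1, hz2⟩ := mem_closure_iff_nhds.mp hq _ h1
    exact hz2.trans (JoinedIn.symm hz1)
  -- Ekeland-type argument: the minimizer `y` of `f + ½ d(x, ·)` over the closure of `V c` is almost
  -- critical, hence within `s₀` of `O`. Since `f y ≥ 0` and `f x < c`, also `d(x, y) ≤ 2c`. The
  -- bound depends on `c` only, so it survives passage to the supremum.
  have hbound : ∀ c ∈ G, V c ⊆ Metric.closedBall O (s₀ + 2 * c) := fun c hc x hx => by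
    have hcomp : IsCompact (closure (V c)) :=
      Metric.isCompact_of_isClosed_isBounded isClosed_closure hc.2.1.closure
    obtain ⟨y, hy, hm⟩ := hcomp.exists_isMinOn ⟨x, subset_closure hx⟩
      (f := fun z => f z + 1 / 2 * dist x z)
      (hf.add (continuous_const.mul (continuous_const.dist continuous_id))).continuousOn
    have hyx : f y + 1 / 2 * dist x y ≤ f x := by
      have : f y + 1 / 2 * dist x y ≤ f x + 1 / 2 * dist x x := hm (subset_closure hx)
      simpa using this
    have hxc := hVlt c x hx
    have hd := dist_nonneg (x := x) (y := y)
    -- `f y ≤ f x < c` excludes the boundary, so `y` minimizes over a full neighbourhood.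
    have hyV : y ∈ V c := hrel c y hy (by linarith)
    have h1 := hslope y (by
      filter_upwards [(hVopen c).mem_nhds hyV] with z hz
      have h2 : f y + 1 / 2 * dist x y ≤ f z + 1 / 2 * dist x z := hm (subset_closure hz)
      have := dist_triangle x y z
      linarith)
    have h2 := hc.2.2 y hyV
    have h3 := dist_triangle O y x
    rw [dist_comm y x] at h3
    rw [Metric.mem_closedBall']
    linarith
  have hG0 : ∃ c, c ∈ G := by
    obtain ⟨ε, hε, h1, h2⟩ := exists_joinedIn_bounded hf (isCompact_singleton (x := O)) rfl le_rfl
      (by simp [hfO]) (by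
        intro x hx
        rw [mem_singleton_iff.mp hx]
        exact hmin)
    rw [zero_add] at h1 h2
    exact ⟨ε, hε, h1, h2⟩
  have hGdown : ∀ c ∈ G, ∀ c', 0 < c' → c' ≤ c → c' ∈ G := fun c hc c' h0 h =>
    ⟨h0, hc.2.1.subset (hmono h), fun y hy => hc.2.2 y (hmono h hy)⟩
  have hall : ∀ c, 0 < c → c ∈ G := by
    by_contra! hcon
    obtain ⟨a, ha, haG⟩ := hcon
    have hbdd : BddAbove G := ⟨a, fun c hc => by
      by_contra! h
      exact haG (hGdown c hc a ha h.le)⟩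
    set c := sSup G with hc
    have hc0 : 0 < c := by
      obtain ⟨b, hb⟩ := hG0
      exact hb.1.trans_le (le_csSup hbdd hb)
    -- A path in `{f < c}` is compact, so it already lies in a lower sublevel set: the supremum
    -- component is the union of the good ones.
    have hexh : ∀ y ∈ V c, ∃ b ∈ G, y ∈ V b := fun y hy => by
      obtain ⟨b, hb, h⟩ := exists_lt_joinedIn hf hy
      obtain ⟨b', hb', hbb'⟩ := exists_lt_of_lt_csSup hG0 hb
      exact ⟨b', hb', h b' hbb'⟩
    have hbd : V c ⊆ Metric.closedBall O (s₀ + 2 * c) := fun y hy => by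
      obtain ⟨b, hb, hyb⟩ := hexh y hy
      exact Metric.closedBall_subset_closedBall (by linarith [le_csSup hbdd hb]) (hbound b hb hyb)
    have hpos : ∀ y ∈ closure (V c), 0 ≤ f y :=
      closure_minimal (fun y hy => by
        obtain ⟨b, hb, hyb⟩ := hexh y hy
        exact hb.2.2 y hyb) (isClosed_le continuous_const hf)
    have hle : ∀ y ∈ closure (V c), f y ≤ c :=
      closure_minimal (fun y hy => (hVlt c y hy).le) (isClosed_le hf continuous_const)
    -- The closure of `V c` is isolated within `{f ≤ c}`. Near a boundary point `q`, any two points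
    -- of `{f < c}` can be joined in that set, and one of them lies in `V c`; points of `{f ≤ c}`
    -- other than `q` are limits of such points. So a level above the supremum is good, a
    -- contradiction.
    obtain ⟨ε, hε, h1, h2⟩ := exists_joinedIn_bounded hf (K := closure (V c)) (O := O) (c := c)
      (Metric.isCompact_of_isClosed_isBounded isClosed_closure
        (Metric.isBounded_closedBall.subset hbd).closure)
      (subset_closure (hOV c hc0)) hc0.le hpos fun q hq => by
        rcases (hle q hq).lt_or_eq with h | h
        · filter_upwards [(hVopen c).mem_nhds (hrel c q hq h)] with y hy _ using subset_closure hy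
        · obtain ⟨W, hW, hWj⟩ := hjoin q
          obtain ⟨z, hzW, hzV⟩ := mem_closure_iff_nhds.mp hq W hW
          have hzc := hVlt c z hzV
          rw [h] at hWj
          filter_upwards [hclos q, eventually_mem_nhds_iff.mpr hW] with y hy hyW hyc
          rw [h] at hy
          by_cases hyq : y = q
          · rwa [hyq]
          refine mem_closure_iff_nhds.mpr fun T hT => ?_
          obtain ⟨w, ⟨hwT, hwW⟩, hwc⟩ :=
            mem_closure_iff_nhds.mp (hy hyc hyq) _ (inter_mem hT hyW)
          exact ⟨w, hwT, hzV.trans (hWj z hzW w hwW hzc hwc)⟩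
    have := le_csSup hbdd (show c + ε ∈ G from ⟨by linarith, h1, h2⟩)
    linarith
  -- Any path from `O` to `p` lies below a sufficiently high level, and that level is good.
  obtain ⟨γ⟩ := PathConnectedSpace.joined O p
  obtain ⟨t, -, ht⟩ := isCompact_univ.exists_isMaxOn univ_nonempty
    (hf.comp γ.continuous).continuousOn
  have h0 : 0 ≤ f (γ t) := by
    have : f (γ 0) ≤ f (γ t) := ht (mem_univ 0)
    simpa [hfO] using this
  refine (hall (f (γ t) + 1) (by linarith)).2.2 p ⟨γ, fun s => ?_⟩
  have : f (γ s) ≤ f (γ t) := ht (mem_univ s)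
  exact lt_of_le_of_lt this (lt_add_one _)

end MountainPass


/-! ### Sublevel sets near nondegenerate minima and near regular points. -/

section Local

variable {E : Type*} [NormedAddCommGroup E] [NormedSpace ℝ E] {F : E → ℝ} {x : E}

lemma hasDerivAt_comp_line {y w : E} {t : ℝ} (h : DifferentiableAt ℝ F (y + t • w)) :
    HasDerivAt (fun t : ℝ => F (y + t • w)) (fderiv ℝ F (y + t • w) w) t := by
  have h1 : HasDerivAt (fun t : ℝ => y + t • w) w t := by
    simpa using ((hasDerivAt_id t).smul_const w).const_add y
  exact h.hasFDerivAt.comp_hasDerivAt t h1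

/-- A nondegenerate critical point with positive definite second derivative is a strict local
minimum. -/
lemma eventually_eq_of_le_of_fderiv_fderiv_pos [FiniteDimensional ℝ E]
    (hF : ContDiffAt ℝ 2 F x) (h1 : fderiv ℝ F x = 0)
    (h2 : ∀ v ≠ 0, 0 < fderiv ℝ (fderiv ℝ F) x v v) : ∀ᶠ y in 𝓝 x, F y ≤ F x → y = x := by
  -- Compactness of the unit sphere makes the positive second derivative coercive; the sphere is
  -- empty only when the space is trivial.
  obtain ⟨a, ha, hav⟩ : ∃ a > 0, ∀ v, a * ‖v‖ ^ 2 ≤ fderiv ℝ (fderiv ℝ F) x v v := by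
    rcases (Metric.sphere (0 : E) 1).eq_empty_or_nonempty with h | h
    · refine ⟨1, one_pos, fun v => ?_⟩
      have hv : v = 0 := by
        by_contra hv
        have : ‖v‖⁻¹ • v ∈ Metric.sphere (0 : E) 1 := by
          simp [norm_smul, norm_ne_zero_iff.mpr hv]
        rw [h] at this
        exact this
      simp [hv]
    · have hc : Continuous fun v => fderiv ℝ (fderiv ℝ F) x v v :=
        (fderiv ℝ (fderiv ℝ F) x).continuous.clm_apply continuous_id
      obtain ⟨w, hw, hm⟩ := (isCompact_sphere (0 : E) 1).exists_isMinOn h hc.continuousOn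
      have hw0 : w ≠ 0 := by
        rintro rfl
        simp at hw
      refine ⟨_, h2 w hw0, fun v => ?_⟩
      rcases eq_or_ne v 0 with rfl | hv
      · simp
      have hv' := norm_ne_zero_iff.mpr hv
      have h3 : fderiv ℝ (fderiv ℝ F) x w w
          ≤ fderiv ℝ (fderiv ℝ F) x (‖v‖⁻¹ • v) (‖v‖⁻¹ • v) :=
        hm (show ‖v‖⁻¹ • v ∈ Metric.sphere (0 : E) 1 by simp [norm_smul, hv'])
      simp only [map_smul, smul_apply, smul_eq_mul] at h3
      have h4 := mul_le_mul_of_nonneg_right h3 (sq_nonneg ‖v‖)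
      refine h4.trans_eq ?_
      field_simp
  have hd : DifferentiableAt ℝ (fderiv ℝ F) x :=
    (hF.fderiv_right (m := 1) (by norm_num)).differentiableAt one_ne_zero
  -- Linearizing `DF` with error at most `(a / 2) ‖y - x‖` keeps the radial derivative positive, so
  -- `F` increases strictly along segments leaving `x`.
  have hpos : ∀ᶠ y in 𝓝 x, y ≠ x → 0 < fderiv ℝ F y (y - x) := by
    have h3 := hd.hasFDerivAt.isLittleO.def (half_pos ha)
    filter_upwards [h3] with y hy hne
    rw [h1, sub_zero] at hy
    have h4 := (fderiv ℝ F y - fderiv ℝ (fderiv ℝ F) x (y - x)).le_opNorm (y - x)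
    rw [sub_apply, Real.norm_eq_abs] at h4
    have h5 := (abs_le.mp h4).1
    have h6 := hav (y - x)
    have h7 : 0 < ‖y - x‖ := norm_pos_iff.mpr (sub_ne_zero.mpr hne)
    have h8 := mul_le_mul_of_nonneg_right hy h7.le
    nlinarith [mul_pos ha (mul_pos h7 h7)]
  have hdiff : ∀ᶠ y in 𝓝 x, DifferentiableAt ℝ F y :=
    (hF.eventually (by simp)).mono fun y hy => hy.differentiableAt (by simp)
  obtain ⟨r, hr, hrs⟩ := Metric.eventually_nhds_iff_ball.mp (hpos.and hdiff)
  filter_upwards [Metric.ball_mem_nhds x hr] with y hy hle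
  by_contra hne
  have hin : ∀ t ∈ Icc (0 : ℝ) 1, x + t • (y - x) ∈ Metric.ball x r := fun t ht => by
    rw [Metric.mem_ball, dist_eq_norm] at hy ⊢
    rw [add_sub_cancel_left, norm_smul, Real.norm_eq_abs, abs_of_nonneg ht.1]
    exact (mul_le_of_le_one_left (norm_nonneg _) ht.2).trans_lt hy
  have hmono : StrictMonoOn (fun t : ℝ => F (x + t • (y - x))) (Icc 0 1) := by
    refine strictMonoOn_of_deriv_pos (convex_Icc 0 1) (fun t ht =>
      (hasDerivAt_comp_line (hrs _ (hin t ht)).2).continuousAt.continuousWithinAt) fun t ht => ?_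
    rw [interior_Icc] at ht
    have h3 := hrs _ (hin t (Ioo_subset_Icc_self ht))
    rw [(hasDerivAt_comp_line h3.2).deriv]
    have h4 := h3.1 (by simpa using ⟨ht.1.ne', sub_ne_zero.mpr hne⟩)
    rw [add_sub_cancel_left, map_smul, smul_eq_mul] at h4
    exact pos_of_mul_pos_right h4 ht.1.le
  have := hmono (left_mem_Icc.mpr zero_le_one) (right_mem_Icc.mpr zero_le_one) zero_lt_one
  simp only [zero_smul, add_zero, one_smul, add_sub_cancel] at this
  exact absurd hle (not_le.mpr this)

/-- Near a regular point the sublevel set is connected, and the level set lies in its closure. -/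
lemma exists_joinedIn_of_fderiv_ne_zero (hF : ContDiffAt ℝ 1 F x) (h : fderiv ℝ F x ≠ 0) {U : Set E}
    (hU : U ∈ 𝓝 x) : ∃ W ∈ 𝓝 x, W ⊆ U ∧
      (∀ y ∈ W, F y ≤ F x → y ∈ closure (U ∩ {z | F z < F x})) ∧
      ∀ y ∈ W, ∀ z ∈ W, F y < F x → F z < F x → JoinedIn (U ∩ {z | F z < F x}) y z := by
  obtain ⟨e, he⟩ : ∃ e, fderiv ℝ F x e < 0 := by
    obtain ⟨v, hv⟩ : ∃ v, fderiv ℝ F x v ≠ 0 := by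
      by_contra! h0
      exact h (ContinuousLinearMap.ext h0)
    rcases hv.lt_or_gt with hv | hv
    · exact ⟨v, hv⟩
    · exact ⟨-v, by rw [map_neg]; exact neg_neg_of_pos hv⟩
  have hc : ContinuousAt (fun y => fderiv ℝ F y e) x :=
    (hF.fderiv_right (m := 0) (by simp)).continuousAt.clm_apply continuousAt_const
  have hdiff : ∀ᶠ y in 𝓝 x, DifferentiableAt ℝ F y :=
    (hF.eventually (by simp)).mono fun y hy => hy.differentiableAt (by simp)
  obtain ⟨r, hr, hrs⟩ := Metric.eventually_nhds_iff_ball.mp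
    ((hc.eventually_lt continuousAt_const he).and (hdiff.and hU))
  -- A short vector `w` along which `F` decreases throughout the ball; its length keeps translates
  -- of the half ball inside the ball.
  obtain ⟨w, hwr, hw⟩ : ∃ w : E, ‖w‖ < r / 2 ∧ ∀ y ∈ Metric.ball x r, fderiv ℝ F y w < 0 := by
    refine ⟨(r / 4 / (‖e‖ + 1)) • e, ?_, fun y hy => ?_⟩
    · have he0 : 0 < ‖e‖ + 1 := by positivity
      rw [norm_smul, Real.norm_eq_abs, abs_of_pos (by positivity), div_mul_eq_mul_div,
        div_lt_iff₀ he0]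
      nlinarith [norm_nonneg e]
    · rw [map_smul, smul_eq_mul]
      exact mul_neg_of_pos_of_neg (by positivity) (hrs y hy).1
  have hin : ∀ y ∈ Metric.ball x (r / 2), ∀ t ∈ Icc (0 : ℝ) 1, y + t • w ∈ Metric.ball x r :=
    fun y hy t ht => by
      rw [Metric.mem_ball, dist_eq_norm] at hy ⊢
      have h1 : ‖t • w‖ ≤ ‖w‖ := by
        rw [norm_smul, Real.norm_eq_abs, abs_of_nonneg ht.1]
        exact mul_le_of_le_one_left (norm_nonneg _) ht.2
      have h2 := norm_add_le (y - x) (t • w)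
      rw [show y + t • w - x = y - x + t • w by abel]
      linarith
  have hanti : ∀ y ∈ Metric.ball x (r / 2),
      StrictAntiOn (fun t : ℝ => F (y + t • w)) (Icc 0 1) := fun y hy => by
    refine strictAntiOn_of_deriv_neg (convex_Icc 0 1) (fun t ht => (hasDerivAt_comp_line
      (hrs _ (hin y hy t ht)).2.1).continuousAt.continuousWithinAt) fun t ht => ?_
    rw [interior_Icc] at ht
    have h3 := hin y hy t (Ioo_subset_Icc_self ht)
    rw [(hasDerivAt_comp_line (hrs _ h3).2.1).deriv]
    exact hw _ h3
  have hlt : ∀ y ∈ Metric.ball x (r / 2), ∀ t ∈ Ioc (0 : ℝ) 1, F (y + t • w) < F y :=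
    fun y hy t ht => by
      simpa using hanti y hy (left_mem_Icc.mpr zero_le_one) (Ioc_subset_Icc_self ht) ht.1
  have hxw := hin x (Metric.mem_ball_self (by positivity)) 1 (right_mem_Icc.mpr zero_le_one)
  have hxlt := hlt x (Metric.mem_ball_self (by positivity)) 1 (right_mem_Ioc.mpr zero_lt_one)
  rw [one_smul] at hxw hxlt
  -- Two points below the level `F x` are joined by sliding both along `w` into a ball around `x +
  -- w`, which is convex and lies entirely below that level.
  obtain ⟨ρ, hρ, hρs⟩ := Metric.eventually_nhds_iff_ball.mp
    (((hrs _ hxw).2.1.continuousAt.eventually_lt continuousAt_const hxlt).and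
      (Metric.isOpen_ball.mem_nhds hxw))
  have hsub : Metric.ball x (min ρ (r / 2)) ⊆ Metric.ball x (r / 2) :=
    Metric.ball_subset_ball (min_le_right _ _)
  have hjoin : ∀ y ∈ Metric.ball x (min ρ (r / 2)), F y < F x →
      JoinedIn (U ∩ {z | F z < F x}) y (y + w) := fun y hy hyx => by
    have h1 : IsPathConnected ((fun t : ℝ => y + t • w) '' Icc 0 1) :=
      ((convex_Icc (0 : ℝ) 1).isPathConnected (nonempty_Icc.mpr zero_le_one)).image
        (by fun_prop)
    have h2 := h1.joinedIn y ⟨0, left_mem_Icc.mpr zero_le_one, by simp⟩ (y + w)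
      ⟨1, right_mem_Icc.mpr zero_le_one, by simp⟩
    refine h2.mono ?_
    rintro _ ⟨t, ht, rfl⟩
    refine ⟨(hrs _ (hin y (hsub hy) t ht)).2.2, ?_⟩
    rcases ht.1.eq_or_lt with rfl | h0
    · simpa using hyx
    · exact (hlt y (hsub hy) t ⟨h0, ht.2⟩).trans hyx
  have hshift : ∀ y ∈ Metric.ball x (min ρ (r / 2)), y + w ∈ Metric.ball (x + w) ρ :=
    fun y hy => by
      rw [Metric.mem_ball, dist_add_right]
      exact lt_of_lt_of_le hy (min_le_left _ _)
  refine ⟨Metric.ball x (min ρ (r / 2)), Metric.ball_mem_nhds x (by positivity),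
    fun y hy => ?_, fun y hy hyx => ?_, fun y hy z hz hyx hzx => ?_⟩
  · exact (hrs y (Metric.ball_subset_ball (by linarith) (hsub hy))).2.2
  · have h1 : Tendsto (fun t : ℝ => y + t • w) (𝓝[>] 0) (𝓝 y) := by
      have : Continuous fun t : ℝ => y + t • w := by fun_prop
      have h2 := this.tendsto 0
      rw [zero_smul, add_zero] at h2
      exact h2.mono_left nhdsWithin_le_nhds
    refine mem_closure_of_tendsto h1 ?_
    filter_upwards [Ioc_mem_nhdsGT (zero_lt_one (α := ℝ))] with t ht
    exact ⟨(hrs _ (hin y (hsub hy) t (Ioc_subset_Icc_self ht))).2.2,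
      (hlt y (hsub hy) t ht).trans_le hyx⟩
  · have h1 : JoinedIn (U ∩ {z | F z < F x}) (y + w) (z + w) :=
      (((convex_ball (x + w) ρ).isPathConnected ⟨y + w, hshift y hy⟩).joinedIn _ (hshift y hy) _
        (hshift z hz)).mono fun u hu => ⟨(hrs u (hρs u hu).2).2.2, (hρs u hu).1⟩
    exact ((hjoin y hy hyx).trans h1).trans (hjoin z hz hzx).symm

lemma nonneg_of_hasDerivAt_of_eventually_le {h : ℝ → ℝ} {h' a : ℝ} (hd : HasDerivAt h h' a)
    (hle : ∀ᶠ t in 𝓝[>] a, h a ≤ h t) : 0 ≤ h' := by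
  have h1 : Tendsto (slope h a) (𝓝[>] a) (𝓝 h') := (hasDerivAt_iff_tendsto_slope.mp hd).mono_left
    (nhdsWithin_mono a (fun t (ht : a < t) => ht.ne'))
  refine ge_of_tendsto h1 ?_
  filter_upwards [hle, self_mem_nhdsWithin] with t ht hat
  rw [slope_def_field]
  exact div_nonneg (sub_nonneg.mpr ht) (sub_nonneg.mpr (le_of_lt hat))

end Local


/-! ### Slopes, critical points and sublevel sets on the manifold. -/

section Riemannian

variable {n : ℕ} {M : Type*} [MetricSpace M]
  [ChartedSpace (EuclideanSpace ℝ (Fin n)) M] [IsManifold (𝓡 n) ∞ M]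
  [RiemannianBundle (fun x : M => TangentSpace (𝓡 n) x)]
  [IsContMDiffRiemannianBundle (𝓡 n) ∞ (EuclideanSpace ℝ (Fin n))
    (fun x : M => TangentSpace (𝓡 n) x)]

variable {f : M → ℝ}

lemma IsParamOn.fderiv_comp_eq_inner {σ : EuclideanSpace ℝ (Fin n) → M}
    {U : Set (EuclideanSpace ℝ (Fin n))} (hσ : IsParamOn σ U)
    (hf : MDifferentiable (𝓡 n) 𝓘(ℝ, ℝ) f) {x : EuclideanSpace ℝ (Fin n)} (hx : x ∈ U)
    (u : EuclideanSpace ℝ (Fin n)) :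
    fderiv ℝ (f ∘ σ) x u = inner ℝ (grad n f (σ x)) (IsParamOn.diff σ x u) := by
  rw [hσ.fderiv_comp_eq hf hx, IsParamOn.inner_grad]

lemma IsParamOn.fderiv_comp_eq_zero_iff {σ : EuclideanSpace ℝ (Fin n) → M}
    {U : Set (EuclideanSpace ℝ (Fin n))} (hσ : IsParamOn σ U)
    (hf : MDifferentiable (𝓡 n) 𝓘(ℝ, ℝ) f) {x : EuclideanSpace ℝ (Fin n)} (hx : x ∈ U) :
    fderiv ℝ (f ∘ σ) x = 0 ↔ grad n f (σ x) = 0 := by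
  refine ⟨fun h => ?_, fun h => ?_⟩
  · obtain ⟨u, hu⟩ : ∃ u, IsParamOn.diff σ x u = grad n f (σ x) := hσ.surjective hx _
    have h1 := hσ.fderiv_comp_eq_inner hf hx u
    rw [h, hu, real_inner_self_eq_norm_sq, zero_apply] at h1
    exact norm_eq_zero.mp (pow_eq_zero_iff two_ne_zero |>.mp h1.symm)
  · ext u
    rw [hσ.fderiv_comp_eq_inner hf hx, h, inner_zero_left, zero_apply]

/-- If `f` decreases with slope at most `κ` around `q` then the gradient of `f` at `q` has norm at
most `κ`. -/
lemma norm_grad_le_of_eventually_le [IsRiemannianManifold (𝓡 n) M]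
    (hf : MDifferentiable (𝓡 n) 𝓘(ℝ, ℝ) f) {q : M} {κ : ℝ}
    (hκ : 0 ≤ κ) (h : ∀ᶠ y in 𝓝 q, f q - κ * dist q y ≤ f y) : ‖grad n f q‖ ≤ κ := by
  obtain ⟨σ, U, hσ, hx, rfl, -⟩ := exists_isNormalAt (n := n) q
  obtain ⟨v, hv⟩ : ∃ v, IsParamOn.diff σ 0 v = grad n f (σ 0) := hσ.surjective hx _
  set G := ‖grad n f (σ 0)‖ with hG
  -- Follow a coordinate line `γ` with initial velocity `-∇f`. For short times its speed is below
  -- `C`, so `dist q (γ t) ≤ C t`, while `f` initially decreases at rate `G²`. Letting `C` tend to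
  -- `G` gives `G² ≤ κ G`.
  have key : ∀ C, G < C → G ^ 2 ≤ κ * C := fun C hC => by
    have hG0 : 0 ≤ G := norm_nonneg _
    have hline : Continuous fun t : ℝ => (0 : EuclideanSpace ℝ (Fin n)) - t • v := by fun_prop
    have hline0 : (0 : EuclideanSpace ℝ (Fin n)) - (0 : ℝ) • v = 0 := by simp
    have hmet : ContinuousAt (fun t : ℝ => pullMetric σ (0 - t • v) v v) 0 := by
      have h1 : ContinuousAt (pullMetric σ) ((0 : EuclideanSpace ℝ (Fin n)) - (0 : ℝ) • v) := by
        rw [hline0]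
        exact (hσ.isMetricOn.contDiffAt hx).continuousAt
      exact ((h1.comp (f := fun t : ℝ => (0 : EuclideanSpace ℝ (Fin n)) - t • v)
        hline.continuousAt).clm_apply continuousAt_const).clm_apply continuousAt_const
    have hmet0 : pullMetric σ (0 - (0 : ℝ) • v) v v < C ^ 2 := by
      rw [hline0, IsParamOn.pullMetric_apply, hv, real_inner_self_eq_norm_sq]
      exact pow_lt_pow_left₀ hC hG0 two_ne_zero
    have hUev : ∀ᶠ t : ℝ in 𝓝 0, (0 : EuclideanSpace ℝ (Fin n)) - t • v ∈ U :=
      hline.continuousAt.eventually (by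
        simp only [hline0]
        exact hσ.isOpen.mem_nhds hx)
    obtain ⟨τ, hτ, hτs⟩ := Metric.eventually_nhds_iff_ball.mp
      ((hmet.eventually_lt continuousAt_const hmet0).and hUev)
    set γ : ℝ → M := fun t => σ (0 - t • v) with hγ
    have hball : ∀ t ∈ Ico 0 τ, t ∈ Metric.ball (0 : ℝ) τ := fun t ht => by
      rw [Metric.mem_ball, Real.dist_eq, sub_zero, abs_of_nonneg ht.1]
      exact ht.2
    have hγs : ∀ t ∈ Ico 0 τ, ContMDiffAt 𝓘(ℝ, ℝ) (𝓡 n) 1 γ t := fun t ht => by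
      have h1 := (hσ.contMDiffAt (hτs t (hball t ht)).2).of_le (show (1 : ℕ∞ω) ≤ ∞ by decide)
      have h2 : ContMDiffAt 𝓘(ℝ, ℝ) 𝓘(ℝ, EuclideanSpace ℝ (Fin n)) 1
          (fun t : ℝ => (0 : EuclideanSpace ℝ (Fin n)) - t • v) t :=
        ContDiffAt.contMDiffAt (by fun_prop)
      exact h1.comp t h2
    have hvel : ∀ t ∈ Ico 0 τ, velocity n γ t = IsParamOn.diff σ (0 - t • v) (-v) := fun t ht => by
      have h2 : HasDerivAt (fun t : ℝ => (0 : EuclideanSpace ℝ (Fin n)) - t • v) (-v) t := by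
        simpa using ((hasDerivAt_id t).smul_const v).const_sub 0
      have h3 := mfderiv_comp (I'' := 𝓡 n) t (hσ.mdifferentiableAt (hτs t (hball t ht)).2)
        h2.differentiableAt.mdifferentiableAt
      have h4 : mfderiv 𝓘(ℝ, ℝ) 𝓘(ℝ, EuclideanSpace ℝ (Fin n))
          (fun t : ℝ => (0 : EuclideanSpace ℝ (Fin n)) - t • v) t 1 = -v := by
        rw [mfderiv_eq_fderiv]
        exact (fderiv_apply_one_eq_deriv).trans h2.deriv
      exact (congrArg (fun L => L 1) h3).trans (congrArg (IsParamOn.diff σ (0 - t • v)) h4)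
    have hnorm : ∀ t ∈ Ico 0 τ, ‖velocity n γ t‖ ≤ C := fun t ht => by
      have h1 := (hτs t (hball t ht)).1
      refine le_of_lt (lt_of_pow_lt_pow_left₀ 2 (hG0.trans hC.le) ?_)
      refine lt_of_eq_of_lt ?_ h1
      rw [hvel t ht, ← real_inner_self_eq_norm_sq, ← IsParamOn.pullMetric_apply]
      simp
    have hdist : ∀ t ∈ Ico 0 τ, dist (σ 0) (γ t) ≤ C * t := fun t ht => by
      have h1 := dist_le_of_norm_velocity_le (n := n) (γ := γ) (a := 0) (b := t) (C := C) ht.1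
        (fun s hs => (hγs s ⟨hs.1, hs.2.trans_lt ht.2⟩).contMDiffWithinAt) (hG0.trans hC.le)
        fun s hs => hnorm s ⟨hs.1.le, hs.2.trans ht.2⟩
      have h2 : γ 0 = σ 0 := by simp [hγ]
      rwa [h2, sub_zero] at h1
    have hγ0 : γ 0 = σ 0 := by simp [hγ]
    have h0τ : (0 : ℝ) ∈ Ico 0 τ := ⟨le_rfl, hτ⟩
    have hder : HasDerivAt (fun t => f (γ t) + κ * C * t) (-G ^ 2 + κ * C) 0 := by
      have h1 : HasDerivAt (fun t : ℝ => (f ∘ σ) (0 - t • v)) (-G ^ 2) 0 := by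
        have h2 : HasDerivAt (fun t : ℝ => (0 : EuclideanSpace ℝ (Fin n)) - t • v) (-v) 0 := by
          simpa using ((hasDerivAt_id (0 : ℝ)).smul_const v).const_sub 0
        have h3 : DifferentiableAt ℝ (f ∘ σ) (0 - (0 : ℝ) • v) := by
          rw [hline0]
          exact ((hf (σ 0)).comp 0 (hσ.mdifferentiableAt hx)).differentiableAt
        have h4 := h3.hasFDerivAt.comp_hasDerivAt 0 h2
        rw [hline0, map_neg, hσ.fderiv_comp_eq_inner hf hx, hv, real_inner_self_eq_norm_sq] at h4
        exact h4
      have h5 := h1.fun_add ((hasDerivAt_id (0 : ℝ)).const_mul (κ * C))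
      rw [mul_one] at h5
      exact h5
    have hcγ : ContinuousAt γ 0 := (hγs 0 h0τ).continuousAt
    have hev : ∀ᶠ t in 𝓝[>] (0 : ℝ), f (γ 0) + κ * C * 0 ≤ f (γ t) + κ * C * t := by
      have h1 := hcγ.eventually (by rw [hγ0]; exact h)
      filter_upwards [nhdsWithin_le_nhds h1, Ico_mem_nhdsGT hτ] with t ht htτ
      have h2 := mul_le_mul_of_nonneg_left (hdist t htτ) hκ
      rw [hγ0]
      linarith
    have := nonneg_of_hasDerivAt_of_eventually_le hder hev
    linarith
  have hle : G ^ 2 ≤ κ * G := by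
    refine ge_of_tendsto (f := fun C => κ * C) (x := 𝓝[>] G)
      (((continuous_const.mul continuous_id).tendsto _).mono_left nhdsWithin_le_nhds) ?_
    filter_upwards [self_mem_nhdsWithin] with C hC using key C hC
  rcases (norm_nonneg (grad n f (σ 0))).eq_or_lt with h0 | h0
  · rw [hG, ← h0]; exact hκ
  · rw [← hG] at h0
    nlinarith

lemma continuous_norm_grad_sq (hf : ContMDiff (𝓡 n) 𝓘(ℝ, ℝ) ∞ f) :
    Continuous fun q => ‖grad n f q‖ ^ 2 := by
  have := isManifold_one (n := n) (M := M)
  rw [continuous_iff_continuousAt]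
  intro p
  have hσ := isParamOn_extChartAt_symm (n := n) p
  have hy := mem_extChartAt_target (I := 𝓡 n) p
  have hmd : MDifferentiable (𝓡 n) 𝓘(ℝ, ℝ) f := hf.mdifferentiable (by simp)
  have hF : ContDiffAt ℝ ∞ (f ∘ (extChartAt (𝓡 n) p).symm) (extChartAt (𝓡 n) p p) := by
    rw [← contMDiffAt_iff_contDiffAt]
    exact (hf _).comp _ (hσ.contMDiffAt hy)
  have h1 := (hσ.isMetricOn.contDiffAt_laplacianOf_add_gradSqOf
    (EuclideanSpace.basisFun (Fin n) ℝ) hy hF).2.continuousAt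
  have h2 := h1.comp (continuousAt_extChartAt (I := 𝓡 n) p)
  refine h2.congr ?_
  filter_upwards [extChartAt_source_mem_nhds (I := 𝓡 n) p] with q hq
  rw [Function.comp_apply, ← hσ.norm_grad_sq hmd ((extChartAt (𝓡 n) p).map_source hq),
    (extChartAt (𝓡 n) p).left_inv hq]

/-- On a steady soliton, `R + |∇f|²` is constant. -/
lemma hamiltonQuantity_eq [IsRiemannianManifold (𝓡 n) M] (hf : IsGradientRicciSoliton n f)
    (p q : M) : hamiltonQuantity n f p = hamiltonQuantity n f q := by
  obtain ⟨γ, rfl, rfl, hs, -⟩ := exists_curve (n := n) (lt_add_one (dist p q))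
  have h : ∀ t, HasDerivAt (hamiltonQuantity n f ∘ γ) 0 t := fun t => by
    have h1 := hasDerivAt_comp_curve (n := n) (mdifferentiable_hamiltonQuantity hf (γ t))
      (hs.mdifferentiable (by simp) t)
    rw [IsParamOn.inner_grad, mfderiv_hamiltonQuantity hf] at h1
    exact h1
  exact is_const_of_deriv_eq_zero (fun t => (h t).differentiableAt) (fun t => (h t).deriv) 0 1

/-- Near a critical point of the potential of a soliton with positive Ricci curvature, the
potential has a strict local minimum. -/
lemma IsGradientRicciSoliton.eventually_eq_of_le (hf : IsGradientRicciSoliton n f)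
    (hsec : HasPositiveSectionalCurvature n M) (hn : 2 ≤ n) {q : M} (hq : grad n f q = 0) :
    ∀ᶠ y in 𝓝 q, f y ≤ f q → y = q := by
  have hσ := isParamOn_extChartAt_symm (n := n) q
  have hy := mem_extChartAt_target (I := 𝓡 n) q
  have hinv := extChartAt_to_inv (I := 𝓡 n) q
  have hF := hf.contDiffAt_comp hσ hy
  have h1 : fderiv ℝ (f ∘ (extChartAt (𝓡 n) q).symm) (extChartAt (𝓡 n) q q) = 0 := by
    rw [hσ.fderiv_comp_eq_zero_iff hf.mdifferentiable hy, hinv]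
    exact hq
  have e := EuclideanSpace.basisFun (Fin n) ℝ
  -- At a critical point the Christoffel correction vanishes, so the second derivative in the chart
  -- is the Ricci tensor, which is positive definite.
  have h2 := eventually_eq_of_le_of_fderiv_fderiv_pos (hF.of_le (by decide)) h1 fun v hv => by
    have h3 := hf.ricciOf_eq hσ e hy v v
    rw [← hσ.ricci_eq hy, hessianOf, h1, zero_apply, sub_zero] at h3
    rw [← h3]
    refine ricci_pos hsec hn fun h0 => hv ?_
    exact hσ.injective _ hy (h0.trans (map_zero _).symm)
  filter_upwards [(continuousAt_extChartAt (I := 𝓡 n) q).eventually h2,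
    extChartAt_source_mem_nhds (I := 𝓡 n) q] with y hyq hys hle
  rw [Function.comp_apply, Function.comp_apply, hinv, (extChartAt (𝓡 n) q).left_inv hys] at hyq
  have := congrArg (extChartAt (𝓡 n) q).symm (hyq hle)
  rwa [hinv, (extChartAt (𝓡 n) q).left_inv hys] at this

/-- The local structure of the sublevel sets of a function at a regular point. -/
lemma exists_joinedIn_of_grad_ne_zero (hf : ContMDiff (𝓡 n) 𝓘(ℝ, ℝ) ∞ f) {q : M}
    (hq : grad n f q ≠ 0) : ∃ W ∈ 𝓝 q,
      (∀ y ∈ W, f y ≤ f q → y ∈ closure {z | f z < f q}) ∧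
      ∀ y ∈ W, ∀ z ∈ W, f y < f q → f z < f q → JoinedIn {z | f z < f q} y z := by
  have hσ := isParamOn_extChartAt_symm (n := n) q
  have hy := mem_extChartAt_target (I := 𝓡 n) q
  have hinv := extChartAt_to_inv (I := 𝓡 n) q
  have hmd : MDifferentiable (𝓡 n) 𝓘(ℝ, ℝ) f := hf.mdifferentiable (by simp)
  have hF : ContDiffAt ℝ ∞ (f ∘ (extChartAt (𝓡 n) q).symm) (extChartAt (𝓡 n) q q) := by
    rw [← contMDiffAt_iff_contDiffAt]
    exact (hf _).comp _ (hσ.contMDiffAt hy)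
  have h1 : fderiv ℝ (f ∘ (extChartAt (𝓡 n) q).symm) (extChartAt (𝓡 n) q q) ≠ 0 := fun h => by
    rw [hσ.fderiv_comp_eq_zero_iff hmd hy, hinv] at h
    exact hq h
  obtain ⟨W, hW, hWU, hcl, hj⟩ := exists_joinedIn_of_fderiv_ne_zero (hF.of_le (by decide)) h1
    (hσ.isOpen.mem_nhds hy)
  rw [Function.comp_apply, hinv] at hcl hj
  have hcont := continuousOn_extChartAt_symm (I := 𝓡 n) q
  have himage : (extChartAt (𝓡 n) q).symm '' ((extChartAt (𝓡 n) q).target ∩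
      {z | (f ∘ (extChartAt (𝓡 n) q).symm) z < f q}) ⊆ {z | f z < f q} := by
    rintro _ ⟨z, hz, rfl⟩
    exact hz.2
  refine ⟨extChartAt (𝓡 n) q ⁻¹' W ∩ (extChartAt (𝓡 n) q).source,
    inter_mem ((continuousAt_extChartAt (I := 𝓡 n) q).preimage_mem_nhds hW)
      (extChartAt_source_mem_nhds (I := 𝓡 n) q), fun y hyW hyq => ?_, fun y hyW z hzW hyq hzq => ?_⟩
  · have hl := (extChartAt (𝓡 n) q).left_inv hyW.2
    have h3 := hcl _ hyW.1 (by rwa [Function.comp_apply, hl])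
    have h4 := hcont.continuousAt (hσ.isOpen.mem_nhds (hWU hyW.1))
    have h5 := closure_mono himage (mem_closure_image h4 h3)
    rwa [hl] at h5
  · have hly := (extChartAt (𝓡 n) q).left_inv hyW.2
    have hlz := (extChartAt (𝓡 n) q).left_inv hzW.2
    obtain ⟨p, hp⟩ := hj _ hyW.1 _ hzW.1 (by rwa [Function.comp_apply, hly])
      (by rwa [Function.comp_apply, hlz])
    have : PathConnectedSpace unitInterval := isPathConnected_iff_pathConnectedSpace.mp
      ((convex_Icc (0 : ℝ) 1).isPathConnected (nonempty_Icc.mpr zero_le_one))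
    have hpc := (isPathConnected_range p.continuous).image' (hcont.mono (by
      rintro _ ⟨t, rfl⟩
      exact (hp t).1))
    have h6 := hpc.joinedIn _ ⟨_, ⟨0, p.source⟩, hly⟩ _ ⟨_, ⟨1, p.target⟩, hlz⟩
    refine h6.mono (Subset.trans (image_mono ?_) himage)
    rintro _ ⟨t, rfl⟩
    exact hp t

end Riemannian


/-! ### Bounds for the potential of the soliton. -/

section Soliton

variable {n : ℕ} {M : Type*} [MetricSpace M]
  [ChartedSpace (EuclideanSpace ℝ (Fin n)) M] [IsManifold (𝓡 n) ∞ M]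
  [RiemannianBundle (fun x : M => TangentSpace (𝓡 n) x)]
  [IsContMDiffRiemannianBundle (𝓡 n) ∞ (EuclideanSpace ℝ (Fin n))
    (fun x : M => TangentSpace (𝓡 n) x)]
  [IsRiemannianManifold (𝓡 n) M]

variable {f : M → ℝ} {O : M}

lemma properSpace_of_isRiemannianManifold (n : ℕ) (M : Type*) [MetricSpace M]
    [ChartedSpace (EuclideanSpace ℝ (Fin n)) M] [IsManifold (𝓡 n) ∞ M]
    [RiemannianBundle (fun x : M => TangentSpace (𝓡 n) x)]
    [IsContMDiffRiemannianBundle (𝓡 n) ∞ (EuclideanSpace ℝ (Fin n))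
      (fun x : M => TangentSpace (𝓡 n) x)]
    [IsRiemannianManifold (𝓡 n) M] [CompleteSpace M] : ProperSpace M := by
  have := ChartedSpace.locallyCompactSpace (EuclideanSpace ℝ (Fin n)) M
  exact properSpace_of_exists_dist_le_dist_lt fun _ _ _ _ h₁ h₂ h =>
    exists_dist_le_dist_lt n h₁ h₂ h

/-- If the scalar curvature attains its maximum `1` at `O`, then `|∇f|² = 1 - R`. -/
lemma norm_grad_sq_eq (hf : IsGradientRicciSoliton n f) (hsec : HasPositiveSectionalCurvature n M)
    (hmax : ∀ q : M, scalar n q ≤ scalar n O) (hone : scalar n O = 1) (q : M) :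
    ‖grad n f q‖ ^ 2 = 1 - scalar n q := by
  have hn : 2 ≤ n := two_le_of_scalar_ne_zero (p := O) (by rw [hone]; exact one_ne_zero)
  have h1 := hamiltonQuantity_eq hf q O
  rw [hamiltonQuantity, hamiltonQuantity, hone,
    grad_eq_zero_of_isLocalMax_scalar hf hsec hn hmax, norm_zero] at h1
  linarith

lemma norm_grad_lt_one (hf : IsGradientRicciSoliton n f)
    (hsec : HasPositiveSectionalCurvature n M)
    (hmax : ∀ q : M, scalar n q ≤ scalar n O) (hone : scalar n O = 1) (q : M) :
    ‖grad n f q‖ < 1 := by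
  have hn : 2 ≤ n := two_le_of_scalar_ne_zero (p := O) (by rw [hone]; exact one_ne_zero)
  have h1 := norm_grad_sq_eq hf hsec hmax hone q
  have h2 := scalar_pos hsec hn q
  exact lt_of_pow_lt_pow_left₀ 2 zero_le_one (by linarith)

/-- The gradient of the potential has norm close to `1` outside of a bounded set. -/
lemma exists_dist_le_of_norm_grad_le (hf : IsGradientRicciSoliton n f)
    (hsec : HasPositiveSectionalCurvature n M)
    (hmax : ∀ q : M, scalar n q ≤ scalar n O) (hone : scalar n O = 1)
    (hinf : Tendsto (fun q : M => scalar n q) (Bornology.cobounded M) (𝓝 0)) {κ : ℝ} (hκ0 : 0 ≤ κ)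
    (hκ : κ < 1) : ∃ s₀, 0 ≤ s₀ ∧ ∀ q, ‖grad n f q‖ ≤ κ → dist O q ≤ s₀ := by
  have h1 : ∀ᶠ q in Bornology.cobounded M, scalar n q < 1 - κ ^ 2 :=
    hinf.eventually_lt_const (by nlinarith)
  have h2 : Bornology.IsBounded {q : M | ¬ scalar n q < 1 - κ ^ 2} :=
    Bornology.isBounded_def.mpr (mem_of_superset h1 fun q hq => not_not.mpr hq)
  obtain ⟨r, hr⟩ := h2.subset_closedBall O
  refine ⟨max r 0, le_max_right _ _, fun q hq => ?_⟩
  have h3 := norm_grad_sq_eq hf hsec hmax hone q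
  have h4 : ‖grad n f q‖ ^ 2 ≤ κ ^ 2 := pow_le_pow_left₀ (norm_nonneg _) hq 2
  have h5 : q ∈ Metric.closedBall O r := hr (show ¬ scalar n q < 1 - κ ^ 2 by linarith)
  rw [Metric.mem_closedBall'] at h5
  exact h5.trans (le_max_left _ _)

/-- The mountain pass principle applies: all critical points are strict local minima as `Hess f =
Ric > 0`, and the points with `|∇f| ≤ 1/2` are bounded since `|∇f|² = 1 - R → 1`. -/
lemma potential_nonneg [CompleteSpace M] (hf : IsGradientRicciSoliton n f)
    (hsec : HasPositiveSectionalCurvature n M)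
    (hmax : ∀ q : M, scalar n q ≤ scalar n O) (hone : scalar n O = 1)
    (hinf : Tendsto (fun q : M => scalar n q) (Bornology.cobounded M) (𝓝 0))
    (hfO : f O = 0) (p : M) : 0 ≤ f p := by
  have hn : 2 ≤ n := two_le_of_scalar_ne_zero (p := O) (by rw [hone]; exact one_ne_zero)
  have := properSpace_of_isRiemannianManifold n M
  have := ChartedSpace.locallyPathConnectedSpace (EuclideanSpace ℝ (Fin n)) M
  have : PathConnectedSpace M := ⟨⟨O⟩, joined_of_isRiemannianManifold n⟩
  obtain ⟨s₀, -, hs₀⟩ := exists_dist_le_of_norm_grad_le hf hsec hmax hone hinf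
    (κ := 1 / 2) (by norm_num) (by norm_num)
  have hO := hf.eventually_eq_of_le hsec hn (grad_eq_zero_of_isLocalMax_scalar hf hsec hn hmax)
  rw [hfO] at hO
  refine nonneg_of_strictLocalMin hf.smooth.continuous hfO hO (fun q => ?_) (fun q => ?_)
    (fun q hq => hs₀ q (norm_grad_le_of_eventually_le hf.mdifferentiable (by norm_num) hq)) p
  · by_cases hq : grad n f q = 0
    · refine ⟨_, hf.eventually_eq_of_le hsec hn hq, fun y hy z _ hyq _ => ?_⟩
      have : y = q := hy hyq.le
      rw [this] at hyq
      exact absurd hyq (lt_irrefl _)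
    · obtain ⟨W, hW, -, h⟩ := exists_joinedIn_of_grad_ne_zero hf.smooth hq
      exact ⟨W, hW, h⟩
  · by_cases hq : grad n f q = 0
    · filter_upwards [hf.eventually_eq_of_le hsec hn hq] with y hy hyq hne
      exact absurd (hy hyq) hne
    · obtain ⟨W, hW, h, -⟩ := exists_joinedIn_of_grad_ne_zero hf.smooth hq
      filter_upwards [hW] with y hy hyq _ using h y hy hyq

/-- A minimizer `q` of `f + κ d(p, ·)` has `|∇f(q)| ≤ κ`, hence `d(O, q) ≤ s₀`. Comparing values at
`q` and `p` and using `f q ≥ 0` gives the bound. -/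
lemma exists_mul_sub_le_potential [CompleteSpace M] (hf : IsGradientRicciSoliton n f)
    (hsec : HasPositiveSectionalCurvature n M)
    (hmax : ∀ q : M, scalar n q ≤ scalar n O) (hone : scalar n O = 1)
    (hinf : Tendsto (fun q : M => scalar n q) (Bornology.cobounded M) (𝓝 0))
    (hfO : f O = 0) {κ : ℝ} (hκ0 : 0 < κ) (hκ : κ < 1) :
    ∃ s₀, 0 ≤ s₀ ∧ ∀ p, κ * (dist O p - s₀) ≤ f p := by
  have := properSpace_of_isRiemannianManifold n M
  obtain ⟨s₀, hs₀, h⟩ := exists_dist_le_of_norm_grad_le hf hsec hmax hone hinf hκ0.le hκ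
  have hnn := potential_nonneg hf hsec hmax hone hinf hfO
  refine ⟨s₀, hs₀, fun p => ?_⟩
  -- Outside the ball of radius `f p / κ` the term `κ d(p, ·)` alone exceeds `f p`; since `f ≥ 0`,
  -- the minimum over the compact ball is global.
  obtain ⟨q, hq, hm⟩ := (isCompact_closedBall p (f p / κ)).exists_isMinOn
    ⟨p, Metric.mem_closedBall_self (div_nonneg (hnn p) hκ0.le)⟩
    (f := fun z => f z + κ * dist p z) (hf.smooth.continuous.add
      (continuous_const.mul (continuous_const.dist continuous_id))).continuousOn
  have hqp : f q + κ * dist p q ≤ f p := by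
    have : f q + κ * dist p q ≤ f p + κ * dist p p :=
      hm (Metric.mem_closedBall_self (div_nonneg (hnn p) hκ0.le))
    simpa using this
  have hglob : ∀ z, f q + κ * dist p q ≤ f z + κ * dist p z := fun z => by
    by_cases hz : z ∈ Metric.closedBall p (f p / κ)
    · exact hm hz
    · rw [Metric.mem_closedBall', not_le, div_lt_iff₀ hκ0] at hz
      have := hnn z
      linarith
  have hgrad := h q (norm_grad_le_of_eventually_le hf.mdifferentiable hκ0.le
    (Eventually.of_forall fun z => by
      have h1 := hglob z
      have h2 := mul_le_mul_of_nonneg_left (dist_triangle p q z) hκ0.le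
      linarith))
  have h1 := mul_le_mul_of_nonneg_left (dist_triangle O q p) hκ0.le
  have h2 := mul_le_mul_of_nonneg_left hgrad hκ0.le
  have h3 := hnn q
  rw [dist_comm q p] at h1
  linarith

lemma exists_le_potential [CompleteSpace M] (hf : IsGradientRicciSoliton n f)
    (hsec : HasPositiveSectionalCurvature n M)
    (hmax : ∀ q : M, scalar n q ≤ scalar n O) (hone : scalar n O = 1)
    (hinf : Tendsto (fun q : M => scalar n q) (Bornology.cobounded M) (𝓝 0))
    (hfO : f O = 0) {δ : ℝ} (hδ : 0 < δ) :
    ∃ s₀, 0 < s₀ ∧ ∀ p, s₀ ≤ dist O p → (1 - δ) * dist O p ≤ f p := by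
  -- The restriction `η ≤ 1` keeps the slope `κ = 1 - η / 2` in `(0, 1)`. The constant `κ s₀` is
  -- absorbed by the remaining `(η / 2) d` once `d ≥ 2 s₀ / η`.
  have key : ∀ η : ℝ, 0 < η → η ≤ 1 →
      ∃ s₀, 0 < s₀ ∧ ∀ p, s₀ ≤ dist O p → (1 - η) * dist O p ≤ f p := fun η h0 h1 => by
    obtain ⟨s₀, hs₀, h⟩ := exists_mul_sub_le_potential hf hsec hmax hone hinf hfO
      (κ := 1 - η / 2) (by linarith) (by linarith)
    refine ⟨2 * s₀ / η + 1, by positivity, fun p hp => le_trans ?_ (h p)⟩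
    have h2 : 2 * s₀ / η ≤ dist O p := by linarith
    rw [div_le_iff₀ h0] at h2
    have h3 : 0 ≤ η * s₀ := by positivity
    nlinarith
  obtain ⟨s₀, hs₀, h⟩ := key (min δ 1) (lt_min hδ one_pos) (min_le_right _ _)
  refine ⟨s₀, hs₀, fun p hp => le_trans ?_ (h p hp)⟩
  exact mul_le_mul_of_nonneg_right (by linarith [min_le_left δ 1]) dist_nonneg

/-- The bound `|∇f| < 1` integrated along almost minimizing curves gives only `f ≤ d`. Strictness
comes from `∇f(O) = 0`, which makes the slope at most `1/2` near `O`. -/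
lemma exists_potential_lt_dist (hf : IsGradientRicciSoliton n f)
    (hsec : HasPositiveSectionalCurvature n M)
    (hmax : ∀ q : M, scalar n q ≤ scalar n O) (hone : scalar n O = 1) (hfO : f O = 0) :
    ∃ r, 0 < r ∧ ∀ p, r ≤ dist O p → f p < dist O p := by
  have hsm : ContMDiff (𝓡 n) 𝓘(ℝ, ℝ) 1 f := hf.smooth.of_le (by decide)
  have hO : ‖grad n f O‖ ^ 2 < 1 / 4 := by
    rw [norm_grad_sq_eq hf hsec hmax hone, hone]
    norm_num
  obtain ⟨r, hr, hrs⟩ := Metric.eventually_nhds_iff.mp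
    ((continuous_norm_grad_sq hf.smooth).continuousAt.eventually_lt continuousAt_const hO)
  refine ⟨r, hr, fun p hp => ?_⟩
  -- An almost geodesic splitting at distance `r / 2` with slack `r / 8`: `f` gains at most `r / 4`
  -- up to `z` and less than `d - r / 2 + r / 8` afterwards, in total less than `d - r / 8`.
  obtain ⟨z, hz1, hz2⟩ := exists_dist_le_dist_lt n (x := O) (y := p) (r₁ := r / 2)
    (r₂ := dist O p - r / 2 + r / 8) (by positivity) (by linarith) (by linarith)
  have h1 := abs_sub_le_of_norm_grad_le (n := n) hsm (x := O) (y := z) (C := 1 / 2) (r := r)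
    (fun w hw => by
      have h2 : ‖grad n f w‖ ^ 2 < 1 / 4 := hrs (by rwa [dist_comm])
      exact le_of_lt (lt_of_pow_lt_pow_left₀ 2 (by norm_num) (by linarith)))
    (by norm_num) (by linarith)
  have h2 := abs_sub_le_of_norm_grad_le (n := n) hsm (x := z) (y := p) (C := 1)
    (r := dist z p + 1) (fun w _ => (norm_grad_lt_one hf hsec hmax hone w).le) zero_le_one
    (lt_add_one _)
  have h3 := (abs_le.mp h1).2
  have h4 := (abs_le.mp h2).2
  rw [hfO] at h3
  linarith

end Soliton

/-! ### Convexity of the potential along geodesics, and the angle. -/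

section Geodesic

variable {n : ℕ} {M : Type*} [MetricSpace M]
  [ChartedSpace (EuclideanSpace ℝ (Fin n)) M] [IsManifold (𝓡 n) ∞ M]
  [RiemannianBundle (fun x : M => TangentSpace (𝓡 n) x)]
  [IsContMDiffRiemannianBundle (𝓡 n) ∞ (EuclideanSpace ℝ (Fin n))
    (fun x : M => TangentSpace (𝓡 n) x)]

variable {f : M → ℝ}

lemma contDiffAt_extChartAt_comp {γ : ℝ → M} {t : ℝ} (hγ : ContMDiffAt 𝓘(ℝ, ℝ) (𝓡 n) ∞ γ t) :
    ContDiffAt ℝ ∞ (extChartAt (𝓡 n) (γ t) ∘ γ) t := by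
  rw [← contMDiffAt_iff_contDiffAt]
  exact (contMDiffAt_extChartAt (I := 𝓡 n) (n := ∞)).comp t hγ

lemma coords_velocity {γ : ℝ → M} {t : ℝ} (hγ : ContMDiffAt 𝓘(ℝ, ℝ) (𝓡 n) ∞ γ t) :
    coords n (γ t) (velocity n γ t) = deriv (extChartAt (𝓡 n) (γ t) ∘ γ) t := by
  have := isManifold_one (n := n) (M := M)
  have h := mfderiv_comp (I'' := 𝓘(ℝ, EuclideanSpace ℝ (Fin n))) t
    (mdifferentiableAt_extChartAt (I := 𝓡 n) (mem_chart_source _ (γ t)))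
    (hγ.mdifferentiableAt (by simp))
  rw [← fderiv_apply_one_eq_deriv, ← mfderiv_eq_fderiv]
  exact (congrArg (fun L => L 1) h).symm

/-- The second derivative of a function along a geodesic is its Hessian. -/
lemma hasDerivAt_deriv_comp_geodesic (hf : ContMDiff (𝓡 n) 𝓘(ℝ, ℝ) ∞ f) {γ : ℝ → M} {t : ℝ}
    (hγ : ContMDiffAt 𝓘(ℝ, ℝ) (𝓡 n) ∞ γ t) (hacc : acceleration n γ t = 0) :
    HasDerivAt (deriv (f ∘ γ)) (hessian n f (γ t) (velocity n γ t) (velocity n γ t)) t := by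
  set φ := extChartAt (𝓡 n) (γ t) with hφ
  set x := φ ∘ γ with hx
  have hxc : ContDiffAt ℝ ∞ x t := contDiffAt_extChartAt_comp hγ
  have hσ := isParamOn_extChartAt_symm (n := n) (γ t)
  have hy := mem_extChartAt_target (I := 𝓡 n) (γ t)
  set F := f ∘ φ.symm with hFdef
  have hF : ContDiffAt ℝ ∞ F (x t) := by
    rw [← contMDiffAt_iff_contDiffAt]
    exact (hf _).comp _ (hσ.contMDiffAt hy)
  have hfx : f ∘ γ =ᶠ[𝓝 t] F ∘ x := by
    filter_upwards [hγ.continuousAt.eventually (extChartAt_source_mem_nhds (I := 𝓡 n) (γ t))]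
      with s hs
    simp only [hFdef, hx, Function.comp_apply]
    rw [φ.left_inv hs]
  have hFd : ∀ᶠ s in 𝓝 t, DifferentiableAt ℝ F (x s) :=
    hxc.continuousAt.eventually (((hF.of_le (show (1 : ℕ∞ω) ≤ ∞ by decide)).eventually
      (by simp)).mono fun y hy => hy.differentiableAt (by simp))
  have hxd : ∀ᶠ s in 𝓝 t, DifferentiableAt ℝ x s :=
    (((hxc.of_le (show (1 : ℕ∞ω) ≤ ∞ by decide)).eventually
      (by simp)).mono fun y hy => hy.differentiableAt (by simp))
  have hder : deriv (f ∘ γ) =ᶠ[𝓝 t] fun s => fderiv ℝ F (x s) (deriv x s) := by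
    refine hfx.deriv.trans ?_
    filter_upwards [hFd, hxd] with s h1 h2
    exact (h1.hasFDerivAt.comp_hasDerivAt s h2.hasDerivAt).deriv
  have hx1 : HasDerivAt x (deriv x t) t := hxd.self_of_nhds.hasDerivAt
  have hx2 : HasDerivAt (deriv x) (deriv (deriv x) t) t := by
    have h1 : ContDiffAt ℝ 1 (deriv x) t := by
      have h2 : ContDiffAt ℝ 1 (fun s => fderiv ℝ x s 1) t :=
        (hxc.fderiv_right (m := 1) (by decide)).clm_apply contDiffAt_const
      simpa using h2
    exact (h1.differentiableAt one_ne_zero).hasDerivAt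
  have hDF : HasFDerivAt (fderiv ℝ F) (fderiv ℝ (fderiv ℝ F) (x t)) (x t) :=
    ((hF.fderiv_right (m := 1) (by decide)).differentiableAt one_ne_zero).hasFDerivAt
  have hmain := (hDF.comp_hasDerivAt t hx1).clm_apply hx2
  refine (hmain.congr_of_eventuallyEq hder).congr_deriv ?_
  -- The geodesic equation replaces `x''` by `-Γ(x', x')`, which is exactly the Christoffel
  -- correction in the Hessian.
  have hacc' : deriv (deriv x) t = - christoffel n (γ t) (x t) (deriv x t) (deriv x t) :=
    eq_neg_of_add_eq_zero_left hacc
  rw [hacc', hessian, coords_velocity hγ, map_neg, ← sub_eq_add_neg]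
  rfl

/-- A soliton potential with nonnegative Ricci curvature is convex along a geodesic: its slope at
the end is at least its average slope. -/
lemma sub_le_inner_grad_velocity (hf : IsGradientRicciSoliton n f)
    (hric : ∀ (p : M) (X : TangentSpace (𝓡 n) p), 0 ≤ ricci n p X X) {γ : ℝ → M} {s : ℝ}
    (hs : 0 < s) (hγ : IsMinimizingGeodesic n γ s) :
    f (γ s) - f (γ 0) ≤ inner ℝ (grad n f (γ s)) (velocity n γ s) * s := by
  have h1 : ∀ t ∈ Icc 0 s, HasDerivAt (f ∘ γ) (inner ℝ (grad n f (γ t)) (velocity n γ t)) t :=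
    fun t ht => hasDerivAt_comp_curve (hf.mdifferentiable _)
      ((hγ.smooth t ht).mdifferentiableAt (by simp))
  have h2 : ∀ t ∈ Icc 0 s, HasDerivAt (deriv (f ∘ γ))
      (hessian n f (γ t) (velocity n γ t) (velocity n γ t)) t := fun t ht =>
    hasDerivAt_deriv_comp_geodesic hf.smooth (hγ.smooth t ht) (hγ.geodesic t ht)
  have hmono : MonotoneOn (deriv (f ∘ γ)) (Icc 0 s) := by
    refine monotoneOn_of_deriv_nonneg (convex_Icc 0 s)
      (fun t ht => (h2 t ht).continuousAt.continuousWithinAt) (fun t ht => ?_) fun t ht => ?_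
    · rw [interior_Icc] at ht
      exact (h2 t (Ioo_subset_Icc_self ht)).differentiableAt.differentiableWithinAt
    · rw [interior_Icc] at ht
      rw [(h2 t (Ioo_subset_Icc_self ht)).deriv, ← hf.ricci_eq]
      exact hric _ _
  obtain ⟨ξ, hξ, he⟩ := exists_deriv_eq_slope (f ∘ γ) hs
    (fun t ht => (h1 t ht).continuousAt.continuousWithinAt)
    fun t ht => (h1 t (Ioo_subset_Icc_self ht)).differentiableAt.differentiableWithinAt
  have h3 := hmono (Ioo_subset_Icc_self hξ) (right_mem_Icc.mpr hs.le) hξ.2.le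
  rw [he, (h1 s (right_mem_Icc.mpr hs.le)).deriv, sub_zero, div_le_iff₀ hs] at h3
  exact h3

/-- Since `|∇f| < 1`, normalizing the gradient can only increase its positive inner product with the
unit vector `X`. The restriction `ε ≤ π / 2` guarantees that positivity. -/
lemma angle_outwardNormal_lt {p : M} {X : TangentSpace (𝓡 n) p} (hX : ‖X‖ = 1)
    (hg : ‖grad n f p‖ < 1) {ε : ℝ} (hε : 0 < ε) (hε' : ε ≤ Real.pi / 2)
    (h : Real.cos ε < inner ℝ (grad n f p) X) :
    InnerProductGeometry.angle (outwardNormal n f p) X < ε := by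
  have hpi := Real.pi_pos
  have hcos : 0 ≤ Real.cos ε := Real.cos_nonneg_of_mem_Icc ⟨by linarith, hε'⟩
  have hg0 : 0 < ‖grad n f p‖ := by
    refine norm_pos_iff.mpr fun h0 => ?_
    rw [h0, inner_zero_left] at h
    linarith
  have h1 : inner ℝ (grad n f p) X ≤ ‖grad n f p‖ := by
    simpa [hX] using real_inner_le_norm (grad n f p) X
  rw [outwardNormal, InnerProductGeometry.angle_smul_left_of_pos _ _ (inv_pos.mpr hg0),
    InnerProductGeometry.angle, hX, mul_one]
  have h2 : Real.cos ε < inner ℝ (grad n f p) X / ‖grad n f p‖ := by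
    rw [lt_div_iff₀ hg0]
    nlinarith
  have h3 : inner ℝ (grad n f p) X / ‖grad n f p‖ ≤ 1 := by
    rw [div_le_one hg0]
    exact h1
  calc Real.arccos (inner ℝ (grad n f p) X / ‖grad n f p‖)
      < Real.arccos (Real.cos ε) := Real.arccos_lt_arccos (by linarith) h2 h3
    _ = ε := Real.arccos_cos hε.le (by linarith)

end Geodesic

end GradientSoliton

end

/-! ### Conclusion. -/

theorem corollary3p3 {n : ℕ} {M : Type*} [MetricSpace M]
    [ChartedSpace (EuclideanSpace ℝ (Fin n)) M] [IsManifold (𝓡 n) ∞ M]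
    [RiemannianBundle (fun x : M => TangentSpace (𝓡 n) x)]
    [IsContMDiffRiemannianBundle (𝓡 n) ∞ (EuclideanSpace ℝ (Fin n))
      (fun x : M => TangentSpace (𝓡 n) x)]
    [IsRiemannianManifold (𝓡 n) M] [CompleteSpace M]
    (f : M → ℝ) (O : M)
    (hsoliton : GradientSoliton.IsGradientRicciSoliton n f)
    (hsec : GradientSoliton.HasPositiveSectionalCurvature n M)
    (hmax : ∀ q : M, GradientSoliton.scalar n q ≤ GradientSoliton.scalar n O)
    (hone : GradientSoliton.scalar n O = 1)
    (hinf : Tendsto (fun q : M => GradientSoliton.scalar n q) (Bornology.cobounded M) (𝓝 0))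
    (hfO : f O = 0) :
    (∀ δ : ℝ, 0 < δ → ∃ sbar : ℝ, 0 < sbar ∧ ∀ p : M, sbar ≤ dist O p →
      (1 - δ) * dist O p ≤ f p ∧ f p < dist O p) ∧
    (∀ ε : ℝ, 0 < ε → ∃ sbar : ℝ, 0 < sbar ∧ ∀ (γ : ℝ → M) (s : ℝ),
      GradientSoliton.IsMinimizingGeodesic n γ s → γ 0 = O → sbar ≤ s →
        InnerProductGeometry.angle (GradientSoliton.outwardNormal n f (γ s))
          (GradientSoliton.velocity n γ s) < ε) := by
  have hn : 2 ≤ n := GradientSoliton.two_le_of_scalar_ne_zero (p := O) (by simp [hone])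
  refine ⟨fun δ hδ => ?_, fun ε hε => ?_⟩
  · obtain ⟨s₁, hs₁, h₁⟩ :=
      GradientSoliton.exists_le_potential hsoliton hsec hmax hone hinf hfO hδ
    obtain ⟨s₂, hs₂, h₂⟩ :=
      GradientSoliton.exists_potential_lt_dist hsoliton hsec hmax hone hfO
    exact ⟨max s₁ s₂, lt_max_of_lt_left hs₁, fun p hp =>
      ⟨h₁ p ((le_max_left _ _).trans hp), h₂ p ((le_max_right _ _).trans hp)⟩⟩
  · have hpi := Real.pi_pos
    -- The angle is capped at `π / 2` so that its cosine is nonnegative.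
    set η := min ε (Real.pi / 2) with hη
    have hη0 : 0 < η := lt_min hε (by linarith)
    have hηpi : η ≤ Real.pi / 2 := min_le_right _ _
    have hcos : Real.cos η < 1 := by
      have := Real.cos_lt_cos_of_nonneg_of_le_pi_div_two le_rfl hηpi hη0
      rwa [Real.cos_zero] at this
    -- With this `δ`, the slope `1 - δ` is the midpoint of `cos η` and `1`, hence larger than `cos
    -- η`.
    obtain ⟨s₁, hs₁, h₁⟩ := GradientSoliton.exists_le_potential hsoliton hsec hmax hone hinf hfO
      (δ := (1 - Real.cos η) / 2) (by linarith)
    refine ⟨s₁, hs₁, fun γ s hγ hγ0 hs => ?_⟩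
    have hs0 : 0 < s := hs₁.trans_le hs
    have hdist : dist O (γ s) = s := by rw [← hγ0, hγ.minimizing]
    have h2 := h₁ (γ s) (by rwa [hdist])
    have hric : ∀ (p : M) (X : TangentSpace (𝓡 n) p), 0 ≤ GradientSoliton.ricci n p X X :=
      fun p X => GradientSoliton.ricci_nonneg hsec hn X
    have h3 := GradientSoliton.sub_le_inner_grad_velocity hsoliton hric hs0 hγ
    rw [hγ0, hfO, sub_zero] at h3
    rw [hdist] at h2
    -- Dividing `(1 - δ) s ≤ f(γ(s)) ≤ ⟨∇f, γ'(s)⟩ s` by `s` bounds the radial slope from below.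
    have h4 := le_of_mul_le_mul_right (h2.trans h3) hs0
    exact (GradientSoliton.angle_outwardNormal_lt (hγ.unit_speed s ⟨hs0.le, le_rfl⟩)
      (GradientSoliton.norm_grad_lt_one hsoliton hsec hmax hone _) hη0 hηpi
      (by linarith)).trans_le (min_le_left _ _)
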